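/- Let $(f_k)_{k\ge 0}$ be complex numbers such that $f(z)=\sum_{n\ge0} f_{2n}z^n$ and $g(z)=\sum_{n\ge0} f_{2n+1}z^n$ are entire functions of genus $0$ all of whose zeros are negative real numbers (i.e. $f(z)=f_0\prod_\nu(1+z/a_\nu)$ and $g(z)=f_1\prod_\mu(1+z/b_\mu)$ are finite, possibly empty, or infinite products with $f_0,f_1\ne0$, $a_\nu,b_\mu>0$, $\sum 1/a_\nu<\infty$, $\sum1/b_\mu<\infty$). Put $$h(z)=\sum_{k\ge0} i^{\frac{k(k-1)}2}f_kz^k,\qquad \overline h(z)=\sum_{k\ge0} i^{-\frac{k(k-1)}2}f_kz^k,$$ and let $\mu$ be a square root of $i$. Let either $H(z)=h(\overline\mu z)$ and $\alpha=-\overline\mu f_1/f_0$, or $H(z)=\overline h(\mu z)$ and $\alpha=-\mu f_1/f_0$. Then the zeros of $H$, each repeated according to its multiplicity, can be listed as $(z_n)_{n=1}^{\omega}$, $\omega\le\infty$, with $|z_1|\le|z_2|\le\cdots$, and for every such list the following holds, where each relation is asserted whenever the members of the list occurring in it exist, and $Q_s=\{z\ne0: 0<\operatorname{Arg}(ze^{-i\pi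 s/2})<\pi/2\}$, $s\in\mathbb Z$, are the open quadrants ($Q_{s+4}=Q_s$; $-\pi<\operatorname{Arg}\le\pi$). (i) If $\operatorname{Im}\alpha^2\ne0$, then all zeros are simple, $0<|z_1|<|z_2|<\cdots$, $\operatorname{Im}z_n^2\ne0$ for all $n$, and $z_n\in Q_l$ implies $z_{n+1}\in Q_{l+\operatorname{sign}(\operatorname{Im}\alpha^2)}$. Moreover, $\operatorname{Im}\alpha\,\operatorname{Im}z_1<0$ and $\operatorname{Im}\alpha^2\,\operatorname{Re}z_1\operatorname{Im}z_1<0$. (ii) If $\operatorname{Im}\alpha=0$, then $0<|z_1|\le|z_2|<|z_3|\le|z_4|<|z_5|\le\cdots$, there are no purely imaginary zeros, real zeros are simple or double, and all other zeros are simple. Moreover, for each $n\ge1$: $|z_{2n-1}|=|z_{2n}|$ implies $z_{2n-1}=\overline{z_{2n}}$; $|z_{2n-1}|<|z_{2n}|$ implies $\operatorname{Arg}z_{2n-1}=\operatorname{Arg}z_{2n}\in\{0,\pi\}$; $\operatorname{Re}z_{2n}\operatorname{Re}z_{2n+1}<0$; and $\alpha\operatorname{Re}z_1>0$. (iii) If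 $\operatorname{Re}\alpha=0$, then $0<|z_1|<|z_2|\le|z_3|<|z_4|\le|z_5|<\cdots$, there are no real zeros, purely imaginary zeros are simple or double, and all other zeros are simple. Moreover, for each $n\ge1$: $|z_{2n}|=|z_{2n+1}|$ implies $z_{2n}=-\overline{z_{2n+1}}$; $|z_{2n}|<|z_{2n+1}|$ implies $\operatorname{Arg}z_{2n}=\operatorname{Arg}z_{2n+1}\in\{-\tfrac\pi2,\tfrac\pi2\}$; $\operatorname{Im}z_{2n-1}\operatorname{Im}z_{2n}<0$; $\operatorname{Im}\alpha\operatorname{Im}z_1<0$ and $\operatorname{Re}z_1=0$. -/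

import Mathlib

open Complex

/-- `f` is an entire function of genus zero: up to a nonzero constant factor and a power of `z`,
it is a finite or infinite product `∏ (1 - z / a i)` over its nonzero zeros, repeated according
to multiplicity, where `∑ 1 / |a i|` converges. (Summability forces the family to be countable;
the empty family is allowed.) -/
def IsEntireGenusZero (f : ℂ → ℂ) : Prop :=
  ∃ (C : ℂ) (m : ℕ) (ι : Type) (a : ι → ℂ),
    C ≠ 0 ∧ (∀ i, a i ≠ 0) ∧ Summable (fun i => ‖a i‖⁻¹) ∧
    ∀ z, f z = C * z ^ m * ∏' i, (1 - z / a i)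

/-- Every zero of `f` is a negative real number. -/
def HasOnlyNegativeZeros (f : ℂ → ℂ) : Prop :=
  ∀ z, f z = 0 → ∃ x : ℝ, x < 0 ∧ z = (x : ℂ)

/-- `h(z) = ∑ i^{k(k-1)/2} c_k z^k`. -/
noncomputable def twistedSeries (c : ℕ → ℂ) (z : ℂ) : ℂ :=
  ∑' k : ℕ, I ^ (k * (k - 1) / 2) * c k * z ^ k

/-- `h̄(z) = ∑ i^{-k(k-1)/2} c_k z^k`. -/
noncomputable def twistedSeriesBar (c : ℕ → ℂ) (z : ℂ) : ℂ :=
  ∑' k : ℕ, (I ^ (k * (k - 1) / 2))⁻¹ * c k * z ^ k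

/-- The open quadrants `Q_s`, numbered anticlockwise with `Q_0` the first one and
`Q_{s+4} = Q_s`: the points `z` with `0 < Arg (z e^{-iπs/2}) < π/2`. -/
def quadrant (s : ℤ) : Set ℂ :=
  {z | z ≠ 0 ∧ 0 < (z * I ^ (-s)).arg ∧ (z * I ^ (-s)).arg < Real.pi / 2}

/-- `z 1, z 2, …` (of length `ω ≤ ∞`; `z 0` and the values beyond `ω` are ignored) lists all zeros
of `H`, each one as many times as its multiplicity, in the order of nondecreasing absolute
values. -/
def IsZeroEnumeration (H : ℂ → ℂ) (ω : ℕ∞) (z : ℕ → ℂ) : Prop :=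
  (∀ n : ℕ, 1 ≤ n → ((n + 1 : ℕ) : ℕ∞) ≤ ω → ‖z n‖ ≤ ‖z (n + 1)‖) ∧
  ∀ w : ℂ, {n : ℕ | 1 ≤ n ∧ (n : ℕ∞) ≤ ω ∧ z n = w}.encard = analyticOrderAt H w

/-- The distribution of the zeros of `H` in the case `Im α² ≠ 0`. -/
def DistributedGeneric (H : ℂ → ℂ) (α : ℂ) (ω : ℕ∞) (z : ℕ → ℂ) : Prop :=
  (∀ w, H w = 0 → w ≠ 0 ∧ analyticOrderAt H w = 1 ∧ (w ^ 2).im ≠ 0) ∧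
  (∀ n : ℕ, 1 ≤ n → ((n + 1 : ℕ) : ℕ∞) ≤ ω →
    ‖z n‖ < ‖z (n + 1)‖ ∧
    ∀ l : ℤ, z n ∈ quadrant l →
      z (n + 1) ∈ quadrant (l + ((SignType.sign (α ^ 2).im : SignType) : ℤ))) ∧
  (1 ≤ ω → α.im * (z 1).im < 0 ∧ (α ^ 2).im * (z 1).re * (z 1).im < 0)

/-- The distribution of the zeros of `H` in the case `Im α = 0`. Here `n` runs from `0`, so that
the pairs are `(z 1, z 2), (z 3, z 4), …`. -/
def DistributedReal (H : ℂ → ℂ) (α : ℂ) (ω : ℕ∞) (z : ℕ → ℂ) : Prop :=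
  (∀ w, H w = 0 → w.re ≠ 0 ∧
    (w.im = 0 → analyticOrderAt H w = 1 ∨ analyticOrderAt H w = 2) ∧
    (w.im ≠ 0 → analyticOrderAt H w = 1)) ∧
  (∀ n : ℕ, ((2 * n + 2 : ℕ) : ℕ∞) ≤ ω →
    ‖z (2 * n + 1)‖ ≤ ‖z (2 * n + 2)‖ ∧
    (‖z (2 * n + 1)‖ = ‖z (2 * n + 2)‖ →
      z (2 * n + 1) = (starRingEnd ℂ) (z (2 * n + 2))) ∧
    (‖z (2 * n + 1)‖ < ‖z (2 * n + 2)‖ →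
      (z (2 * n + 1)).arg = (z (2 * n + 2)).arg ∧
      ((z (2 * n + 2)).arg = 0 ∨ (z (2 * n + 2)).arg = Real.pi))) ∧
  (∀ n : ℕ, ((2 * n + 3 : ℕ) : ℕ∞) ≤ ω →
    ‖z (2 * n + 2)‖ < ‖z (2 * n + 3)‖ ∧
    (z (2 * n + 2)).re * (z (2 * n + 3)).re < 0) ∧
  (1 ≤ ω → 0 < α.re * (z 1).re)

/-- The distribution of the zeros of `H` in the case `Re α = 0`. Here `n` runs from `0`, so that
after `z 1` come the pairs `(z 2, z 3), (z 4, z 5), …`. -/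
def DistributedImaginary (H : ℂ → ℂ) (α : ℂ) (ω : ℕ∞) (z : ℕ → ℂ) : Prop :=
  (∀ w, H w = 0 → w.im ≠ 0 ∧
    (w.re = 0 → analyticOrderAt H w = 1 ∨ analyticOrderAt H w = 2) ∧
    (w.re ≠ 0 → analyticOrderAt H w = 1)) ∧
  (∀ n : ℕ, ((2 * n + 3 : ℕ) : ℕ∞) ≤ ω →
    ‖z (2 * n + 2)‖ ≤ ‖z (2 * n + 3)‖ ∧
    (‖z (2 * n + 2)‖ = ‖z (2 * n + 3)‖ →
      z (2 * n + 2) = -(starRingEnd ℂ) (z (2 * n + 3))) ∧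
    (‖z (2 * n + 2)‖ < ‖z (2 * n + 3)‖ →
      (z (2 * n + 2)).arg = (z (2 * n + 3)).arg ∧
      ((z (2 * n + 3)).arg = -(Real.pi / 2) ∨ (z (2 * n + 3)).arg = Real.pi / 2))) ∧
  (∀ n : ℕ, ((2 * n + 2 : ℕ) : ℕ∞) ≤ ω →
    ‖z (2 * n + 1)‖ < ‖z (2 * n + 2)‖ ∧
    (z (2 * n + 1)).im * (z (2 * n + 2)).im < 0) ∧
  (1 ≤ ω → α.im * (z 1).im < 0 ∧ (z 1).re = 0)

/-- The zeros of `H` are distributed in the way that is typical for the `α`-points of functions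
`z⁻¹ ∏ (1 + z² / a_ν) / ∏ (1 - z² / b_μ)` with `a_ν, b_μ > 0`: they can be listed with multiplicity
in the order of nondecreasing absolute values, and each such list has the stated properties. -/
def ZerosDistributed (H : ℂ → ℂ) (α : ℂ) : Prop :=
  (∃ (ω : ℕ∞) (z : ℕ → ℂ), IsZeroEnumeration H ω z) ∧
  ∀ (ω : ℕ∞) (z : ℕ → ℂ), IsZeroEnumeration H ω z →
    ((α ^ 2).im ≠ 0 → DistributedGeneric H α ω z) ∧
    (α.im = 0 → DistributedReal H α ω z) ∧
    (α.re = 0 → DistributedImaginary H α ω z)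

/-! After the substitution by the square root of `i`, and up to the factor `f 0`, the function is `P
- α Q`, so its zeros are the `α`-points of `F(z) = z⁻¹ ∏ (1 + x_i z²) / ∏ (1 - y_j z²)` with `x_i,
y_j > 0` summable. As `F` is real on the real axis and odd, reflections in the axes reduce every
`α`-point to a point of the closed first quadrant, where `α` is replaced by one of `±α, ±conj α`.

Write `z = e^ζ`, `ζ = s + iθ`, and `log F = L + iA`. Everything rests on one inequality: for two
points of the quadrant off the zeros and poles, `ΔA · Δs - ΔL · Δθ ≥ 0`, strictly unless they
coincide or lie on one axis (or there are no factors). It says `Im (Δ(log F) · conj Δζ) ≥ 0`, and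
follows by summing the corresponding inequality for `log (1 + e^ζ)` on `0 ≤ Im ζ ≤ π`
(`exp_kernel_pos`), whose derivative has positive imaginary part inside the strip. The factor `z⁻¹`
contributes nothing.

Taking `Δs = 0`, the modulus of `F` decreases strictly from the real to the imaginary axis on each
quarter circle. Hence the level curve `|F| = |α|` meets it at most once; where it does not, it is
continued along the nearer axis (`curve`). Along this extended curve the argument of `F` (`phase`)
is continuous and nondecreasing, and it is constant only along an axis (`phase_monotone`,
`phase_lt`). It starts at `-π/2`, since `F ~ 1/z` at the origin. The `α`-points are the points of
the true level curve where the phase equals the argument of `α` up to reflection.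

If `α` is on neither axis, the phase meets exactly one admissible value in each quarter-turn it
completes: one simple zero per quarter-turn. If `α` is real, the admissible values are `kπ`. Each
level set of the phase is a point inside the quadrant (a conjugate pair), a point of the axis (a
double zero), or a stretch of the axis whose ends are simple zeros (`level_sum`). If `α` is
imaginary, rotation by `i` gives the reciprocal type `F ~ z` with a real value; its phase starts at
`0`, the level `0` has no left end and carries one zero only, which shifts the pairing by one.
Multiplicities come from applying the same inequality to short rays at an `α`-point
(`leading_coeff_im_nonneg`). Finally, counting multiplicities level by level identifies the position
of a zero in any list with its level (`position_bounds`). -/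

open Complex

/-! ### The kernel inequality for `log (1 + e^ζ)` -/

/-- The argument of `1 + e^{u + iv}`. -/
noncomputable def expArg (u v : ℝ) : ℝ := (1 + exp (u + v * I)).arg

/-- The logarithm of the modulus of `1 + e^{u + iv}`. -/
noncomputable def expLog (u v : ℝ) : ℝ := Real.log ‖1 + exp (u + v * I)‖

lemma one_add_exp_im (u v : ℝ) : (1 + exp ((u : ℂ) + v * I)).im = Real.exp u * Real.sin v := by
  simp [Complex.exp_im]

lemma one_add_exp_im_nonneg (u : ℝ) {v : ℝ} (hv : v ∈ Set.Icc 0 Real.pi) :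
    0 ≤ (1 + exp ((u : ℂ) + v * I)).im := by
  rw [one_add_exp_im]
  exact mul_nonneg (Real.exp_pos u).le (Real.sin_nonneg_of_mem_Icc hv)

/-- On its branch cut the principal logarithm is continuous from above. The strip `0 ≤ v ≤ π` maps
into the closed upper half-plane, so its edge `v = π` needs no separate treatment. -/
lemma continuousWithinAt_log_upper {w : ℂ} (hw : w ≠ 0) :
    ContinuousWithinAt log {z : ℂ | 0 ≤ z.im} w := by
  by_cases h : w ∈ slitPlane
  · exact (continuousAt_clog h).continuousWithinAt
  · have h' : ¬ (0 < w.re ∨ w.im ≠ 0) := h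
    push Not at h'
    have hre : w.re < 0 := lt_of_le_of_ne h'.1 fun h0 => hw (Complex.ext h0 h'.2)
    exact continuousWithinAt_log_of_re_neg_of_im_zero hre h'.2

/-- The derivative `e^ζ / (1 + e^ζ)` of `log (1 + e^ζ)` has positive imaginary part in the open
strip. Integrated along the segment from `ζ₁` to `ζ₂`, this makes `Im (log (1 + e^ζ) · conj Δ)`
increase, where `Δ = ζ₂ - ζ₁`. The condition `hne` says that the open segment lies in the open strip
and is not a point. -/
lemma exp_kernel_pos {u₁ v₁ u₂ v₂ : ℝ} (h₁ : v₁ ∈ Set.Icc 0 Real.pi) (h₂ : v₂ ∈ Set.Icc 0 Real.pi)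
    (n₁ : 1 + exp ((u₁ : ℂ) + v₁ * I) ≠ 0) (n₂ : 1 + exp ((u₂ : ℂ) + v₂ * I) ≠ 0)
    (hne : v₁ ≠ v₂ ∨ (v₁ ∈ Set.Ioo 0 Real.pi ∧ u₁ ≠ u₂)) :
    0 < (expArg u₂ v₂ - expArg u₁ v₁) * (u₂ - u₁) - (expLog u₂ v₂ - expLog u₁ v₁) * (v₂ - v₁) := by
  set U : ℝ → ℝ := fun t => u₁ + t * (u₂ - u₁) with hU
  set V : ℝ → ℝ := fun t => v₁ + t * (v₂ - v₁) with hV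
  set Δ : ℂ := ((u₂ - u₁ : ℝ) : ℂ) + ((v₂ - v₁ : ℝ) : ℂ) * I with hΔ
  set ξ : ℝ → ℂ := fun t => (U t : ℂ) + V t * I with hξ
  set W : ℝ → ℂ := fun t => 1 + exp (ξ t) with hW
  set φ : ℝ → ℝ := fun t => (log (W t) * (starRingEnd ℂ) Δ).im with hφ
  have hΔ0 : Δ ≠ 0 := by
    intro h
    have hr : u₂ - u₁ = 0 := by simpa [hΔ] using congrArg re h
    have hi : v₂ - v₁ = 0 := by simpa [hΔ] using congrArg im h
    rcases hne with h | ⟨-, h⟩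
    · exact h (by linarith)
    · exact h (by linarith)
  have hVmem : ∀ t ∈ Set.Icc (0 : ℝ) 1, V t ∈ Set.Icc 0 Real.pi := by
    intro t ht
    have e : V t = (1 - t) * v₁ + t * v₂ := by simp only [hV]; ring
    rw [e]
    constructor
    · have := mul_nonneg (sub_nonneg.2 ht.2) h₁.1
      have := mul_nonneg ht.1 h₂.1
      linarith
    · have := mul_le_mul_of_nonneg_left h₁.2 (sub_nonneg.2 ht.2)
      have := mul_le_mul_of_nonneg_left h₂.2 ht.1
      linarith
  have hVint : ∀ t ∈ Set.Ioo (0 : ℝ) 1, V t ∈ Set.Ioo 0 Real.pi := by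
    intro t ht
    have e : V t = (1 - t) * v₁ + t * v₂ := by simp only [hV]; ring
    have a1 : 0 < 1 - t := sub_pos.2 ht.2
    have a2 : 0 < t := ht.1
    have b1 := h₁.1
    have b2 := h₂.1
    have b3 := h₁.2
    have b4 := h₂.2
    rw [e]
    rcases hne with h | ⟨h, -⟩
    · rcases lt_or_gt_of_ne h with h | h
      · constructor <;> nlinarith [mul_pos a1 a2]
      · constructor <;> nlinarith [mul_pos a1 a2]
    · have := h.1
      have := h.2
      constructor <;> nlinarith [mul_pos a1 a2]
  have him : ∀ t, (W t).im = Real.exp (U t) * Real.sin (V t) := fun t => one_add_exp_im _ _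
  have hW0 : ∀ t ∈ Set.Icc (0 : ℝ) 1, W t ≠ 0 := by
    intro t ht
    rcases eq_or_lt_of_le ht.1 with h | h
    · subst h; simpa [hW, hξ, hU, hV] using n₁
    rcases eq_or_lt_of_le ht.2 with h' | h'
    · subst h'; simpa [hW, hξ, hU, hV] using n₂
    · intro h0
      have := him t
      rw [h0, zero_im] at this
      have hs := Real.sin_pos_of_mem_Ioo (hVint t ⟨h, h'⟩)
      have := mul_pos (Real.exp_pos (U t)) hs
      linarith
  have hξd : ∀ t, HasDerivAt ξ Δ t := by
    intro t
    have e1 : HasDerivAt (fun t : ℝ => (u₁ : ℂ) + (v₁ : ℂ) * I + (t : ℂ) * Δ) (1 * Δ) t :=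
      ((Complex.ofRealCLM.hasDerivAt (x := t)).mul_const Δ).const_add _
    rw [one_mul] at e1
    refine e1.congr_of_eventuallyEq (Filter.Eventually.of_forall fun t => ?_)
    simp only [hξ, hU, hV, hΔ]; push_cast; ring
  have hWc : Continuous W := by
    have : Continuous ξ := continuous_iff_continuousAt.2 fun t => (hξd t).continuousAt
    exact continuous_const.add this.cexp
  have hφc : ContinuousOn φ (Set.Icc 0 1) := by
    intro t ht
    have hc : ContinuousWithinAt (fun t => log (W t)) (Set.Icc 0 1) t := by
      refine (continuousWithinAt_log_upper (hW0 t ht)).comp hWc.continuousWithinAt ?_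
      intro t ht
      exact one_add_exp_im_nonneg _ (hVmem t ht)
    exact Complex.continuous_im.continuousAt.comp_continuousWithinAt (hc.mul continuousWithinAt_const)
  have hφd : ∀ t ∈ Set.Ioo (0 : ℝ) 1, HasDerivAt φ
      ((exp (ξ t) * Δ / W t) * (starRingEnd ℂ) Δ).im t := by
    intro t ht
    have hWd : HasDerivAt W (exp (ξ t) * Δ) t := ((hξd t).cexp).const_add 1
    have hsl : W t ∈ slitPlane := by
      refine Or.inr ?_
      rw [him]
      exact (mul_pos (Real.exp_pos _) (Real.sin_pos_of_mem_Ioo (hVint t ht))).ne'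
    have := (hWd.clog_real hsl).mul_const ((starRingEnd ℂ) Δ)
    exact Complex.imCLM.hasFDerivAt.comp_hasDerivAt t this
  have hmono : StrictMonoOn φ (Set.Icc 0 1) := by
    refine strictMonoOn_of_deriv_pos (convex_Icc 0 1) hφc fun t ht => ?_
    rw [interior_Icc] at ht
    rw [(hφd t ht).deriv]
    have hw : W t ≠ 0 := hW0 t ⟨ht.1.le, ht.2.le⟩
    have e : (exp (ξ t) * Δ / W t) * (starRingEnd ℂ) Δ
        = (normSq Δ * (normSq (W t))⁻¹ : ℝ) * (exp (ξ t) * (starRingEnd ℂ) (W t)) := by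
      have h1 : (starRingEnd ℂ) Δ * Δ = (normSq Δ : ℂ) := by rw [mul_comm, mul_conj]
      have h2 : (W t)⁻¹ = (starRingEnd ℂ) (W t) * ((normSq (W t))⁻¹ : ℝ) := by rw [Complex.inv_def]
      rw [div_eq_mul_inv, h2]
      push_cast
      rw [← h1]; ring
    rw [e, im_ofReal_mul]
    -- With `W = 1 + e^ξ`, the product `e^ξ · conj W` is `e^ξ` plus the real number `|e^ξ|²`.
    have e2 : (exp (ξ t) * (starRingEnd ℂ) (W t)).im = Real.exp (U t) * Real.sin (V t) := by
      have h3 : (exp (ξ t)).im = Real.exp (U t) * Real.sin (V t) := by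
        have := him t; simpa [hW] using this
      simp only [hW, map_add, map_one, mul_add, mul_one, add_im, mul_conj, h3, ofReal_im, add_zero]
    rw [e2]
    have := Real.sin_pos_of_mem_Ioo (hVint t ht)
    have h4 := normSq_pos.2 hΔ0
    have h5 := normSq_pos.2 hw
    positivity
  have hlt := hmono (Set.left_mem_Icc.2 zero_le_one) (Set.right_mem_Icc.2 zero_le_one) zero_lt_one
  have e0 : φ 0 = expArg u₁ v₁ * (u₂ - u₁) - expLog u₁ v₁ * (v₂ - v₁) := by
    simp [hφ, hW, hξ, hU, hV, hΔ, expArg, expLog, mul_im, log_re, log_im]; ring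
  have e1 : φ 1 = expArg u₂ v₂ * (u₂ - u₁) - expLog u₂ v₂ * (v₂ - v₁) := by
    simp [hφ, hW, hξ, hU, hV, hΔ, expArg, expLog, mul_im, log_re, log_im]; ring
  rw [e0, e1] at hlt
  linarith

/-- Only horizontal segments on the edges remain. There the argument of `1 ± e^u` is identically `0`
for `v = 0`, and jumps upwards from `0` to `π` for `v = π`, so it is monotone even across the zero
at `u = 0`. -/
lemma exp_kernel_nonneg {u₁ v₁ u₂ v₂ : ℝ} (h₁ : v₁ ∈ Set.Icc 0 Real.pi)
    (h₂ : v₂ ∈ Set.Icc 0 Real.pi)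
    (n₁ : 1 + exp ((u₁ : ℂ) + v₁ * I) ≠ 0) (n₂ : 1 + exp ((u₂ : ℂ) + v₂ * I) ≠ 0) :
    0 ≤ (expArg u₂ v₂ - expArg u₁ v₁) * (u₂ - u₁) - (expLog u₂ v₂ - expLog u₁ v₁) * (v₂ - v₁) := by
  by_cases hv : v₁ = v₂
  swap
  · exact (exp_kernel_pos h₁ h₂ n₁ n₂ (Or.inl hv)).le
  by_cases hu : u₁ = u₂
  · simp [hu, hv]
  subst hv
  by_cases h0 : v₁ = 0
  · subst h0
    have : ∀ u : ℝ, expArg u 0 = 0 := fun u => by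
      have : (1 : ℂ) + exp ((u : ℂ) + (0 : ℝ) * I) = ((1 + Real.exp u : ℝ) : ℂ) := by simp
      rw [expArg, this, arg_ofReal_of_nonneg (by positivity)]
    simp [this]
  by_cases hp : v₁ = Real.pi
  · subst hp
    have e : ∀ u : ℝ, (1 : ℂ) + exp ((u : ℂ) + (Real.pi : ℝ) * I) = ((1 - Real.exp u : ℝ) : ℂ) :=
      fun u => by simp [Complex.exp_add, sub_eq_add_neg]
    have a : ∀ u : ℝ, u ≤ 0 → expArg u Real.pi = 0 := fun u hu => by
      rw [expArg, e, arg_ofReal_of_nonneg]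
      have := Real.exp_le_one_iff.2 hu
      linarith
    have b : ∀ u : ℝ, 0 < u → expArg u Real.pi = Real.pi := fun u hu => by
      rw [expArg, e, arg_ofReal_of_neg]
      have := Real.one_lt_exp_iff.2 hu
      linarith
    have hpi := Real.pi_pos
    rcases le_or_gt u₁ 0 with k₁ | k₁ <;> rcases le_or_gt u₂ 0 with k₂ | k₂
    · simp [a _ k₁, a _ k₂]
    · rw [a _ k₁, b _ k₂]; simp only [sub_self, mul_zero, sub_zero]; nlinarith
    · rw [b _ k₁, a _ k₂]; simp only [sub_self, mul_zero, sub_zero]; nlinarith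
    · simp [b _ k₁, b _ k₂]
  · exact (exp_kernel_pos h₁ h₂ n₁ n₂ (Or.inr
      ⟨⟨lt_of_le_of_ne h₁.1 (Ne.symm h0), lt_of_le_of_ne h₁.2 hp⟩, hu⟩)).le

lemma continuousWithinAt_expArg {u v : ℝ}
    (h : 1 + exp ((u : ℂ) + v * I) ≠ 0) :
    ContinuousWithinAt (fun p : ℝ × ℝ => expArg p.1 p.2) {p | p.2 ∈ Set.Icc 0 Real.pi} (u, v) := by
  have hW : Continuous fun p : ℝ × ℝ => 1 + exp ((p.1 : ℂ) + p.2 * I) := by fun_prop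
  have := (continuousWithinAt_log_upper h).comp
    (f := fun p : ℝ × ℝ => 1 + exp ((p.1 : ℂ) + p.2 * I)) (x := (u, v))
    (s := {p | p.2 ∈ Set.Icc 0 Real.pi}) hW.continuousWithinAt
    (fun p hp => one_add_exp_im_nonneg p.1 hp)
  refine (Complex.continuous_im.continuousAt.comp_continuousWithinAt this).congr ?_ ?_
  · intro p _; simp [expArg, log_im]
  · simp [expArg, log_im]

/-- A summable majorant, uniform for `u` bounded above: after the shift of `u` by `log x_i` the
right side is a constant times `x_i`. -/
lemma abs_expArg_le (u v : ℝ) : |expArg u v| ≤ 2 * Real.pi * Real.exp u := by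
  have hn : ‖exp ((u : ℂ) + v * I)‖ = Real.exp u := by simp [norm_exp]
  have hpi := Real.pi_gt_three
  have he := Real.exp_pos u
  rcases le_or_gt (Real.exp u) (1 / 2) with h | h
  · have h1 := norm_log_one_add_half_le_self (z := exp ((u : ℂ) + v * I)) (by rw [hn]; exact h)
    have h2 := Complex.abs_im_le_norm (log (1 + exp ((u : ℂ) + v * I)))
    rw [log_im] at h2
    rw [hn] at h1
    have : |expArg u v| ≤ 3 / 2 * Real.exp u := h2.trans h1
    nlinarith
  · have : |expArg u v| ≤ Real.pi := abs_arg_le_pi _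
    nlinarith

/-! ### Genus zero products with negative zeros in polar coordinates -/

/-- The genus zero product with zeros `-1 / x i`. -/
noncomputable def genusProd {ι : Type} (x : ι → ℝ) (w : ℂ) : ℂ := ∏' i, (1 + (x i : ℂ) * w)

/-- A continuous choice of the argument of `genusProd x (e^{u + iv})` for `0 ≤ v ≤ π`. -/
noncomputable def genusArg {ι : Type} (x : ι → ℝ) (u v : ℝ) : ℝ :=
  ∑' i, expArg (u + Real.log (x i)) v

section genusProd

variable {ι : Type} {x : ι → ℝ}

lemma norm_mul_summable (hs : Summable x) (w : ℂ) : Summable fun i => ‖(x i : ℂ) * w‖ := by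
  simpa [norm_mul] using hs.abs.mul_right ‖w‖

lemma genusProd_eq_zero_iff (hs : Summable x) (w : ℂ) :
    genusProd x w = 0 ↔ ∃ i, 1 + (x i : ℂ) * w = 0 := by
  constructor
  · intro h
    by_contra! hne
    exact tprod_one_add_ne_zero_of_summable hne (norm_mul_summable hs w) h
  · exact fun h => tprod_of_exists_eq_zero h

lemma genusProd_zero : genusProd x 0 = 1 := by simp [genusProd]

lemma genusProd_of_isEmpty [IsEmpty ι] (w : ℂ) : genusProd x w = 1 := by simp [genusProd]

lemma differentiable_genusProd (hs : Summable x) : Differentiable ℂ (genusProd x) := by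
  have key : ∀ R : ℝ, DifferentiableOn ℂ (genusProd x) (Metric.ball 0 R) := by
    intro R
    have h : HasProdLocallyUniformlyOn (fun (i : ι) (w : ℂ) => 1 + (x i : ℂ) * w)
        (fun w => ∏' i, (1 + (x i : ℂ) * w)) (Metric.ball 0 R) := by
      refine (hs.abs.mul_right R).hasProdLocallyUniformlyOn_one_add Metric.isOpen_ball
        (.of_forall fun i w hw => ?_) (fun i => by fun_prop)
      rw [norm_mul, norm_real, Real.norm_eq_abs]
      exact mul_le_mul_of_nonneg_left (by simpa using (Metric.mem_ball.1 hw).le) (abs_nonneg _)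
    exact h.differentiableOn (.of_forall fun _ => by
      simpa [Finset.prod_fn] using DifferentiableOn.finsetProd (fun _ _ => by fun_prop))
      Metric.isOpen_ball
  intro w
  exact (key (‖w‖ + 1)).differentiableAt (Metric.isOpen_ball.mem_nhds (by simp))

lemma genusProd_conj (hs : Summable x) (w : ℂ) :
    genusProd x ((starRingEnd ℂ) w) = (starRingEnd ℂ) (genusProd x w) := by
  have h : Multipliable fun i => 1 + (x i : ℂ) * w :=
    multipliable_one_add_of_summable (norm_mul_summable hs w)
  rw [genusProd, genusProd, h.map_tprod (starRingEnd ℂ) Complex.continuous_conj]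
  simp

lemma one_add_mul_exp (hx : ∀ i, 0 < x i) (i : ι) (u v : ℝ) :
    1 + (x i : ℂ) * exp (u + v * I) = 1 + exp (((u + Real.log (x i) : ℝ) : ℂ) + v * I) := by
  have : (x i : ℂ) = exp (Real.log (x i) : ℝ) := by
    rw [← ofReal_exp, Real.exp_log (hx i)]
  conv_lhs => rw [this]
  rw [← Complex.exp_add]; push_cast; ring_nf

lemma one_add_exp_ne_zero (hs : Summable x) (hx : ∀ i, 0 < x i) {u v : ℝ}
    (h : genusProd x (exp (u + v * I)) ≠ 0) (i : ι) :
    1 + exp (((u + Real.log (x i) : ℝ) : ℂ) + v * I) ≠ 0 := by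
  rw [← one_add_mul_exp hx]
  intro h0
  exact h ((genusProd_eq_zero_iff hs _).2 ⟨i, h0⟩)

lemma genusProd_ne_zero (hs : Summable x) (hx : ∀ i, 0 < x i) {u v : ℝ} (h0 : 0 ≤ v)
    (hv : v < Real.pi) : genusProd x (exp (u + v * I)) ≠ 0 := by
  intro h
  obtain ⟨i, hi⟩ := (genusProd_eq_zero_iff hs _).1 h
  rw [one_add_mul_exp hx] at hi
  rcases eq_or_lt_of_le h0 with h0 | h0
  · subst h0
    have := congrArg re hi
    simp [Complex.exp_re] at this
    have := Real.exp_pos (u + Real.log (x i))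
    linarith
  · have := congrArg im hi
    rw [one_add_exp_im, zero_im] at this
    have := mul_pos (Real.exp_pos (u + Real.log (x i))) (Real.sin_pos_of_mem_Ioo ⟨h0, hv⟩)
    linarith

lemma summable_log_genus (hs : Summable x) (hx : ∀ i, 0 < x i) (u v : ℝ) :
    Summable fun i => log (1 + exp (((u + Real.log (x i) : ℝ) : ℂ) + v * I)) := by
  have := summable_log_one_add_of_summable (norm_mul_summable hs (exp (u + v * I))).of_norm
  exact this.congr fun i => by rw [one_add_mul_exp hx]

lemma genusProd_eq_exp (hs : Summable x) (hx : ∀ i, 0 < x i) {u v : ℝ}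
    (h : genusProd x (exp (u + v * I)) ≠ 0) :
    genusProd x (exp (u + v * I))
      = exp (∑' i, log (1 + exp (((u + Real.log (x i) : ℝ) : ℂ) + v * I))) := by
  rw [cexp_tsum_eq_tprod (one_add_exp_ne_zero hs hx h) (summable_log_genus hs hx u v), genusProd]
  exact tprod_congr fun i => one_add_mul_exp hx i u v

lemma hasSum_genusArg (hs : Summable x) (hx : ∀ i, 0 < x i) (u v : ℝ) :
    HasSum (fun i => expArg (u + Real.log (x i)) v) (genusArg x u v) := by
  have := (Complex.hasSum_im (summable_log_genus hs hx u v).hasSum).summable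
  simp only [log_im] at this
  exact this.hasSum

lemma genusArg_eq_im (hs : Summable x) (hx : ∀ i, 0 < x i) (u v : ℝ) :
    genusArg x u v = (∑' i, log (1 + exp (((u + Real.log (x i) : ℝ) : ℂ) + v * I))).im := by
  have := Complex.hasSum_im (summable_log_genus hs hx u v).hasSum
  simp only [log_im] at this
  exact this.tsum_eq

lemma hasSum_log_norm_genusProd (hs : Summable x) (hx : ∀ i, 0 < x i) {u v : ℝ}
    (h : genusProd x (exp (u + v * I)) ≠ 0) :
    HasSum (fun i => expLog (u + Real.log (x i)) v)
      (Real.log ‖genusProd x (exp (u + v * I))‖) := by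
  have := Complex.hasSum_re (summable_log_genus hs hx u v).hasSum
  simp only [log_re] at this
  rw [genusProd_eq_exp hs hx h, norm_exp, Real.log_exp]
  exact this

/-- The sum of the principal logarithms of the factors is a logarithm of the product, in general not
the principal one. Its imaginary part is `genusArg`. -/
lemma genusProd_polar (hs : Summable x) (hx : ∀ i, 0 < x i) {u v : ℝ}
    (h : genusProd x (exp (u + v * I)) ≠ 0) :
    genusProd x (exp (u + v * I))
      = ‖genusProd x (exp (u + v * I))‖ * exp (genusArg x u v * I) := by
  have e := genusProd_eq_exp hs hx h
  rw [e, norm_exp, genusArg_eq_im hs hx, ofReal_exp, ← Complex.exp_add, re_add_im]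

/-- A factor `1 + x_i e^ζ` is `1 + e^ζ'` with `ζ' = ζ + log x_i`. The real shift leaves the
differences of coordinates unchanged, so the inequalities for the single factors add up. -/
lemma genus_kernel_nonneg (hs : Summable x) (hx : ∀ i, 0 < x i) {u₁ v₁ u₂ v₂ : ℝ}
    (h₁ : v₁ ∈ Set.Icc 0 Real.pi) (h₂ : v₂ ∈ Set.Icc 0 Real.pi)
    (n₁ : genusProd x (exp (u₁ + v₁ * I)) ≠ 0) (n₂ : genusProd x (exp (u₂ + v₂ * I)) ≠ 0) :
    0 ≤ (genusArg x u₂ v₂ - genusArg x u₁ v₁) * (u₂ - u₁)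
      - (Real.log ‖genusProd x (exp (u₂ + v₂ * I))‖
        - Real.log ‖genusProd x (exp (u₁ + v₁ * I))‖) * (v₂ - v₁) := by
  have H := (((hasSum_genusArg hs hx u₂ v₂).sub (hasSum_genusArg hs hx u₁ v₁)).mul_right
    (u₂ - u₁)).sub (((hasSum_log_norm_genusProd hs hx n₂).sub
      (hasSum_log_norm_genusProd hs hx n₁)).mul_right (v₂ - v₁))
  refine H.nonneg fun i => ?_
  have := exp_kernel_nonneg h₁ h₂ (one_add_exp_ne_zero hs hx n₁ i) (one_add_exp_ne_zero hs hx n₂ i)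
  rwa [show u₂ + Real.log (x i) - (u₁ + Real.log (x i)) = u₂ - u₁ by ring] at this

lemma genus_kernel_pos [Nonempty ι] (hs : Summable x) (hx : ∀ i, 0 < x i) {u₁ v₁ u₂ v₂ : ℝ}
    (h₁ : v₁ ∈ Set.Icc 0 Real.pi) (h₂ : v₂ ∈ Set.Icc 0 Real.pi)
    (n₁ : genusProd x (exp (u₁ + v₁ * I)) ≠ 0) (n₂ : genusProd x (exp (u₂ + v₂ * I)) ≠ 0)
    (hne : v₁ ≠ v₂ ∨ (v₁ ∈ Set.Ioo 0 Real.pi ∧ u₁ ≠ u₂)) :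
    0 < (genusArg x u₂ v₂ - genusArg x u₁ v₁) * (u₂ - u₁)
      - (Real.log ‖genusProd x (exp (u₂ + v₂ * I))‖
        - Real.log ‖genusProd x (exp (u₁ + v₁ * I))‖) * (v₂ - v₁) := by
  have H := (((hasSum_genusArg hs hx u₂ v₂).sub (hasSum_genusArg hs hx u₁ v₁)).mul_right
    (u₂ - u₁)).sub (((hasSum_log_norm_genusProd hs hx n₂).sub
      (hasSum_log_norm_genusProd hs hx n₁)).mul_right (v₂ - v₁))
  have hp : ∀ i, 0 < (expArg (u₂ + Real.log (x i)) v₂ - expArg (u₁ + Real.log (x i)) v₁) * (u₂ - u₁)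
      - (expLog (u₂ + Real.log (x i)) v₂ - expLog (u₁ + Real.log (x i)) v₁) * (v₂ - v₁) := by
    intro i
    have := exp_kernel_pos h₁ h₂ (one_add_exp_ne_zero hs hx n₁ i)
      (one_add_exp_ne_zero hs hx n₂ i) (hne.imp_right fun h => ⟨h.1, by simpa using h.2⟩)
    rwa [show u₂ + Real.log (x i) - (u₁ + Real.log (x i)) = u₂ - u₁ by ring] at this
  rw [← H.tsum_eq]
  exact H.summable.tsum_pos (fun i => (hp i).le) (Classical.arbitrary ι) (hp _)

/-- This is the kernel inequality with `u₁ = u₂`, where only the term with the moduli survives. -/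
lemma norm_genusProd_antitone (hs : Summable x) (hx : ∀ i, 0 < x i) (u : ℝ) {v₁ v₂ : ℝ}
    (h₁ : 0 ≤ v₁) (h : v₁ ≤ v₂) (h₂ : v₂ ≤ Real.pi) :
    ‖genusProd x (exp (u + v₂ * I))‖ ≤ ‖genusProd x (exp (u + v₁ * I))‖ := by
  rcases eq_or_lt_of_le h with h | h
  · rw [h]
  by_cases n₂ : genusProd x (exp (u + v₂ * I)) = 0
  · rw [n₂]; simp
  have n₁ := genusProd_ne_zero hs hx (u := u) h₁ (h.trans_le h₂)
  have := genus_kernel_nonneg hs hx ⟨h₁, h.le.trans h₂⟩ ⟨h₁.trans h.le, h₂⟩ n₁ n₂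
  rw [sub_self, mul_zero, zero_sub] at this
  refine (Real.log_le_log_iff (norm_pos_iff.2 n₂) (norm_pos_iff.2 n₁)).1 ?_
  nlinarith

lemma norm_genusProd_strictAnti [Nonempty ι] (hs : Summable x) (hx : ∀ i, 0 < x i) (u : ℝ)
    {v₁ v₂ : ℝ} (h₁ : 0 ≤ v₁) (h : v₁ < v₂) (h₂ : v₂ ≤ Real.pi) :
    ‖genusProd x (exp (u + v₂ * I))‖ < ‖genusProd x (exp (u + v₁ * I))‖ := by
  have n₁ := genusProd_ne_zero hs hx (u := u) h₁ (h.trans_le h₂)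
  by_cases n₂ : genusProd x (exp (u + v₂ * I)) = 0
  · rw [n₂]; simpa using n₁
  have := genus_kernel_pos hs hx ⟨h₁, h.le.trans h₂⟩ ⟨h₁.trans h.le, h₂⟩ n₁ n₂ (Or.inl h.ne)
  rw [sub_self, mul_zero, zero_sub] at this
  refine (Real.log_lt_log_iff (norm_pos_iff.2 n₂) (norm_pos_iff.2 n₁)).1 ?_
  nlinarith

lemma continuousOn_genusArg (hs : Summable x) (hx : ∀ i, 0 < x i) (R : ℝ) :
    ContinuousOn (fun p : ℝ × ℝ => genusArg x p.1 p.2)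
      {p | p.1 ≤ R ∧ p.2 ∈ Set.Icc 0 Real.pi ∧ genusProd x (exp (p.1 + p.2 * I)) ≠ 0} := by
  refine continuousOn_tsum (u := fun i => 2 * Real.pi * Real.exp R * x i) (fun i => ?_)
    (hs.mul_left _) (fun i p hp => ?_)
  · rintro ⟨u, v⟩ ⟨-, hv, hn⟩
    have := (continuousWithinAt_expArg (one_add_exp_ne_zero hs hx hn i)).comp
      (f := fun p : ℝ × ℝ => (p.1 + Real.log (x i), p.2)) (x := (u, v))
      (s := {p | p.1 ≤ R ∧ p.2 ∈ Set.Icc 0 Real.pi ∧ genusProd x (exp (p.1 + p.2 * I)) ≠ 0})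
      (by fun_prop) (fun p hp => hp.2.1)
    exact this
  · rw [Real.norm_eq_abs]
    refine (abs_expArg_le _ _).trans ?_
    rw [Real.exp_add, Real.exp_log (hx i), ← mul_assoc]
    have := hx i
    have := Real.pi_pos
    have := Real.exp_le_exp.2 hp.1
    gcongr

lemma genusArg_zero_right (u : ℝ) : genusArg x u 0 = 0 := by
  have : ∀ i, expArg (u + Real.log (x i)) 0 = 0 := fun i => by
    have : (1 : ℂ) + exp (((u + Real.log (x i) : ℝ) : ℂ) + (0 : ℝ) * I)
        = ((1 + Real.exp (u + Real.log (x i)) : ℝ) : ℂ) := by simp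
    rw [expArg, this, arg_ofReal_of_nonneg (by positivity)]
  simp [genusArg, this]

lemma exists_genusArg_pi_eq_zero (hs : Summable x) (hx : ∀ i, 0 < x i) :
    ∃ R : ℝ, ∀ u ≤ R, genusArg x u Real.pi = 0 := by
  -- `X` bounds every `x i`; the summand `1` keeps it positive for the empty family. For `e^u ≤ 1 /
  -- X` all factors `1 - x_i e^u` are nonnegative.
  set X := 1 + ∑' i, x i with hX
  have h0 : 0 ≤ ∑' i, x i := tsum_nonneg fun i => (hx i).le
  have hXp : 0 < X := by positivity
  refine ⟨-Real.log X, fun u hu => ?_⟩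
  have : ∀ i, expArg (u + Real.log (x i)) Real.pi = 0 := fun i => by
    have e : (1 : ℂ) + exp (((u + Real.log (x i) : ℝ) : ℂ) + (Real.pi : ℝ) * I)
        = ((1 - Real.exp (u + Real.log (x i)) : ℝ) : ℂ) := by
      simp [Complex.exp_add, sub_eq_add_neg]
    have hle : x i ≤ X := by
      have := hs.le_tsum i fun j _ => (hx j).le
      linarith
    have : Real.log (x i) ≤ Real.log X := Real.log_le_log (hx i) hle
    have : Real.exp (u + Real.log (x i)) ≤ 1 := Real.exp_le_one_iff.2 (by linarith)
    rw [expArg, e, arg_ofReal_of_nonneg (by linarith)]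
  simp [genusArg, this]

end genusProd

/-! ### The quotient, its symmetries and its polar form -/

/-- The data of a quotient `z ^ (m - n) * ∏ (1 + x i * z²) / ∏ (1 - y j * z²)`, where `m - n = ±1`
and the `x i`, `y j` are positive and summable. -/
structure QuotientData where
  ι : Type
  κ : Type
  x : ι → ℝ
  y : κ → ℝ
  x_pos : ∀ i, 0 < x i
  y_pos : ∀ j, 0 < y j
  x_summable : Summable x
  y_summable : Summable y
  m : ℕ
  n : ℕ
  exponents : (m = 0 ∧ n = 1) ∨ (m = 1 ∧ n = 0)

/-- The point with polar coordinates `(e^s, θ)`. -/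
noncomputable def polarPt (s θ : ℝ) : ℂ := exp (s + θ * I)

lemma polarPt_ne_zero (s θ : ℝ) : polarPt s θ ≠ 0 := exp_ne_zero _

lemma norm_polarPt (s θ : ℝ) : ‖polarPt s θ‖ = Real.exp s := by simp [polarPt, norm_exp]

lemma polarPt_re (s θ : ℝ) : (polarPt s θ).re = Real.exp s * Real.cos θ := by
  simp [polarPt, Complex.exp_re]

lemma polarPt_im (s θ : ℝ) : (polarPt s θ).im = Real.exp s * Real.sin θ := by
  simp [polarPt, Complex.exp_im]

lemma continuous_polarPt : Continuous fun p : ℝ × ℝ => polarPt p.1 p.2 := by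
  unfold polarPt; fun_prop

lemma polarPt_sq (s θ : ℝ) : polarPt s θ ^ 2 = exp ((2 * s : ℝ) + (2 * θ : ℝ) * I) := by
  rw [polarPt, ← Complex.exp_nat_mul]; push_cast; ring_nf

/-- The angle `2θ - π` of `-z²` is outside the strip `[0, π]`, but its negative is inside. The
conjugation reverses the sign of the argument, and so does the position of these factors in the
denominator; hence both products enter `ang` with a plus sign. -/
lemma neg_polarPt_sq (s θ : ℝ) :
    -polarPt s θ ^ 2 = (starRingEnd ℂ) (exp ((2 * s : ℝ) + (Real.pi - 2 * θ : ℝ) * I)) := by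
  rw [polarPt_sq, ← Complex.exp_conj]
  have : (starRingEnd ℂ) (((2 * s : ℝ) : ℂ) + (Real.pi - 2 * θ : ℝ) * I)
      = ((2 * s : ℝ) + (2 * θ : ℝ) * I) - Real.pi * I := by
    simp only [map_add, map_mul, conj_ofReal, conj_I]; push_cast; ring
  rw [this, Complex.exp_sub, exp_pi_mul_I, div_neg, div_one]

/-- The reflections of the plane in the coordinate axes and in the origin, for `e₁, e₂ = ±1`. -/
def reflect (e₁ e₂ : ℝ) (z : ℂ) : ℂ := ⟨e₁ * z.re, e₂ * z.im⟩

lemma reflect_cases {e₁ e₂ : ℝ} (h₁ : e₁ = 1 ∨ e₁ = -1) (h₂ : e₂ = 1 ∨ e₂ = -1) :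
    (∀ z, reflect e₁ e₂ z = z) ∨ (∀ z, reflect e₁ e₂ z = -z) ∨
    (∀ z, reflect e₁ e₂ z = (starRingEnd ℂ) z) ∨ (∀ z, reflect e₁ e₂ z = -(starRingEnd ℂ) z) := by
  rcases h₁ with rfl | rfl <;> rcases h₂ with rfl | rfl
  · exact Or.inl fun z => Complex.ext (by simp [reflect]) (by simp [reflect])
  · exact Or.inr (Or.inr (Or.inl fun z => Complex.ext (by simp [reflect]) (by simp [reflect])))
  · exact Or.inr (Or.inr (Or.inr fun z => Complex.ext (by simp [reflect]) (by simp [reflect])))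
  · exact Or.inr (Or.inl fun z => Complex.ext (by simp [reflect]) (by simp [reflect]))

lemma reflect_reflect {e₁ e₂ : ℝ} (h₁ : e₁ = 1 ∨ e₁ = -1) (h₂ : e₂ = 1 ∨ e₂ = -1) (z : ℂ) :
    reflect e₁ e₂ (reflect e₁ e₂ z) = z := by
  rcases h₁ with rfl | rfl <;> rcases h₂ with rfl | rfl <;>
    exact Complex.ext (by simp [reflect]) (by simp [reflect])

lemma norm_reflect {e₁ e₂ : ℝ} (h₁ : e₁ = 1 ∨ e₁ = -1) (h₂ : e₂ = 1 ∨ e₂ = -1) (z : ℂ) :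
    ‖reflect e₁ e₂ z‖ = ‖z‖ := by
  rcases reflect_cases h₁ h₂ with h | h | h | h <;> simp [h]

lemma exists_reflect_polarPt {z : ℂ} (hz : z ≠ 0) :
    ∃ e₁ e₂ θ : ℝ, (e₁ = 1 ∨ e₁ = -1) ∧ (e₂ = 1 ∨ e₂ = -1) ∧ θ ∈ Set.Icc 0 (Real.pi / 2) ∧
      z = reflect e₁ e₂ (polarPt (Real.log ‖z‖) θ) := by
  have key : ∀ t : ℝ, ∃ e : ℝ, (e = 1 ∨ e = -1) ∧ t = e * |t| := by
    intro t
    rcases abs_choice t with h | h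
    · exact ⟨1, Or.inl rfl, by rw [h, one_mul]⟩
    · exact ⟨-1, Or.inr rfl, by rw [h]; ring⟩
  obtain ⟨e₁, h₁, k₁⟩ := key z.re
  obtain ⟨e₂, h₂, k₂⟩ := key z.im
  set w : ℂ := ⟨|z.re|, |z.im|⟩ with hw
  have hzw : z = reflect e₁ e₂ w := Complex.ext k₁ k₂
  have hn : ‖z‖ = ‖w‖ := by rw [hzw, norm_reflect h₁ h₂]
  have hw0 : w ≠ 0 := by rw [← norm_pos_iff, ← hn]; exact norm_pos_iff.2 hz
  refine ⟨e₁, e₂, w.arg, h₁, h₂, ⟨arg_nonneg_iff.2 (abs_nonneg _), ?_⟩, ?_⟩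
  · exact (abs_le.1 (abs_arg_le_pi_div_two_iff.2 (abs_nonneg _ : 0 ≤ w.re))).2
  · rw [hn]
    have : polarPt (Real.log ‖w‖) w.arg = w := exp_log hw0
    rw [this, ← hzw]

namespace QuotientData

variable (d : QuotientData)

/-- The numerator of the quotient. -/
noncomputable def P (z : ℂ) : ℂ := z ^ d.m * genusProd d.x (z ^ 2)

/-- The denominator of the quotient. -/
noncomputable def Q (z : ℂ) : ℂ := z ^ d.n * genusProd d.y (-z ^ 2)

/-- The entire function whose zeros are the `α`-points of the quotient. -/
noncomputable def H (α z : ℂ) : ℂ := d.P z - α * d.Q z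

/-- The argument of the quotient at `polarPt s θ`, continuous on the closed first quadrant off the
zeros and the poles. -/
noncomputable def ang (s θ : ℝ) : ℝ :=
  ((d.m : ℝ) - d.n) * θ + genusArg d.x (2 * s) (2 * θ) + genusArg d.y (2 * s) (Real.pi - 2 * θ)

/-- The sign of `gap c s θ` compares the modulus of the quotient at `polarPt s θ` with `c`. -/
noncomputable def gap (c s θ : ℝ) : ℝ := ‖d.P (polarPt s θ)‖ - c * ‖d.Q (polarPt s θ)‖

lemma differentiable_P : Differentiable ℂ d.P := by
  have := differentiable_genusProd d.x_summable
  unfold P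
  exact (differentiable_id.pow _).mul (this.comp (differentiable_id.pow 2))

lemma differentiable_Q : Differentiable ℂ d.Q := by
  have := differentiable_genusProd d.y_summable
  unfold Q
  exact (differentiable_id.pow _).mul (this.comp (differentiable_id.pow 2).neg)

lemma differentiable_H (α : ℂ) : Differentiable ℂ (d.H α) :=
  d.differentiable_P.sub (d.differentiable_Q.const_mul α)

lemma P_conj (z : ℂ) : d.P ((starRingEnd ℂ) z) = (starRingEnd ℂ) (d.P z) := by
  rw [P, P, ← map_pow (starRingEnd ℂ) z 2, genusProd_conj d.x_summable, map_mul, map_pow]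

lemma Q_conj (z : ℂ) : d.Q ((starRingEnd ℂ) z) = (starRingEnd ℂ) (d.Q z) := by
  rw [Q, Q, ← map_pow (starRingEnd ℂ) z 2, ← map_neg, genusProd_conj d.y_summable, map_mul, map_pow]

lemma P_neg (z : ℂ) : d.P (-z) = (-1) ^ d.m * d.P z := by
  rw [P, P, neg_sq, neg_pow]; ring

lemma Q_neg (z : ℂ) : d.Q (-z) = -((-1) ^ d.m * d.Q z) := by
  rw [Q, Q, neg_sq, neg_pow]
  rcases d.exponents with ⟨h, h'⟩ | ⟨h, h'⟩ <;> rw [h, h'] <;> ring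

lemma H_conj (α z : ℂ) :
    d.H ((starRingEnd ℂ) α) ((starRingEnd ℂ) z) = (starRingEnd ℂ) (d.H α z) := by
  simp [H, P_conj, Q_conj]

lemma H_neg (α z : ℂ) : d.H (-α) (-z) = (-1) ^ d.m * d.H α z := by
  rw [H, H, P_neg, Q_neg]; ring

lemma H_zero_ne_zero {α : ℂ} (hα : α ≠ 0) : d.H α 0 ≠ 0 := by
  rcases d.exponents with ⟨h, h'⟩ | ⟨h, h'⟩ <;> simp [H, P, Q, h, h', genusProd_zero, hα]

/-- `P / Q` commutes with conjugation and is odd, because exactly one of the exponents `m`, `n` is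
odd. So zeros may be moved into the first quadrant at the price of reflecting `α`. -/
lemma H_reflect_eq_zero_iff {e₁ e₂ : ℝ} (h₁ : e₁ = 1 ∨ e₁ = -1) (h₂ : e₂ = 1 ∨ e₂ = -1)
    (α z : ℂ) : d.H (reflect e₁ e₂ α) (reflect e₁ e₂ z) = 0 ↔ d.H α z = 0 := by
  rcases reflect_cases h₁ h₂ with h | h | h | h <;>
    simp [h, H_conj, H_neg]

lemma norm_P_polarPt (s θ : ℝ) : ‖d.P (polarPt s θ)‖ =
    Real.exp (d.m * s) * ‖genusProd d.x (exp ((2 * s : ℝ) + (2 * θ : ℝ) * I))‖ := by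
  rw [P, norm_mul, norm_pow, norm_polarPt, polarPt_sq, ← Real.exp_nat_mul]

lemma norm_Q_polarPt (s θ : ℝ) : ‖d.Q (polarPt s θ)‖ =
    Real.exp (d.n * s) * ‖genusProd d.y (exp ((2 * s : ℝ) + (Real.pi - 2 * θ : ℝ) * I))‖ := by
  rw [Q, norm_mul, norm_pow, norm_polarPt, neg_polarPt_sq, genusProd_conj d.y_summable,
    RCLike.norm_conj, ← Real.exp_nat_mul]

variable {d}

lemma genusProd_x_ne_zero {s θ : ℝ} (h : d.P (polarPt s θ) ≠ 0) :
    genusProd d.x (exp ((2 * s : ℝ) + (2 * θ : ℝ) * I)) ≠ 0 := by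
  rw [← norm_ne_zero_iff, norm_P_polarPt] at h
  simpa using right_ne_zero_of_mul h

lemma genusProd_y_ne_zero {s θ : ℝ} (h : d.Q (polarPt s θ) ≠ 0) :
    genusProd d.y (exp ((2 * s : ℝ) + (Real.pi - 2 * θ : ℝ) * I)) ≠ 0 := by
  rw [← norm_ne_zero_iff, norm_Q_polarPt] at h
  simpa using right_ne_zero_of_mul h

lemma P_ne_zero {s θ : ℝ} (h0 : 0 ≤ θ) (h : θ < Real.pi / 2) : d.P (polarPt s θ) ≠ 0 := by
  rw [← norm_ne_zero_iff, norm_P_polarPt]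
  have := genusProd_ne_zero d.x_summable d.x_pos (u := 2 * s) (v := 2 * θ) (by linarith)
    (by linarith)
  exact mul_ne_zero (Real.exp_pos _).ne' (norm_ne_zero_iff.2 this)

lemma Q_ne_zero {s θ : ℝ} (h0 : 0 < θ) (h : θ ≤ Real.pi / 2) : d.Q (polarPt s θ) ≠ 0 := by
  rw [← norm_ne_zero_iff, norm_Q_polarPt]
  have := genusProd_ne_zero d.y_summable d.y_pos (u := 2 * s) (v := Real.pi - 2 * θ) (by linarith)
    (by linarith)
  exact mul_ne_zero (Real.exp_pos _).ne' (norm_ne_zero_iff.2 this)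

/-- `ang` is an argument of the quotient, chosen continuously rather than reduced modulo `2π`. -/
lemma quotient_polar {s θ : ℝ} (hP : d.P (polarPt s θ) ≠ 0) (hQ : d.Q (polarPt s θ) ≠ 0) :
    d.P (polarPt s θ) / d.Q (polarPt s θ)
      = (‖d.P (polarPt s θ)‖ / ‖d.Q (polarPt s θ)‖ : ℝ) * exp (d.ang s θ * I) := by
  have hx := genusProd_polar d.x_summable d.x_pos (genusProd_x_ne_zero hP)
  have hy := genusProd_polar d.y_summable d.y_pos (genusProd_y_ne_zero hQ)
  have hadd : ∀ a b : ℝ, exp ((a + b : ℝ) * I) = exp (a * I) * exp (b * I) := fun a b => by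
    rw [ofReal_add, add_mul, Complex.exp_add]
  have eP : d.P (polarPt s θ) = ‖d.P (polarPt s θ)‖
      * exp ((d.m * θ + genusArg d.x (2 * s) (2 * θ) : ℝ) * I) := by
    have h1 : polarPt s θ ^ d.m = (Real.exp (d.m * s) : ℝ) * exp ((d.m * θ : ℝ) * I) := by
      rw [polarPt, ← Complex.exp_nat_mul, ofReal_exp, ← Complex.exp_add]; push_cast; ring_nf
    conv_lhs => rw [P, polarPt_sq, hx, h1]
    rw [norm_P_polarPt, hadd, ofReal_mul (Real.exp _)]
    ring
  have eQ : d.Q (polarPt s θ) = ‖d.Q (polarPt s θ)‖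
      * exp ((d.n * θ - genusArg d.y (2 * s) (Real.pi - 2 * θ) : ℝ) * I) := by
    have h1 : polarPt s θ ^ d.n = (Real.exp (d.n * s) : ℝ) * exp ((d.n * θ : ℝ) * I) := by
      rw [polarPt, ← Complex.exp_nat_mul, ofReal_exp, ← Complex.exp_add]; push_cast; ring_nf
    conv_lhs => rw [Q, neg_polarPt_sq, genusProd_conj d.y_summable, hy, h1]
    rw [norm_Q_polarPt]
    have h2 : (starRingEnd ℂ) (exp ((genusArg d.y (2 * s) (Real.pi - 2 * θ) : ℝ) * I))
        = exp (-((genusArg d.y (2 * s) (Real.pi - 2 * θ) : ℝ) * I)) := by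
      rw [← Complex.exp_conj]; simp
    rw [map_mul, h2, conj_ofReal, sub_eq_add_neg (d.n * θ), hadd, ofReal_mul (Real.exp _),
      ofReal_neg, neg_mul]
    ring
  conv_lhs => rw [eP, eQ]
  rw [mul_div_mul_comm, ← Complex.exp_sub, ang]
  push_cast
  ring_nf

/-! ### The kernel inequality for the quotient -/

/-- The data has at least one factor. -/
def HasFactor (d : QuotientData) : Prop := Nonempty d.ι ∨ Nonempty d.κ

/-- `A` and `B` are the kernels of the two products, at the angles `2θ` and `π - 2θ`; the factor `2`
comes from squaring `z`. The monomial drops out because `(m - n) Δζ · conj Δζ` is real. For the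
denominator both the logarithm of the modulus and the difference of angles change sign, so its
kernel keeps the right sign. -/
lemma kernel_aux {s₁ θ₁ s₂ θ₂ : ℝ} (h₁ : θ₁ ∈ Set.Icc 0 (Real.pi / 2))
    (h₂ : θ₂ ∈ Set.Icc 0 (Real.pi / 2))
    (P₁ : d.P (polarPt s₁ θ₁) ≠ 0) (Q₁ : d.Q (polarPt s₁ θ₁) ≠ 0)
    (P₂ : d.P (polarPt s₂ θ₂) ≠ 0) (Q₂ : d.Q (polarPt s₂ θ₂) ≠ 0) :
    ∃ A B : ℝ, 0 ≤ A ∧ 0 ≤ B ∧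
      (d.HasFactor → (θ₁ ≠ θ₂ ∨ (θ₁ ∈ Set.Ioo 0 (Real.pi / 2) ∧ s₁ ≠ s₂)) → 0 < A + B) ∧
      2 * ((d.ang s₂ θ₂ - d.ang s₁ θ₁) * (s₂ - s₁)
        - ((Real.log ‖d.P (polarPt s₂ θ₂)‖ - Real.log ‖d.Q (polarPt s₂ θ₂)‖)
          - (Real.log ‖d.P (polarPt s₁ θ₁)‖ - Real.log ‖d.Q (polarPt s₁ θ₁)‖)) * (θ₂ - θ₁))
        = A + B := by
  have a₁ := genusProd_x_ne_zero P₁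
  have a₂ := genusProd_x_ne_zero P₂
  have b₁ := genusProd_y_ne_zero Q₁
  have b₂ := genusProd_y_ne_zero Q₂
  have i1 : 2 * θ₁ ∈ Set.Icc 0 Real.pi := ⟨by linarith [h₁.1], by linarith [h₁.2]⟩
  have i2 : 2 * θ₂ ∈ Set.Icc 0 Real.pi := ⟨by linarith [h₂.1], by linarith [h₂.2]⟩
  have j1 : Real.pi - 2 * θ₁ ∈ Set.Icc 0 Real.pi := ⟨by linarith [h₁.2], by linarith [h₁.1]⟩
  have j2 : Real.pi - 2 * θ₂ ∈ Set.Icc 0 Real.pi := ⟨by linarith [h₂.2], by linarith [h₂.1]⟩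
  have kx := genus_kernel_nonneg d.x_summable d.x_pos i1 i2 a₁ a₂
  have ky := genus_kernel_nonneg d.y_summable d.y_pos j1 j2 b₁ b₂
  refine ⟨_, _, kx, ky, ?_, ?_⟩
  · rintro (hn | hn) hne
    · have := genus_kernel_pos d.x_summable d.x_pos i1 i2 a₁ a₂
        (hne.imp (fun h => by simpa using h) fun h =>
          ⟨⟨by linarith [h.1.1], by linarith [h.1.2]⟩, by simpa using h.2⟩)
      linarith
    · have := genus_kernel_pos d.y_summable d.y_pos j1 j2 b₁ b₂
        (hne.imp (fun h => by simpa using h) fun h =>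
          ⟨⟨by linarith [h.1.2], by linarith [h.1.1]⟩, by simpa using h.2⟩)
      linarith
  · have l : ∀ (k : ℕ) (s : ℝ) (w : ℂ), w ≠ 0 →
        Real.log (Real.exp (k * s) * ‖w‖) = k * s + Real.log ‖w‖ := fun k s w hw => by
      rw [Real.log_mul (Real.exp_pos _).ne' (norm_ne_zero_iff.2 hw), Real.log_exp]
    simp only [norm_P_polarPt, norm_Q_polarPt]
    rw [l _ _ _ a₁, l _ _ _ a₂, l _ _ _ b₁, l _ _ _ b₂]
    simp only [ang]
    ring

lemma kernel_nonneg {s₁ θ₁ s₂ θ₂ : ℝ} (h₁ : θ₁ ∈ Set.Icc 0 (Real.pi / 2))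
    (h₂ : θ₂ ∈ Set.Icc 0 (Real.pi / 2))
    (P₁ : d.P (polarPt s₁ θ₁) ≠ 0) (Q₁ : d.Q (polarPt s₁ θ₁) ≠ 0)
    (P₂ : d.P (polarPt s₂ θ₂) ≠ 0) (Q₂ : d.Q (polarPt s₂ θ₂) ≠ 0) :
    ((Real.log ‖d.P (polarPt s₂ θ₂)‖ - Real.log ‖d.Q (polarPt s₂ θ₂)‖)
          - (Real.log ‖d.P (polarPt s₁ θ₁)‖ - Real.log ‖d.Q (polarPt s₁ θ₁)‖)) * (θ₂ - θ₁)
      ≤ (d.ang s₂ θ₂ - d.ang s₁ θ₁) * (s₂ - s₁) := by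
  obtain ⟨A, B, hA, hB, -, h⟩ := kernel_aux h₁ h₂ P₁ Q₁ P₂ Q₂
  linarith

lemma kernel_pos (hd : d.HasFactor) {s₁ θ₁ s₂ θ₂ : ℝ} (h₁ : θ₁ ∈ Set.Icc 0 (Real.pi / 2))
    (h₂ : θ₂ ∈ Set.Icc 0 (Real.pi / 2))
    (P₁ : d.P (polarPt s₁ θ₁) ≠ 0) (Q₁ : d.Q (polarPt s₁ θ₁) ≠ 0)
    (P₂ : d.P (polarPt s₂ θ₂) ≠ 0) (Q₂ : d.Q (polarPt s₂ θ₂) ≠ 0)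
    (hne : θ₁ ≠ θ₂ ∨ (θ₁ ∈ Set.Ioo 0 (Real.pi / 2) ∧ s₁ ≠ s₂)) :
    ((Real.log ‖d.P (polarPt s₂ θ₂)‖ - Real.log ‖d.Q (polarPt s₂ θ₂)‖)
          - (Real.log ‖d.P (polarPt s₁ θ₁)‖ - Real.log ‖d.Q (polarPt s₁ θ₁)‖)) * (θ₂ - θ₁)
      < (d.ang s₂ θ₂ - d.ang s₁ θ₁) * (s₂ - s₁) := by
  obtain ⟨A, B, hA, hB, hp, h⟩ := kernel_aux h₁ h₂ P₁ Q₁ P₂ Q₂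
  have := hp hd hne
  linarith

/-- As `θ` grows, the modulus of the numerator falls and that of the denominator rises, one of them
strictly. Working with a difference instead of a ratio includes the zeros and the poles on the axes.
-/
lemma gap_strictAnti (hd : d.HasFactor) {c : ℝ} (hc : 0 < c) (s : ℝ) {θ₁ θ₂ : ℝ} (h₁ : 0 ≤ θ₁)
    (h : θ₁ < θ₂) (h₂ : θ₂ ≤ Real.pi / 2) : d.gap c s θ₂ < d.gap c s θ₁ := by
  simp only [gap, norm_P_polarPt, norm_Q_polarPt]
  have ax := norm_genusProd_antitone d.x_summable d.x_pos (2 * s) (v₁ := 2 * θ₁) (v₂ := 2 * θ₂)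
    (by linarith) (by linarith) (by linarith)
  have ay := norm_genusProd_antitone d.y_summable d.y_pos (2 * s) (v₁ := Real.pi - 2 * θ₂)
    (v₂ := Real.pi - 2 * θ₁) (by linarith) (by linarith) (by linarith)
  have em := Real.exp_pos (d.m * s)
  have en := mul_pos hc (Real.exp_pos (d.n * s))
  simp only [← mul_assoc]
  rcases hd with hn | hn
  · have bx := norm_genusProd_strictAnti d.x_summable d.x_pos (2 * s) (v₁ := 2 * θ₁)
      (v₂ := 2 * θ₂) (by linarith) (by linarith) (by linarith)
    linarith [mul_lt_mul_of_pos_left bx em, mul_le_mul_of_nonneg_left ay en.le]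
  · have bx := norm_genusProd_strictAnti d.y_summable d.y_pos (2 * s) (v₁ := Real.pi - 2 * θ₂)
      (v₂ := Real.pi - 2 * θ₁) (by linarith) (by linarith) (by linarith)
    linarith [mul_le_mul_of_nonneg_left ax em.le, mul_lt_mul_of_pos_left bx en]

lemma continuous_gap (c : ℝ) : Continuous fun p : ℝ × ℝ => d.gap c p.1 p.2 := by
  have hP := d.differentiable_P.continuous.comp continuous_polarPt
  have hQ := d.differentiable_Q.continuous.comp continuous_polarPt
  exact hP.norm.sub (continuous_const.mul hQ.norm)

lemma continuousOn_ang (R : ℝ) :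
    ContinuousOn (fun p : ℝ × ℝ => d.ang p.1 p.2)
      {p | p.1 ≤ R ∧ p.2 ∈ Set.Icc 0 (Real.pi / 2) ∧ d.P (polarPt p.1 p.2) ≠ 0 ∧
        d.Q (polarPt p.1 p.2) ≠ 0} := by
  refine ContinuousOn.add (ContinuousOn.add (by fun_prop) ?_) ?_
  · refine (continuousOn_genusArg d.x_summable d.x_pos (2 * R)).comp
      (f := fun p : ℝ × ℝ => (2 * p.1, 2 * p.2)) (by fun_prop) ?_
    rintro ⟨s, θ⟩ ⟨h1, h2, h3, -⟩
    refine ⟨?_, ⟨?_, ?_⟩, genusProd_x_ne_zero h3⟩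
    · simp only at h1 ⊢; linarith
    · have := h2.1; simp only at this ⊢; linarith
    · have := h2.2; simp only at this ⊢; linarith
  · refine (continuousOn_genusArg d.y_summable d.y_pos (2 * R)).comp
      (f := fun p : ℝ × ℝ => (2 * p.1, Real.pi - 2 * p.2)) (by fun_prop) ?_
    rintro ⟨s, θ⟩ ⟨h1, h2, -, h4⟩
    refine ⟨?_, ⟨?_, ?_⟩, genusProd_y_ne_zero h4⟩
    · simp only at h1 ⊢; linarith
    · have := h2.2; simp only at this ⊢; linarith
    · have := h2.1; simp only at this ⊢; linarith

end QuotientData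

/-! ### The level curve and the phase along it -/

namespace QuotientData

variable {d : QuotientData}

lemma continuous_gap_right (c s : ℝ) : Continuous fun θ => d.gap c s θ :=
  (continuous_gap (d := d) c).comp (g := fun p : ℝ × ℝ => d.gap c p.1 p.2)
    (f := fun θ : ℝ => (s, θ)) (by fun_prop)

lemma continuous_gap_left (c θ : ℝ) : Continuous fun s => d.gap c s θ :=
  (continuous_gap (d := d) c).comp (g := fun p : ℝ × ℝ => d.gap c p.1 p.2)
    (f := fun s : ℝ => (s, θ)) (by fun_prop)

/-- For each `s`, exactly one `θ` satisfies this: the point of the level curve where the quotient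
has modulus `c`, or the nearer end of `[0, π/2]` if there is no such point. -/
def OnCurve (d : QuotientData) (c s θ : ℝ) : Prop :=
  θ ∈ Set.Icc 0 (Real.pi / 2) ∧ (0 < θ → 0 ≤ d.gap c s θ) ∧ (θ < Real.pi / 2 → d.gap c s θ ≤ 0)

lemma exists_onCurve (d : QuotientData) (c s : ℝ) : ∃ θ, d.OnCurve c s θ := by
  have hpi := Real.pi_pos
  by_cases h0 : d.gap c s 0 ≤ 0
  · exact ⟨0, ⟨le_rfl, by positivity⟩, fun h => absurd h (lt_irrefl _), fun _ => h0⟩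
  by_cases h1 : 0 ≤ d.gap c s (Real.pi / 2)
  · exact ⟨Real.pi / 2, ⟨by positivity, le_rfl⟩, fun _ => h1, fun h => absurd h (lt_irrefl _)⟩
  push Not at h0 h1
  have hc : Continuous fun θ => d.gap c s θ := continuous_gap_right c s
  obtain ⟨θ, hθ, h⟩ := intermediate_value_Icc' (by positivity : (0 : ℝ) ≤ Real.pi / 2)
    hc.continuousOn ⟨h1.le, h0.le⟩
  exact ⟨θ, hθ, fun _ => h.ge, fun _ => h.le⟩

/-- The angular coordinate of the level curve at the radius `e^s`. -/
noncomputable def curve (d : QuotientData) (c s : ℝ) : ℝ := (d.exists_onCurve c s).choose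

/-- The argument of the quotient along the level curve. -/
noncomputable def phase (d : QuotientData) (c s : ℝ) : ℝ := d.ang s (d.curve c s)

lemma curve_spec (d : QuotientData) (c s : ℝ) : d.OnCurve c s (d.curve c s) :=
  (d.exists_onCurve c s).choose_spec

lemma curve_mem (d : QuotientData) (c s : ℝ) : d.curve c s ∈ Set.Icc 0 (Real.pi / 2) :=
  (d.curve_spec c s).1

variable {c : ℝ}

lemma lt_curve (hd : d.HasFactor) (hc : 0 < c) {s θ : ℝ} (h1 : θ ≤ Real.pi / 2)
    (h : 0 < d.gap c s θ) (h2 : θ < Real.pi / 2) : θ < d.curve c s := by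
  obtain ⟨hm, -, hle⟩ := d.curve_spec c s
  by_contra! hlt
  have h3 := hle (hlt.trans_lt h2)
  rcases eq_or_lt_of_le hlt with e | hlt
  · rw [e] at h3; linarith
  · linarith [gap_strictAnti hd hc s hm.1 hlt h1]

lemma curve_lt (hd : d.HasFactor) (hc : 0 < c) {s θ : ℝ} (h1 : 0 < θ)
    (h : d.gap c s θ < 0) : d.curve c s < θ := by
  obtain ⟨hm, hge, -⟩ := d.curve_spec c s
  by_contra! hlt
  have h3 := hge (h1.trans_le hlt)
  rcases eq_or_lt_of_le hlt with e | hlt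
  · rw [← e] at h3; linarith
  · linarith [gap_strictAnti hd hc s h1.le hlt hm.2]

lemma curve_eq (hd : d.HasFactor) (hc : 0 < c) {s θ : ℝ} (h : d.OnCurve c s θ) :
    d.curve c s = θ := by
  obtain ⟨hm, hge, hle⟩ := h
  obtain ⟨hm', hge', hle'⟩ := d.curve_spec c s
  rcases lt_trichotomy (d.curve c s) θ with h | h | h
  · linarith [hle' (h.trans_le hm.2), hge (hm'.1.trans_lt h), gap_strictAnti hd hc s hm'.1 h hm.2]
  · exact h
  · linarith [hle (h.trans_le hm'.2), hge' (hm.1.trans_lt h), gap_strictAnti hd hc s hm.1 h hm'.2]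

lemma curve_eq_of_gap_eq_zero (hd : d.HasFactor) (hc : 0 < c) {s θ : ℝ}
    (hθ : θ ∈ Set.Icc 0 (Real.pi / 2)) (h : d.gap c s θ = 0) : d.curve c s = θ :=
  curve_eq hd hc ⟨hθ, fun _ => h.ge, fun _ => h.le⟩

lemma curve_eq_zero_iff (hd : d.HasFactor) (hc : 0 < c) {s : ℝ} :
    d.curve c s = 0 ↔ d.gap c s 0 ≤ 0 := by
  have hpi := Real.pi_pos
  constructor
  · intro h
    have := (d.curve_spec c s).2.2
    rw [h] at this
    exact this (by positivity)
  · intro h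
    exact curve_eq hd hc ⟨⟨le_rfl, by positivity⟩, fun h => absurd h (lt_irrefl _), fun _ => h⟩

lemma gap_curve_eq_zero {s : ℝ} (h : d.curve c s ∈ Set.Ioo 0 (Real.pi / 2)) :
    d.gap c s (d.curve c s) = 0 :=
  le_antisymm ((d.curve_spec c s).2.2 h.2) ((d.curve_spec c s).2.1 h.1)

/-- For `a` strictly on one side of the curve at `s₀`, the strict monotonicity in `θ` makes the gap
at `(s₀, a)` nonzero. Its sign persists for nearby `s` and keeps `a` on the same side. -/
lemma continuous_curve (hd : d.HasFactor) (hc : 0 < c) : Continuous (d.curve c) := by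
  refine continuous_iff_continuousAt.2 fun s₀ => tendsto_order.2 ⟨fun a ha => ?_, fun a ha => ?_⟩
  · by_cases h0 : a < 0
    · exact Filter.Eventually.of_forall fun s => h0.trans_le (d.curve_mem c s).1
    push Not at h0
    have hm := (d.curve_mem c s₀).2
    have h1 : 0 < d.gap c s₀ a := lt_of_le_of_lt ((d.curve_spec c s₀).2.1 (h0.trans_lt ha))
      (gap_strictAnti hd hc s₀ h0 ha hm)
    filter_upwards [((continuous_gap_left c a).tendsto s₀).eventually_const_lt h1] with s hs
    exact lt_curve hd hc (ha.le.trans hm) hs (ha.trans_le hm)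
  · by_cases h0 : Real.pi / 2 < a
    · exact Filter.Eventually.of_forall fun s => (d.curve_mem c s).2.trans_lt h0
    push Not at h0
    have hm := (d.curve_mem c s₀).1
    have h1 : d.gap c s₀ a < 0 := lt_of_lt_of_le (gap_strictAnti hd hc s₀ hm ha h0)
      ((d.curve_spec c s₀).2.2 (ha.trans_le h0))
    filter_upwards [((continuous_gap_left c a).tendsto s₀).eventually_lt_const h1] with s hs
    exact curve_lt hd hc (hm.trans_lt ha) hs

/-- In the closed quadrant the zeros of `P` away from the origin lie on the imaginary axis. The
curve is there only if the modulus is still at least `c > 0`. -/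
lemma P_curve_ne_zero (hc : 0 < c) (s : ℝ) : d.P (polarPt s (d.curve c s)) ≠ 0 := by
  have hpi := Real.pi_pos
  obtain ⟨hm, hge, -⟩ := d.curve_spec c s
  rcases eq_or_lt_of_le hm.2 with h | h
  · intro h0
    have h1 := hge (by rw [h]; positivity)
    rw [gap, h0, norm_zero, zero_sub] at h1
    have := norm_pos_iff.2 (Q_ne_zero (d := d) (s := s) (θ := d.curve c s) (by rw [h]; positivity) hm.2)
    nlinarith
  · exact P_ne_zero hm.1 h

lemma Q_curve_ne_zero (c s : ℝ) : d.Q (polarPt s (d.curve c s)) ≠ 0 := by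
  have hpi := Real.pi_pos
  obtain ⟨hm, -, hle⟩ := d.curve_spec c s
  rcases eq_or_lt_of_le hm.1 with h | h
  · intro h0
    have h1 := hle (by rw [← h]; positivity)
    rw [gap, h0, norm_zero, mul_zero, sub_zero] at h1
    have := norm_pos_iff.2 (P_ne_zero (d := d) (s := s) (θ := d.curve c s) hm.1
      (by rw [← h]; positivity))
    linarith
  · exact Q_ne_zero h hm.2

lemma continuous_phase (hd : d.HasFactor) (hc : 0 < c) : Continuous (d.phase c) := by
  refine continuous_iff_continuousAt.2 fun s₀ => ?_
  have h : ContinuousOn (d.phase c) (Set.Iic (s₀ + 1)) := by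
    refine (continuousOn_ang (d := d) (s₀ + 1)).comp (f := fun s => (s, d.curve c s)) ?_ ?_
    · exact (continuous_id.prodMk (continuous_curve hd hc)).continuousOn
    · intro s hs
      exact ⟨hs, d.curve_mem c s, P_curve_ne_zero hc s, Q_curve_ne_zero c s⟩
  exact h.continuousAt (Iic_mem_nhds (by linarith))

lemma log_le_of_gap_nonneg (hc : 0 < c) {s θ : ℝ} (hP : d.P (polarPt s θ) ≠ 0)
    (hQ : d.Q (polarPt s θ) ≠ 0) :
    (0 ≤ d.gap c s θ →
      Real.log c ≤ Real.log ‖d.P (polarPt s θ)‖ - Real.log ‖d.Q (polarPt s θ)‖) ∧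
    (d.gap c s θ ≤ 0 →
      Real.log ‖d.P (polarPt s θ)‖ - Real.log ‖d.Q (polarPt s θ)‖ ≤ Real.log c) := by
  have p := norm_pos_iff.2 hP
  have q := norm_pos_iff.2 hQ
  have e : Real.log (c * ‖d.Q (polarPt s θ)‖) = Real.log c + Real.log ‖d.Q (polarPt s θ)‖ :=
    Real.log_mul hc.ne' q.ne'
  constructor
  · intro h
    have := Real.log_le_log (mul_pos hc q) (sub_nonneg.1 h)
    linarith
  · intro h
    have := Real.log_le_log p (sub_nonpos.1 h)
    linarith

/-- On the true level curve the first factor vanishes. In general, of two points at different angles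
the lower one is below `π/2`, hence has modulus at most `c`, and the upper one is above `0`, hence
has modulus at least `c`. So the term `ΔL · Δθ` has the sign that makes the argument monotone also
where the curve runs along an axis. -/
lemma curve_log_mul_nonneg (hc : 0 < c) (s₁ s₂ : ℝ) :
    0 ≤ ((Real.log ‖d.P (polarPt s₂ (d.curve c s₂))‖ - Real.log ‖d.Q (polarPt s₂ (d.curve c s₂))‖)
        - (Real.log ‖d.P (polarPt s₁ (d.curve c s₁))‖
          - Real.log ‖d.Q (polarPt s₁ (d.curve c s₁))‖)) * (d.curve c s₂ - d.curve c s₁) := by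
  obtain ⟨m₁, ge₁, le₁⟩ := d.curve_spec c s₁
  obtain ⟨m₂, ge₂, le₂⟩ := d.curve_spec c s₂
  have l₁ := log_le_of_gap_nonneg hc (P_curve_ne_zero (d := d) hc s₁) (Q_curve_ne_zero c s₁)
  have l₂ := log_le_of_gap_nonneg hc (P_curve_ne_zero (d := d) hc s₂) (Q_curve_ne_zero c s₂)
  rcases lt_trichotomy (d.curve c s₁) (d.curve c s₂) with h | h | h
  · have a := l₁.2 (le₁ (h.trans_le m₂.2))
    have b := l₂.1 (ge₂ (m₁.1.trans_lt h))
    exact mul_nonneg (by linarith) (by linarith)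
  · rw [h]; simp
  · have a := l₂.2 (le₂ (h.trans_le m₁.2))
    have b := l₁.1 (ge₁ (m₂.1.trans_lt h))
    exact mul_nonneg_of_nonpos_of_nonpos (by linarith) (by linarith)

lemma phase_monotone (hc : 0 < c) : Monotone (d.phase c) := by
  intro s₁ s₂ h
  rcases eq_or_lt_of_le h with h | h
  · rw [h]
  have k := kernel_nonneg (d.curve_mem c s₁) (d.curve_mem c s₂) (P_curve_ne_zero hc s₁)
    (Q_curve_ne_zero c s₁) (P_curve_ne_zero hc s₂) (Q_curve_ne_zero c s₂)
  have := (curve_log_mul_nonneg (d := d) hc s₁ s₂).trans k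
  have := nonneg_of_mul_nonneg_left this (sub_pos.2 h)
  exact sub_nonneg.1 this

lemma phase_lt (hd : d.HasFactor) (hc : 0 < c) {s₁ s₂ : ℝ} (h : s₁ < s₂)
    (hne : d.curve c s₁ ≠ d.curve c s₂ ∨ d.curve c s₁ ∈ Set.Ioo 0 (Real.pi / 2)) :
    d.phase c s₁ < d.phase c s₂ := by
  have k := kernel_pos hd (d.curve_mem c s₁) (d.curve_mem c s₂) (P_curve_ne_zero hc s₁)
    (Q_curve_ne_zero c s₁) (P_curve_ne_zero hc s₂) (Q_curve_ne_zero c s₂)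
    (hne.imp_right fun h' => ⟨h', h.ne⟩)
  have := (curve_log_mul_nonneg (d := d) hc s₁ s₂).trans_lt k
  exact sub_pos.1 (pos_of_mul_pos_left this (sub_pos.2 h).le)

/-- The phase can stay constant only while the curve stays on one axis. -/
lemma curve_eq_of_phase_eq (hd : d.HasFactor) (hc : 0 < c) {s₁ s₂ : ℝ} (h : s₁ ≠ s₂)
    (he : d.phase c s₁ = d.phase c s₂) :
    d.curve c s₁ = d.curve c s₂ ∧ d.curve c s₁ ∉ Set.Ioo 0 (Real.pi / 2) := by
  rcases lt_or_gt_of_ne h with h | h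
  · by_contra hn
    rw [not_and_or, not_not] at hn
    exact (phase_lt hd hc h hn).ne he
  · by_contra hn
    rw [not_and_or, not_not] at hn
    have : d.curve c s₂ ≠ d.curve c s₁ ∨ d.curve c s₂ ∈ Set.Ioo 0 (Real.pi / 2) := by
      by_cases e : d.curve c s₁ = d.curve c s₂
      · exact Or.inr (e ▸ hn.resolve_left (not_not.2 e))
      · exact Or.inl (Ne.symm e)
    exact (phase_lt hd hc h this).ne' he

/-- The quotient is real on the real axis. -/
lemma ang_zero_eq (d : QuotientData) {s : ℝ} (hQ : d.Q (polarPt s 0) ≠ 0) :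
    ∃ k : ℤ, d.ang s 0 = k * Real.pi := by
  have hP : d.P (polarPt s 0) ≠ 0 := P_ne_zero le_rfl (by positivity)
  have e := quotient_polar hP hQ
  have hz : (starRingEnd ℂ) (polarPt s 0) = polarPt s 0 := by
    rw [polarPt, ← Complex.exp_conj]; simp
  have hr : (d.P (polarPt s 0) / d.Q (polarPt s 0)).im = 0 := by
    rw [← conj_eq_iff_im, map_div₀, ← P_conj, ← Q_conj, hz]
  rw [e, im_ofReal_mul, exp_ofReal_mul_I_im] at hr
  have hne : ‖d.P (polarPt s 0)‖ / ‖d.Q (polarPt s 0)‖ ≠ 0 :=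
    div_ne_zero (norm_ne_zero_iff.2 hP) (norm_ne_zero_iff.2 hQ)
  obtain ⟨k, hk⟩ := Real.sin_eq_zero_iff.1 ((mul_eq_zero.1 hr).resolve_left hne)
  exact ⟨k, hk.symm⟩

/-- On the imaginary axis `conj z = -z`, so an odd function that commutes with conjugation takes
imaginary values there. -/
lemma cos_ang_pi_div_two (d : QuotientData) {s : ℝ} (hP : d.P (polarPt s (Real.pi / 2)) ≠ 0) :
    Real.cos (d.ang s (Real.pi / 2)) = 0 := by
  have hQ : d.Q (polarPt s (Real.pi / 2)) ≠ 0 := Q_ne_zero (by positivity) le_rfl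
  have e := quotient_polar hP hQ
  have hz : (starRingEnd ℂ) (polarPt s (Real.pi / 2)) = -polarPt s (Real.pi / 2) := by
    apply Complex.ext <;> simp [polarPt_re, polarPt_im]
  have hr : (d.P (polarPt s (Real.pi / 2)) / d.Q (polarPt s (Real.pi / 2))).re = 0 := by
    have : (starRingEnd ℂ) (d.P (polarPt s (Real.pi / 2)) / d.Q (polarPt s (Real.pi / 2)))
        = -(d.P (polarPt s (Real.pi / 2)) / d.Q (polarPt s (Real.pi / 2))) := by
      rw [map_div₀, ← P_conj, ← Q_conj, hz, P_neg, Q_neg, div_neg,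
        mul_div_mul_left _ _ (pow_ne_zero _ (by norm_num))]
    have := congrArg re this
    rw [conj_re, neg_re] at this
    linarith
  rw [e, re_ofReal_mul, exp_ofReal_mul_I_re] at hr
  have hne : ‖d.P (polarPt s (Real.pi / 2))‖ / ‖d.Q (polarPt s (Real.pi / 2))‖ ≠ 0 :=
    div_ne_zero (norm_ne_zero_iff.2 hP) (norm_ne_zero_iff.2 hQ)
  exact (mul_eq_zero.1 hr).resolve_left hne

lemma phase_of_curve_eq_zero {s : ℝ} (h : d.curve c s = 0) : ∃ k : ℤ, d.phase c s = k * Real.pi := by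
  have hQ := Q_curve_ne_zero (d := d) c s
  rw [phase, h]
  rw [h] at hQ
  exact d.ang_zero_eq hQ

lemma cos_phase_of_curve_eq_pi_div_two (hc : 0 < c) {s : ℝ} (h : d.curve c s = Real.pi / 2) :
    Real.cos (d.phase c s) = 0 := by
  have hP := P_curve_ne_zero (d := d) hc s
  rw [phase, h]
  rw [h] at hP
  exact d.cos_ang_pi_div_two hP

lemma sin_phase_of_curve_eq_zero {s : ℝ} (h : d.curve c s = 0) : Real.sin (d.phase c s) = 0 := by
  obtain ⟨k, hk⟩ := phase_of_curve_eq_zero h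
  rw [hk, Real.sin_int_mul_pi]

lemma tendsto_polarPt (θ : ℝ) : Filter.Tendsto (fun s => polarPt s θ) Filter.atBot (nhds 0) := by
  rw [tendsto_zero_iff_norm_tendsto_zero]
  simpa [norm_polarPt] using Real.tendsto_exp_atBot

/-- Near the origin the quotient behaves like `1 / z`: its modulus exceeds `c` on the whole quarter
circle, so the curve runs along the imaginary axis, where `1 / z` has argument `-π/2`. -/
lemma phase_start_low (hd : d.HasFactor) (hc : 0 < c) (hm : d.m = 0) :
    ∃ s₀, ∀ s ≤ s₀, d.curve c s = Real.pi / 2 ∧ d.phase c s = -(Real.pi / 2) := by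
  have hpi := Real.pi_pos
  have hn : d.n = 1 := by
    rcases d.exponents with h | h
    · exact h.2
    · omega
  have hg : Filter.Tendsto (fun s => d.gap c s (Real.pi / 2)) Filter.atBot (nhds 1) := by
    have h1 := ((d.differentiable_P.continuous.tendsto 0).comp (tendsto_polarPt (Real.pi / 2))).norm
    have h2 := ((d.differentiable_Q.continuous.tendsto 0).comp (tendsto_polarPt (Real.pi / 2))).norm
    have := h1.sub (h2.const_mul c)
    simpa [P, Q, hm, hn, genusProd_zero, gap] using this
  obtain ⟨R, hR⟩ := exists_genusArg_pi_eq_zero d.x_summable d.x_pos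
  obtain ⟨s₁, h₁⟩ := Filter.eventually_atBot.1 (hg.eventually (lt_mem_nhds one_pos))
  refine ⟨min s₁ (R / 2), fun s hs => ?_⟩
  have hcv : d.curve c s = Real.pi / 2 := curve_eq hd hc
    ⟨⟨by positivity, le_rfl⟩, fun _ => (h₁ s (hs.trans (min_le_left _ _))).le,
      fun h => absurd h (lt_irrefl _)⟩
  refine ⟨hcv, ?_⟩
  have h2 : 2 * s ≤ R := by linarith [hs.trans (min_le_right _ _)]
  rw [phase, hcv, ang, mul_div_cancel₀ _ two_ne_zero, hR _ h2, sub_self, genusArg_zero_right, hm, hn]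
  push_cast; ring

/-- Near the origin the quotient behaves like `z`: its modulus is below `c`, so the curve runs along
the positive real axis with argument `0`. -/
lemma phase_start_high (hd : d.HasFactor) (hc : 0 < c) (hm : d.m = 1) :
    ∃ s₀, ∀ s ≤ s₀, d.curve c s = 0 ∧ d.phase c s = 0 := by
  have hpi := Real.pi_pos
  have hn : d.n = 0 := by
    rcases d.exponents with h | h
    · omega
    · exact h.2
  have hg : Filter.Tendsto (fun s => d.gap c s 0) Filter.atBot (nhds (-c)) := by
    have h1 := ((d.differentiable_P.continuous.tendsto 0).comp (tendsto_polarPt 0)).norm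
    have h2 := ((d.differentiable_Q.continuous.tendsto 0).comp (tendsto_polarPt 0)).norm
    have := h1.sub (h2.const_mul c)
    simpa [P, Q, hm, hn, genusProd_zero, gap] using this
  obtain ⟨R, hR⟩ := exists_genusArg_pi_eq_zero d.y_summable d.y_pos
  obtain ⟨s₁, h₁⟩ := Filter.eventually_atBot.1 (hg.eventually (gt_mem_nhds (neg_neg_iff_pos.2 hc)))
  refine ⟨min s₁ (R / 2), fun s hs => ?_⟩
  have hcv : d.curve c s = 0 := (curve_eq_zero_iff hd hc).2 (h₁ s (hs.trans (min_le_left _ _))).le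
  refine ⟨hcv, ?_⟩
  have h2 : 2 * s ≤ R := by linarith [hs.trans (min_le_right _ _)]
  rw [phase, hcv, ang, mul_zero, mul_zero, sub_zero, hR _ h2, genusArg_zero_right]
  simp

/-- The common value, up to a reflection, of the quotient at the point of the level curve. -/
lemma H_curve_eq_zero_iff (hc : 0 < c) {s : ℝ} {β : ℂ} :
    d.H β (polarPt s (d.curve c s)) = 0 ∧ ‖β‖ = c ↔
      d.gap c s (d.curve c s) = 0 ∧ β = c * exp (d.phase c s * I) := by
  have hP := P_curve_ne_zero (d := d) hc s
  have hQ := Q_curve_ne_zero (d := d) c s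
  have e := quotient_polar hP hQ
  have q := norm_pos_iff.2 hQ
  have hH : d.H β (polarPt s (d.curve c s)) = 0 ↔
      β = d.P (polarPt s (d.curve c s)) / d.Q (polarPt s (d.curve c s)) := by
    rw [H, sub_eq_zero, eq_div_iff hQ, eq_comm]
  have hgap : d.gap c s (d.curve c s) = 0 ↔
      ‖d.P (polarPt s (d.curve c s))‖ / ‖d.Q (polarPt s (d.curve c s))‖ = c := by
    rw [gap, sub_eq_zero, div_eq_iff q.ne']
  rw [hH, hgap]
  constructor
  · rintro ⟨h1, h2⟩
    have h3 : ‖d.P (polarPt s (d.curve c s))‖ / ‖d.Q (polarPt s (d.curve c s))‖ = c := by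
      rw [← norm_div, ← h1, h2]
    refine ⟨h3, ?_⟩
    rw [h1, e, h3, phase]
  · rintro ⟨h1, h2⟩
    refine ⟨?_, ?_⟩
    · rw [e, h1, h2, phase]
    · rw [h2, norm_mul, norm_exp_ofReal_mul_I, mul_one, norm_real, Real.norm_of_nonneg hc.le]

/-- The reflected zero lies on the circle of radius `|z|` at modulus exactly `|α|`, and the curve is
the only such point. This and `zero_of_curve` translate zeros into values of the phase. -/
lemma curve_of_zero (hd : d.HasFactor) {α z : ℂ} (hα : α ≠ 0) (hz : d.H α z = 0) :
    d.gap ‖α‖ (Real.log ‖z‖) (d.curve ‖α‖ (Real.log ‖z‖)) = 0 ∧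
    ∃ e₁ e₂ : ℝ, (e₁ = 1 ∨ e₁ = -1) ∧ (e₂ = 1 ∨ e₂ = -1) ∧
      z = reflect e₁ e₂ (polarPt (Real.log ‖z‖) (d.curve ‖α‖ (Real.log ‖z‖))) ∧
      α = reflect e₁ e₂ (‖α‖ * exp (d.phase ‖α‖ (Real.log ‖z‖) * I)) := by
  have hc : 0 < ‖α‖ := norm_pos_iff.2 hα
  have hz0 : z ≠ 0 := by rintro rfl; exact d.H_zero_ne_zero hα hz
  obtain ⟨e₁, e₂, θ, h₁, h₂, hθ, e⟩ := exists_reflect_polarPt hz0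
  have hw : d.H (reflect e₁ e₂ α) (polarPt (Real.log ‖z‖) θ) = 0 := by
    rw [← H_reflect_eq_zero_iff d h₁ h₂, reflect_reflect h₁ h₂, ← e, hz]
  have hg : d.gap ‖α‖ (Real.log ‖z‖) θ = 0 := by
    rw [H, sub_eq_zero] at hw
    rw [gap, hw, norm_mul, norm_reflect h₁ h₂, sub_self]
  have hcv := curve_eq_of_gap_eq_zero hd hc hθ hg
  rw [← hcv] at hw hg e
  have := ((H_curve_eq_zero_iff (d := d) (s := Real.log ‖z‖) hc).1 ⟨hw, norm_reflect h₁ h₂ α⟩).2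
  exact ⟨hg, e₁, e₂, h₁, h₂, e, by rw [← this, reflect_reflect h₁ h₂]⟩

lemma zero_of_curve {α : ℂ} (hα : α ≠ 0) {s e₁ e₂ : ℝ} (h₁ : e₁ = 1 ∨ e₁ = -1)
    (h₂ : e₂ = 1 ∨ e₂ = -1) (hg : d.gap ‖α‖ s (d.curve ‖α‖ s) = 0)
    (h : α = reflect e₁ e₂ (‖α‖ * exp (d.phase ‖α‖ s * I))) :
    d.H α (reflect e₁ e₂ (polarPt s (d.curve ‖α‖ s))) = 0 := by
  have := ((H_curve_eq_zero_iff (norm_pos_iff.2 hα)).2 ⟨hg, rfl⟩).1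
  rw [← H_reflect_eq_zero_iff d h₁ h₂, ← h] at this
  exact this

end QuotientData

/-! ### Multiplicities from the kernel inequality on short rays -/

namespace QuotientData

variable {d : QuotientData}

/-- The relative deviation of the quotient from the value `β`. -/
noncomputable def dev (d : QuotientData) (β z : ℂ) : ℂ := d.P z / d.Q z / β - 1

/-- The point at distance `ε` from `(s₀, θ₀)` in the direction `φ`, in logarithmic coordinates. -/
noncomputable def rayPt (s₀ θ₀ φ ε : ℝ) : ℂ := polarPt (s₀ + ε * Real.cos φ) (θ₀ + ε * Real.sin φ)

lemma rayPt_eq (s₀ θ₀ φ ε : ℝ) :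
    rayPt s₀ θ₀ φ ε = polarPt s₀ θ₀ * exp (ε * exp (φ * I)) := by
  rw [rayPt, polarPt, polarPt, ← Complex.exp_add, exp_mul_I (φ : ℂ)]
  push_cast; ring_nf

lemma rayPt_zero (s₀ θ₀ φ : ℝ) : rayPt s₀ θ₀ φ 0 = polarPt s₀ θ₀ := by simp [rayPt]

lemma continuous_rayPt (s₀ θ₀ φ : ℝ) : Continuous (rayPt s₀ θ₀ φ) := by
  unfold rayPt polarPt; fun_prop

lemma tendsto_rayPt_div (s₀ θ₀ φ : ℝ) :
    Filter.Tendsto (fun ε : ℝ => (rayPt s₀ θ₀ φ ε - polarPt s₀ θ₀) / (ε : ℂ))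
      (nhdsWithin 0 (Set.Ioi 0)) (nhds (polarPt s₀ θ₀ * exp (φ * I))) := by
  have h : HasDerivAt (rayPt s₀ θ₀ φ) (polarPt s₀ θ₀ * exp (φ * I)) 0 := by
    have e1 : HasDerivAt (fun ε : ℝ => (ε : ℂ) * exp (φ * I)) (1 * exp (φ * I)) 0 :=
      (Complex.ofRealCLM.hasDerivAt (x := (0 : ℝ))).mul_const _
    have e2 := (e1.cexp).const_mul (polarPt s₀ θ₀)
    have e3 : rayPt s₀ θ₀ φ = fun ε : ℝ => polarPt s₀ θ₀ * exp (ε * exp (φ * I)) :=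
      funext fun ε => rayPt_eq s₀ θ₀ φ ε
    rw [e3]
    simpa using e2
  have := (hasDerivAt_iff_tendsto_slope.1 h).mono_left
    (nhdsWithin_mono 0 (fun x (hx : 0 < x) => (ne_of_gt hx : x ≠ 0)))
  refine this.congr fun ε => ?_
  rw [slope_def_module, rayPt_zero, sub_zero, real_smul, ofReal_inv, inv_mul_eq_div]

/-- At a `β`-point of multiplicity `q`, the relative deviation in logarithmic coordinates is `K ε^q
e^{iqφ}` to leading order, with the same `K ≠ 0` for all directions. -/
lemma exists_tendsto_dev {s₀ θ₀ : ℝ} {β : ℂ} (hQ : d.Q (polarPt s₀ θ₀) ≠ 0) (hβ : β ≠ 0) {q : ℕ}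
    (hq : analyticOrderAt (d.H β) (polarPt s₀ θ₀) = q) :
    ∃ K : ℂ, K ≠ 0 ∧ ∀ φ : ℝ, Filter.Tendsto
      (fun ε : ℝ => d.dev β (rayPt s₀ θ₀ φ ε) / (ε : ℂ) ^ q)
      (nhdsWithin 0 (Set.Ioi 0)) (nhds (K * exp (q * φ * I))) := by
  have ha : AnalyticAt ℂ (d.H β) (polarPt s₀ θ₀) := (d.differentiable_H β).analyticAt _
  obtain ⟨g, hg, hg0, he⟩ := ha.analyticOrderAt_eq_natCast.1 hq
  refine ⟨polarPt s₀ θ₀ ^ q * (g (polarPt s₀ θ₀) / (β * d.Q (polarPt s₀ θ₀))),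
    mul_ne_zero (pow_ne_zero _ (polarPt_ne_zero _ _)) (div_ne_zero hg0 (mul_ne_zero hβ hQ)),
    fun φ => ?_⟩
  have hray : Filter.Tendsto (rayPt s₀ θ₀ φ) (nhdsWithin 0 (Set.Ioi 0))
      (nhds (polarPt s₀ θ₀)) := by
    have := (continuous_rayPt s₀ θ₀ φ).tendsto 0
    rw [rayPt_zero] at this
    exact this.mono_left nhdsWithin_le_nhds
  have hQc : Filter.Tendsto d.Q (nhds (polarPt s₀ θ₀)) (nhds (d.Q (polarPt s₀ θ₀))) :=
    d.differentiable_Q.continuous.tendsto _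
  have h1 := ((tendsto_rayPt_div s₀ θ₀ φ).pow q).mul ((hg.continuousAt.tendsto.comp hray).div
    ((hQc.comp hray).const_mul β) (mul_ne_zero hβ hQ))
  have e1 : (polarPt s₀ θ₀ * exp (φ * I)) ^ q * (g (polarPt s₀ θ₀) / (β * d.Q (polarPt s₀ θ₀)))
      = polarPt s₀ θ₀ ^ q * (g (polarPt s₀ θ₀) / (β * d.Q (polarPt s₀ θ₀))) * exp (q * φ * I) := by
    rw [mul_pow, ← Complex.exp_nat_mul]; ring_nf
  rw [e1] at h1
  refine h1.congr' ?_
  filter_upwards [hray.eventually he, (hQc.comp hray).eventually_ne hQ] with ε h2 h3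
  simp only [Function.comp_apply, Pi.div_apply] at h3 ⊢
  have h4 : d.dev β (rayPt s₀ θ₀ φ ε) =
      d.H β (rayPt s₀ θ₀ φ ε) / (β * d.Q (rayPt s₀ θ₀ φ ε)) := by
    rw [dev, H]; field_simp
  rw [h4, h2, smul_eq_mul, div_pow]
  ring

/-- The kernel inequality between the point and its neighbour at distance `ε` in the direction `φ`
reads `Im (Δ(log F) · e^{-iφ}) ≥ 0`. Since `Δ(log F) = log (1 + dev) ~ K ε^q e^{iqφ}`, division by
`ε^q` and passage to the limit give the claim. -/
lemma leading_coeff_im_nonneg {s₀ θ₀ : ℝ} {β : ℂ} (hθ₀ : θ₀ ∈ Set.Icc 0 (Real.pi / 2))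
    (hP : d.P (polarPt s₀ θ₀) ≠ 0) (hQ : d.Q (polarPt s₀ θ₀) ≠ 0)
    (hβ : d.H β (polarPt s₀ θ₀) = 0) {q : ℕ} (hq0 : q ≠ 0) {K : ℂ} {φ : ℝ}
    (hK : Filter.Tendsto (fun ε : ℝ => d.dev β (rayPt s₀ θ₀ φ ε) / (ε : ℂ) ^ q)
      (nhdsWithin 0 (Set.Ioi 0)) (nhds (K * exp (q * φ * I))))
    (hφ : ∀ᶠ ε : ℝ in nhdsWithin 0 (Set.Ioi 0), θ₀ + ε * Real.sin φ ∈ Set.Icc 0 (Real.pi / 2)) :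
    0 ≤ (K * exp ((q - 1 : ℝ) * φ * I)).im := by
  have hβe : β = d.P (polarPt s₀ θ₀) / d.Q (polarPt s₀ θ₀) := by
    rw [H, sub_eq_zero] at hβ
    rw [eq_div_iff hQ, hβ]
  have hβ0 : β ≠ 0 := by rw [hβe]; exact div_ne_zero hP hQ
  have hε : Filter.Tendsto (fun ε : ℝ => (ε : ℂ) ^ q) (nhdsWithin 0 (Set.Ioi 0)) (nhds 0) := by
    have : Continuous fun ε : ℝ => (ε : ℂ) ^ q := by fun_prop
    have := (this.tendsto 0).mono_left (nhdsWithin_le_nhds (s := Set.Ioi 0))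
    simpa [hq0] using this
  have hpos : ∀ᶠ ε : ℝ in nhdsWithin 0 (Set.Ioi 0), 0 < ε := self_mem_nhdsWithin
  have hdev : Filter.Tendsto (fun ε : ℝ => d.dev β (rayPt s₀ θ₀ φ ε))
      (nhdsWithin 0 (Set.Ioi 0)) (nhds 0) := by
    have := hK.mul hε
    rw [mul_zero] at this
    refine this.congr' ?_
    filter_upwards [hpos] with ε h
    exact div_mul_cancel₀ _ (pow_ne_zero _ (ofReal_ne_zero.2 h.ne'))
  -- `dslope log 1 (1 + w)` is `log (1 + w) / w` for `w ≠ 0` and `1` at `w = 0`, so `log (1 + w) ~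
  -- w` can be used without excluding zeros of the deviation.
  have hd1 : HasDerivAt log 1 (1 : ℂ) := by simpa using Complex.hasDerivAt_log one_mem_slitPlane
  have hsl : Filter.Tendsto (fun ε : ℝ => dslope log 1 (1 + d.dev β (rayPt s₀ θ₀ φ ε)))
      (nhdsWithin 0 (Set.Ioi 0)) (nhds 1) := by
    have h1 : ContinuousAt (dslope log 1) (1 : ℂ) :=
      continuousAt_dslope_same.2 hd1.differentiableAt
    have h2 := hdev.const_add 1
    rw [add_zero] at h2
    have h3 := h1.tendsto.comp h2
    rwa [dslope_same, hd1.deriv] at h3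
  have hlog : Filter.Tendsto
      (fun ε : ℝ => (log (1 + d.dev β (rayPt s₀ θ₀ φ ε)) / (ε : ℂ) ^ q * exp (-(φ * I))).im)
      (nhdsWithin 0 (Set.Ioi 0)) (nhds (K * exp ((q - 1 : ℝ) * φ * I)).im) := by
    have h1 := ((hK.mul hsl).mul_const (exp (-(φ * I))))
    have e : K * exp (q * φ * I) * 1 * exp (-(φ * I)) = K * exp ((q - 1 : ℝ) * φ * I) := by
      rw [mul_one, mul_assoc, ← Complex.exp_add]; push_cast; ring_nf
    rw [e] at h1
    refine ((Complex.continuous_im.tendsto _).comp h1).congr fun ε => ?_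
    have h2 := sub_smul_dslope (log : ℂ → ℂ) 1 (1 + d.dev β (rayPt s₀ θ₀ φ ε))
    rw [add_sub_cancel_left, log_one, sub_zero, smul_eq_mul] at h2
    simp only [Function.comp_apply]
    rw [← h2]; ring_nf
  refine ge_of_tendsto hlog ?_
  have hray : Filter.Tendsto (rayPt s₀ θ₀ φ) (nhdsWithin 0 (Set.Ioi 0))
      (nhds (polarPt s₀ θ₀)) := by
    have := (continuous_rayPt s₀ θ₀ φ).tendsto 0
    rw [rayPt_zero] at this
    exact this.mono_left nhdsWithin_le_nhds
  have hPe := ((d.differentiable_P.continuous.tendsto _).comp hray).eventually_ne hP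
  have hQe := ((d.differentiable_Q.continuous.tendsto _).comp hray).eventually_ne hQ
  have hang : Filter.Tendsto (fun ε : ℝ => d.ang (s₀ + ε * Real.cos φ) (θ₀ + ε * Real.sin φ))
      (nhdsWithin 0 (Set.Ioi 0)) (nhds (d.ang s₀ θ₀)) := by
    have h1 := continuousOn_ang (d := d) (s₀ + 1) (s₀, θ₀) ⟨by simp, hθ₀, hP, hQ⟩
    refine h1.tendsto.comp
      (f := fun ε : ℝ => (s₀ + ε * Real.cos φ, θ₀ + ε * Real.sin φ))
      (tendsto_nhdsWithin_iff.2 ⟨?_, ?_⟩)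
    · have : Continuous fun ε : ℝ => (s₀ + ε * Real.cos φ, θ₀ + ε * Real.sin φ) := by fun_prop
      have := (this.tendsto 0).mono_left (nhdsWithin_le_nhds (s := Set.Ioi 0))
      simpa using this
    · have h2 : ∀ᶠ ε : ℝ in nhdsWithin 0 (Set.Ioi 0), s₀ + ε * Real.cos φ ≤ s₀ + 1 := by
        have : Continuous fun ε : ℝ => s₀ + ε * Real.cos φ := by fun_prop
        have := (this.tendsto 0).mono_left (nhdsWithin_le_nhds (s := Set.Ioi 0))
        exact this.eventually_le_const (by simp)
      filter_upwards [h2, hφ, hPe, hQe] with ε a b c e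
      exact ⟨a, b, c, e⟩
  -- A change of argument below `π` identifies the principal logarithm of `1 + dev` with the
  -- continuous one, `L + A i`.
  have hsmall : ∀ᶠ ε : ℝ in nhdsWithin 0 (Set.Ioi 0),
      |d.ang (s₀ + ε * Real.cos φ) (θ₀ + ε * Real.sin φ) - d.ang s₀ θ₀| < Real.pi := by
    have := (hang.sub_const (d.ang s₀ θ₀)).abs
    rw [sub_self, abs_zero] at this
    exact this.eventually_lt_const Real.pi_pos
  filter_upwards [hpos, hφ, hPe, hQe, hsmall] with ε h1 h2 h3 h4 h5
  have hk := kernel_nonneg hθ₀ h2 hP hQ h3 h4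
  replace h3 : d.P (polarPt (s₀ + ε * Real.cos φ) (θ₀ + ε * Real.sin φ)) ≠ 0 := h3
  replace h4 : d.Q (polarPt (s₀ + ε * Real.cos φ) (θ₀ + ε * Real.sin φ)) ≠ 0 := h4
  have e0 := quotient_polar hP hQ
  have e1 := quotient_polar h3 h4
  set s := s₀ + ε * Real.cos φ with hs
  set θ := θ₀ + ε * Real.sin φ with hθ
  have hr : rayPt s₀ θ₀ φ ε = polarPt s θ := rfl
  set L := (Real.log ‖d.P (polarPt s θ)‖ - Real.log ‖d.Q (polarPt s θ)‖)
    - (Real.log ‖d.P (polarPt s₀ θ₀)‖ - Real.log ‖d.Q (polarPt s₀ θ₀)‖) with hL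
  set A := d.ang s θ - d.ang s₀ θ₀ with hA
  have hex : 1 + d.dev β (rayPt s₀ θ₀ φ ε) = exp (L + A * I) := by
    have hl : ∀ a : ℂ, a ≠ 0 → (‖a‖ : ℂ) = exp (Real.log ‖a‖ : ℝ) := fun a ha => by
      rw [← ofReal_exp, Real.exp_log (norm_pos_iff.2 ha)]
    rw [hr, dev, add_sub_cancel, hβe, e0, e1, ofReal_div, ofReal_div, hl _ hP, hl _ hQ, hl _ h3,
      hl _ h4, ← Complex.exp_sub, ← Complex.exp_sub, ← Complex.exp_add, ← Complex.exp_add,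
      ← Complex.exp_sub, hL, hA]
    push_cast; ring_nf
  have hlg : log (1 + d.dev β (rayPt s₀ θ₀ φ ε)) = L + A * I := by
    rw [hex, log_exp]
    · simpa using (abs_lt.1 h5).1
    · simpa using (abs_lt.1 h5).2.le
  have hsub : s - s₀ = ε * Real.cos φ := by rw [hs]; ring
  have hsub' : θ - θ₀ = ε * Real.sin φ := by rw [hθ]; ring
  rw [hsub, hsub'] at hk
  have hfin : 0 ≤ A * Real.cos φ - L * Real.sin φ := by
    have : ε * (L * Real.sin φ) ≤ ε * (A * Real.cos φ) := by linarith
    linarith [le_of_mul_le_mul_left this h1]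
  have e3 : log (1 + d.dev β (rayPt s₀ θ₀ φ ε)) / (ε : ℂ) ^ q * exp (-(φ * I))
      = ((ε ^ q)⁻¹ : ℝ) * ((L + A * I) * exp ((-φ : ℝ) * I)) := by
    rw [hlg]; push_cast; rw [neg_mul]; ring
  rw [e3, im_ofReal_mul]
  refine mul_nonneg (inv_nonneg.2 (pow_nonneg h1.le _)) ?_
  rw [mul_im, exp_ofReal_mul_I_re, exp_ofReal_mul_I_im, Real.cos_neg, Real.sin_neg]
  simp
  linarith

/-- The range `[0, 2π)` matters at the edge: with `τ = (q - 1) φ` and `q ≥ 3` it leaves `φ` in `[0,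
π)`, the directions that point into the quadrant. -/
lemma exists_lower_direction {K : ℂ} (hK : K ≠ 0) :
    ∃ τ : ℝ, 0 ≤ τ ∧ τ < 2 * Real.pi ∧ (K * exp (τ * I)).im < 0 := by
  have key : ∀ τ : ℝ, exp (τ * I) = exp ((-(Real.pi / 2) - K.arg : ℝ) * I) →
      (K * exp (τ * I)).im < 0 := by
    intro τ h
    rw [h]
    have e : K * exp ((-(Real.pi / 2) - K.arg : ℝ) * I) = (‖K‖ : ℂ) * exp ((-(Real.pi / 2) : ℝ) * I) := by
      nth_rewrite 1 [← norm_mul_exp_arg_mul_I K]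
      rw [mul_assoc, ← Complex.exp_add]; push_cast; ring_nf
    rw [e, im_ofReal_mul, exp_ofReal_mul_I_im, Real.sin_neg, Real.sin_pi_div_two]
    have := norm_pos_iff.2 hK
    linarith
  have hp := Real.pi_pos
  have a1 := neg_pi_lt_arg K
  have a2 := arg_le_pi K
  by_cases h : 0 ≤ -(Real.pi / 2) - K.arg
  · exact ⟨_, h, by linarith, key _ rfl⟩
  · refine ⟨-(Real.pi / 2) - K.arg + 2 * Real.pi, by linarith, by linarith, key _ ?_⟩
    push_cast
    rw [add_mul, Complex.exp_add, exp_two_pi_mul_I, mul_one]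

/-- At a point of the open quadrant every value is simple. -/
lemma order_le_one {s₀ θ₀ : ℝ} {β : ℂ} (hθ₀ : θ₀ ∈ Set.Ioo 0 (Real.pi / 2))
    (hβ : d.H β (polarPt s₀ θ₀) = 0) {q : ℕ}
    (hq : analyticOrderAt (d.H β) (polarPt s₀ θ₀) = q) : q ≤ 1 := by
  by_contra! h
  have hP := P_ne_zero (d := d) (s := s₀) hθ₀.1.le hθ₀.2
  have hQ := Q_ne_zero (d := d) (s := s₀) hθ₀.1 hθ₀.2.le
  have hβ0 : β ≠ 0 := by
    rintro rfl
    rw [H, zero_mul, sub_zero] at hβ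
    exact hP hβ
  obtain ⟨K, hK, hlim⟩ := exists_tendsto_dev hQ hβ0 hq
  obtain ⟨τ, -, -, hτ⟩ := exists_lower_direction hK
  have hq1 : (q - 1 : ℝ) ≠ 0 := by
    have : (1 : ℝ) < q := by exact_mod_cast h
    linarith
  have := leading_coeff_im_nonneg (Set.Ioo_subset_Icc_self hθ₀) hP hQ hβ (by omega)
    (hlim (τ / (q - 1))) ?_
  · rw [← ofReal_mul, mul_div_cancel₀ _ hq1] at this
    linarith
  · have hc : Continuous fun ε : ℝ => θ₀ + ε * Real.sin (τ / (q - 1)) := by fun_prop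
    have := (hc.tendsto 0).mono_left (nhdsWithin_le_nhds (s := Set.Ioi 0))
    rw [zero_mul, add_zero] at this
    exact this.eventually (Icc_mem_nhds hθ₀.1 hθ₀.2)

lemma eventually_edge_direction {φ : ℝ} (h0 : 0 ≤ φ) (h1 : φ ≤ Real.pi) :
    ∀ᶠ ε : ℝ in nhdsWithin 0 (Set.Ioi 0), 0 + ε * Real.sin φ ∈ Set.Icc 0 (Real.pi / 2) := by
  have hs := Real.sin_nonneg_of_nonneg_of_le_pi h0 h1
  have hc : Continuous fun ε : ℝ => 0 + ε * Real.sin φ := by fun_prop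
  have := (hc.tendsto 0).mono_left (nhdsWithin_le_nhds (s := Set.Ioi 0))
  rw [zero_mul, add_zero] at this
  have hpos : ∀ᶠ ε : ℝ in nhdsWithin 0 (Set.Ioi 0), 0 < ε := self_mem_nhdsWithin
  filter_upwards [this.eventually_le_const (by positivity : (0 : ℝ) < Real.pi / 2), hpos] with ε h h'
  exact ⟨by have := mul_nonneg h'.le hs; linarith, h⟩

/-- Local behaviour of the quotient at a real `β`-point. -/
lemma order_edge {s₀ : ℝ} {β : ℝ} (hβ0 : β ≠ 0) (hβ : d.H β (polarPt s₀ 0) = 0) {q : ℕ}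
    (hq : analyticOrderAt (d.H β) (polarPt s₀ 0) = q) :
    (q = 2 ∧ (∀ᶠ s in nhdsWithin s₀ (Set.Ioi s₀), 0 < d.gap |β| s 0) ∧
      ∀ᶠ s in nhdsWithin s₀ (Set.Iio s₀), 0 < d.gap |β| s 0) ∨
    (q = 1 ∧ (∀ᶠ s in nhdsWithin s₀ (Set.Ioi s₀), 0 < d.gap |β| s 0) ∧
      ∀ᶠ s in nhdsWithin s₀ (Set.Iio s₀), d.gap |β| s 0 < 0) ∨
    (q = 1 ∧ (∀ᶠ s in nhdsWithin s₀ (Set.Ioi s₀), d.gap |β| s 0 < 0) ∧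
      ∀ᶠ s in nhdsWithin s₀ (Set.Iio s₀), 0 < d.gap |β| s 0) := by
  have hpi := Real.pi_pos
  have hβc : (β : ℂ) ≠ 0 := ofReal_ne_zero.2 hβ0
  have hP := P_ne_zero (d := d) (s := s₀) le_rfl (by positivity : (0 : ℝ) < Real.pi / 2)
  have hQ : d.Q (polarPt s₀ 0) ≠ 0 := by
    intro h0
    rw [H, h0, mul_zero, sub_zero] at hβ
    exact hP hβ
  obtain ⟨K, hK, hlim⟩ := exists_tendsto_dev hQ hβc hq
  have hq0 : q ≠ 0 := by
    rintro rfl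
    have : analyticOrderAt (d.H β) (polarPt s₀ 0) ≠ 0 :=
      analyticOrderAt_ne_zero.2 ⟨(d.differentiable_H β).analyticAt _, hβ⟩
    exact this (by simpa using hq)
  have hdir : ∀ φ : ℝ, 0 ≤ φ → φ ≤ Real.pi → 0 ≤ (K * exp ((q - 1 : ℝ) * φ * I)).im := fun φ h0 h1 =>
    leading_coeff_im_nonneg ⟨le_rfl, by positivity⟩ hP hQ hβ hq0 (hlim φ)
      (eventually_edge_direction h0 h1)
  -- For `q ≥ 3` the angle `(q - 1) φ` makes a full turn as `φ` runs over the half circle `[0, π]`,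
  -- so `K e^{i(q-1)φ}` would enter the lower half-plane.
  have hq2 : q ≤ 2 := by
    by_contra! h
    obtain ⟨τ, t0, t1, hτ⟩ := exists_lower_direction hK
    have hq1 : (2 : ℝ) ≤ q - 1 := by
      have : (3 : ℝ) ≤ q := by exact_mod_cast h
      linarith
    have := hdir (τ / (q - 1)) (div_nonneg t0 (by linarith))
      ((div_le_iff₀ (by linarith)).2 (by nlinarith))
    rw [← ofReal_mul, mul_div_cancel₀ _ (by linarith)] at this
    linarith
  have hreal : ∀ s : ℝ, (d.dev β (polarPt s 0)).im = 0 := fun s => by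
    have hz : (starRingEnd ℂ) (polarPt s 0) = polarPt s 0 := by
      rw [polarPt, ← Complex.exp_conj]; simp
    rw [← conj_eq_iff_im]
    rw [dev, map_sub, map_div₀, map_div₀, ← P_conj, ← Q_conj, hz, conj_ofReal, map_one]
  -- On the real axis the deviation is real, so near `s₀` the sign of the gap is the sign of the
  -- deviation.
  have hgap : ∀ s : ℝ, d.Q (polarPt s 0) ≠ 0 → d.gap |β| s 0
      = |β| * ‖d.Q (polarPt s 0)‖ * (|1 + (d.dev β (polarPt s 0)).re| - 1) := fun s hs => by
    have e : ((1 + (d.dev β (polarPt s 0)).re : ℝ) : ℂ) = 1 + d.dev β (polarPt s 0) :=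
      Complex.ext (by simp) (by simp [hreal])
    rw [← Real.norm_eq_abs (1 + _), ← norm_real, e, dev, add_sub_cancel, norm_div, norm_div,
      norm_real, Real.norm_eq_abs, gap]
    have := norm_ne_zero_iff.2 hs
    have := abs_ne_zero.2 hβ0
    field_simp
  have hQev : ∀ᶠ s in nhds s₀, d.Q (polarPt s 0) ≠ 0 := by
    have : Continuous fun s => d.Q (polarPt s 0) :=
      d.differentiable_Q.continuous.comp (by unfold polarPt; fun_prop)
    exact (this.tendsto s₀).eventually_ne hQ
  have hdc : Filter.Tendsto (fun s => (d.dev β (polarPt s 0)).re) (nhds s₀) (nhds 0) := by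
    have h1 : Continuous fun s => polarPt s 0 := by unfold polarPt; fun_prop
    have h2 := ((((d.differentiable_P.continuous.comp h1).tendsto s₀).div
      ((d.differentiable_Q.continuous.comp h1).tendsto s₀) hQ).div_const (β : ℂ)).sub_const 1
    have h3 := (Complex.continuous_re.tendsto _).comp h2
    have h4 : d.P (polarPt s₀ 0) / d.Q (polarPt s₀ 0) / β - 1 = 0 := by
      rw [H, sub_eq_zero] at hβ
      rw [hβ]; field_simp; simp
    simp only [Function.comp_apply] at h3
    rw [h4, zero_re] at h3
    exact h3
  have hpos : ∀ᶠ s in nhds s₀, 0 < (d.dev β (polarPt s 0)).re → 0 < d.gap |β| s 0 := by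
    filter_upwards [hQev] with s h1 h2
    rw [hgap s h1, abs_of_pos (by linarith : 0 < 1 + (d.dev β (polarPt s 0)).re)]
    have := norm_pos_iff.2 h1
    have := abs_pos.2 hβ0
    rw [add_sub_cancel_left]
    positivity
  have hneg : ∀ᶠ s in nhds s₀, (d.dev β (polarPt s 0)).re < 0 → d.gap |β| s 0 < 0 := by
    filter_upwards [hQev, hdc.eventually_const_lt (by norm_num : (-1 : ℝ) < 0)] with s h1 h3 h2
    rw [hgap s h1, abs_of_pos (by linarith : 0 < 1 + (d.dev β (polarPt s 0)).re)]
    have := norm_pos_iff.2 h1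
    have := abs_pos.2 hβ0
    rw [add_sub_cancel_left]
    exact mul_neg_of_pos_of_neg (by positivity) h2
  have hε : ∀ᶠ ε : ℝ in nhdsWithin 0 (Set.Ioi 0), 0 < ε := self_mem_nhdsWithin
  have hre : ∀ (φ : ℝ) (ε : ℝ), (d.dev β (rayPt s₀ 0 φ ε) / (ε : ℂ) ^ q).re
      = (d.dev β (rayPt s₀ 0 φ ε)).re / ε ^ q := fun φ ε => by
    rw [← ofReal_pow, div_ofReal_re]
  have right : Filter.Tendsto (fun s => s - s₀) (nhdsWithin s₀ (Set.Ioi s₀))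
      (nhdsWithin 0 (Set.Ioi 0)) := by
    refine tendsto_nhdsWithin_iff.2 ⟨?_, ?_⟩
    · have : Continuous fun s => s - s₀ := by fun_prop
      have := (this.tendsto s₀).mono_left (nhdsWithin_le_nhds (s := Set.Ioi s₀))
      simpa using this
    · filter_upwards [self_mem_nhdsWithin] with s hs
      exact Set.mem_Ioi.2 (sub_pos.2 (by simpa using hs))
  have left : Filter.Tendsto (fun s => s₀ - s) (nhdsWithin s₀ (Set.Iio s₀))
      (nhdsWithin 0 (Set.Ioi 0)) := by
    refine tendsto_nhdsWithin_iff.2 ⟨?_, ?_⟩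
    · have : Continuous fun s => s₀ - s := by fun_prop
      have := (this.tendsto s₀).mono_left (nhdsWithin_le_nhds (s := Set.Iio s₀))
      simpa using this
    · filter_upwards [self_mem_nhdsWithin] with s hs
      exact Set.mem_Ioi.2 (sub_pos.2 (by simpa using hs))
  have rr : ∀ s, rayPt s₀ 0 0 (s - s₀) = polarPt s 0 := fun s => by simp [rayPt]
  have rl : ∀ s, rayPt s₀ 0 Real.pi (s₀ - s) = polarPt s 0 := fun s => by simp [rayPt]
  have l0 := (Complex.continuous_re.tendsto _).comp (hlim 0)
  have lp := (Complex.continuous_re.tendsto _).comp (hlim Real.pi)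
  have h0e : K * exp (q * (0 : ℝ) * I) = K := by simp
  have hpe : K * exp (q * (Real.pi : ℝ) * I) = K * (-1) ^ q := by
    rw [mul_assoc (q : ℂ), Complex.exp_nat_mul, exp_pi_mul_I]
  rw [h0e] at l0
  rw [hpe] at lp
  -- Along the axis, in the direction `φ = 0`, `K` is a limit of real numbers. Its sign, together
  -- with that of `K (-1)^q` for the direction `φ = π`, decides the sign of the gap on either side.
  have hKim : K.im = 0 := by
    have h1 := (Complex.continuous_im.tendsto _).comp (hlim 0)
    rw [h0e] at h1
    refine tendsto_nhds_unique h1 (tendsto_const_nhds.congr fun ε => ?_)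
    have : rayPt s₀ 0 0 ε = polarPt (s₀ + ε) 0 := by simp [rayPt]
    simp only [Function.comp_apply]
    rw [← ofReal_pow, div_ofReal_im, this, hreal, zero_div]
  have hKre : K.re ≠ 0 := fun h => hK (Complex.ext h hKim)
  have Rpos : 0 < K.re → ∀ᶠ s in nhdsWithin s₀ (Set.Ioi s₀), 0 < d.gap |β| s 0 := fun h => by
    filter_upwards [right.eventually (l0.eventually_const_lt h), right.eventually hε,
      nhdsWithin_le_nhds hpos] with s h1 h2 h3
    simp only [Function.comp_apply] at h1
    rw [hre, rr] at h1
    exact h3 ((div_pos_iff_of_pos_right (pow_pos h2 _)).1 h1)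
  have Rneg : K.re < 0 → ∀ᶠ s in nhdsWithin s₀ (Set.Ioi s₀), d.gap |β| s 0 < 0 := fun h => by
    filter_upwards [right.eventually (l0.eventually_lt_const h), right.eventually hε,
      nhdsWithin_le_nhds hneg] with s h1 h2 h3
    simp only [Function.comp_apply] at h1
    rw [hre, rr] at h1
    exact h3 (by simpa using (div_lt_iff₀ (pow_pos h2 _)).1 h1)
  have Lpos : 0 < (K * (-1) ^ q).re → ∀ᶠ s in nhdsWithin s₀ (Set.Iio s₀), 0 < d.gap |β| s 0 :=
    fun h => by
    filter_upwards [left.eventually (lp.eventually_const_lt h), left.eventually hε,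
      nhdsWithin_le_nhds hpos] with s h1 h2 h3
    simp only [Function.comp_apply] at h1
    rw [hre, rl] at h1
    exact h3 ((div_pos_iff_of_pos_right (pow_pos h2 _)).1 h1)
  have Lneg : (K * (-1) ^ q).re < 0 → ∀ᶠ s in nhdsWithin s₀ (Set.Iio s₀), d.gap |β| s 0 < 0 :=
    fun h => by
    filter_upwards [left.eventually (lp.eventually_lt_const h), left.eventually hε,
      nhdsWithin_le_nhds hneg] with s h1 h2 h3
    simp only [Function.comp_apply] at h1
    rw [hre, rl] at h1
    exact h3 (by simpa using (div_lt_iff₀ (pow_pos h2 _)).1 h1)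
  have hq12 : q = 1 ∨ q = 2 := by omega
  rcases hq12 with h | h
  · subst h
    rcases lt_or_gt_of_ne hKre with h | h
    · exact Or.inr (Or.inr ⟨rfl, Rneg h, Lpos (by simpa using h)⟩)
    · exact Or.inr (Or.inl ⟨rfl, Rpos h, Lneg (by simpa using h)⟩)
  · subst h
    -- For `q = 2` the direction `π/2` gives `Im (K i) ≥ 0`, so `K > 0` and the gap is positive on
    -- both sides.
    have h1 := hdir (Real.pi / 2) (by positivity) (by linarith)
    have e : ((2 : ℕ) - 1 : ℝ) = 1 := by norm_num
    rw [e, ofReal_one, one_mul, mul_im, exp_ofReal_mul_I_re, exp_ofReal_mul_I_im, Real.sin_pi_div_two,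
      Real.cos_pi_div_two] at h1
    have h2 : 0 < K.re := lt_of_le_of_ne (by simpa using h1) (Ne.symm hKre)
    exact Or.inl ⟨rfl, Rpos h2, Lpos (by simpa using h2)⟩

end QuotientData

/-! ### Multiplicities under scaling, conjugation and reflection -/

lemma le_analyticOrderAt_conj_conj {f : ℂ → ℂ} (hf : Differentiable ℂ f) (w : ℂ) (n : ℕ)
    (h : (n : ℕ∞) ≤ analyticOrderAt f w) :
    (n : ℕ∞) ≤ analyticOrderAt (fun z => (starRingEnd ℂ) (f ((starRingEnd ℂ) z)))
      ((starRingEnd ℂ) w) := by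
  have hf' : Differentiable ℂ fun z => (starRingEnd ℂ) (f ((starRingEnd ℂ) z)) := fun z => by
    have := (hf ((starRingEnd ℂ) z)).conj_conj
    simpa [Function.comp_def] using this
  obtain ⟨g, hg, he⟩ := (natCast_le_analyticOrderAt (hf.analyticAt w)).1 h
  have hconj : Filter.Tendsto (starRingEnd ℂ) (nhds ((starRingEnd ℂ) w)) (nhds w) := by
    have := Complex.continuous_conj.tendsto ((starRingEnd ℂ) w)
    rwa [Complex.conj_conj] at this
  refine (natCast_le_analyticOrderAt (hf'.analyticAt _)).2
    ⟨fun z => (starRingEnd ℂ) (g ((starRingEnd ℂ) z)), ?_, ?_⟩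
  · rw [analyticAt_iff_eventually_differentiableAt] at hg ⊢
    filter_upwards [hconj.eventually hg] with z hz
    have := hz.conj_conj
    simpa [Function.comp_def] using this
  · filter_upwards [hconj.eventually he] with z hz
    rw [hz]; simp

lemma analyticOrderAt_conj_conj {f : ℂ → ℂ} (hf : Differentiable ℂ f) (w : ℂ) :
    analyticOrderAt (fun z => (starRingEnd ℂ) (f ((starRingEnd ℂ) z))) ((starRingEnd ℂ) w)
      = analyticOrderAt f w := by
  have hf' : Differentiable ℂ fun z => (starRingEnd ℂ) (f ((starRingEnd ℂ) z)) := fun z => by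
    have := (hf ((starRingEnd ℂ) z)).conj_conj
    simpa [Function.comp_def] using this
  refine le_antisymm ?_ ?_ <;> refine ENat.forall_natCast_le_iff_le.1 fun n hn => ?_
  · simpa using le_analyticOrderAt_conj_conj hf' _ n hn
  · exact le_analyticOrderAt_conj_conj hf w n hn

lemma analyticOrderAt_const_mul {f : ℂ → ℂ} (hf : Differentiable ℂ f) {C : ℂ} (hC : C ≠ 0)
    (w : ℂ) : analyticOrderAt (fun z => C * f z) w = analyticOrderAt f w := by
  have h := analyticOrderAt_mul (f := fun _ => C) (g := f) (z₀ := w) analyticAt_const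
    (hf.analyticAt w)
  have h0 : analyticOrderAt (fun _ : ℂ => C) w = 0 :=
    analyticOrderAt_eq_zero.2 (Or.inr hC)
  rw [h0, zero_add] at h
  exact h

lemma analyticOrderAt_comp_mul_left {f : ℂ → ℂ} {C : ℂ} (hC : C ≠ 0) (w : ℂ) :
    analyticOrderAt (fun z => f (C * z)) w = analyticOrderAt f (C * w) := by
  refine analyticOrderAt_comp_of_deriv_ne_zero (f := f) (g := fun z => C * z) (by fun_prop) ?_
  simpa using hC

namespace QuotientData

variable {d : QuotientData}

lemma analyticOrderAt_H_neg (α w : ℂ) :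
    analyticOrderAt (d.H (-α)) (-w) = analyticOrderAt (d.H α) w := by
  have h1 := analyticOrderAt_comp_mul_left (f := d.H (-α)) (C := -1) (by norm_num) w
  have h2 : (fun z => d.H (-α) (-1 * z)) = fun z => (-1) ^ d.m * d.H α z :=
    funext fun z => by rw [neg_one_mul, H_neg]
  rw [h2, analyticOrderAt_const_mul (d.differentiable_H α) (pow_ne_zero _ (by norm_num)),
    neg_one_mul] at h1
  exact h1.symm

lemma analyticOrderAt_H_conj (α w : ℂ) :
    analyticOrderAt (d.H ((starRingEnd ℂ) α)) ((starRingEnd ℂ) w) = analyticOrderAt (d.H α) w := by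
  have h1 := analyticOrderAt_conj_conj (d.differentiable_H α) w
  have h2 : (fun z => (starRingEnd ℂ) (d.H α ((starRingEnd ℂ) z))) = d.H ((starRingEnd ℂ) α) :=
    funext fun z => by rw [← H_conj, Complex.conj_conj]
  rwa [h2] at h1

lemma analyticOrderAt_H_reflect {e₁ e₂ : ℝ} (h₁ : e₁ = 1 ∨ e₁ = -1) (h₂ : e₂ = 1 ∨ e₂ = -1)
    (α w : ℂ) :
    analyticOrderAt (d.H (reflect e₁ e₂ α)) (reflect e₁ e₂ w) = analyticOrderAt (d.H α) w := by
  rcases reflect_cases h₁ h₂ with h | h | h | h <;>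
    simp only [h, analyticOrderAt_H_neg, analyticOrderAt_H_conj]

lemma analyticOrderAt_H_ne_top {α : ℂ} (hα : α ≠ 0) (w : ℂ) : analyticOrderAt (d.H α) w ≠ ⊤ := by
  intro h
  have h1 := (AnalyticOnNhd.eq_of_eventuallyEq (f := d.H α) (g := fun _ => 0)
    (fun z _ => (d.differentiable_H α).analyticAt z) (fun z _ => analyticAt_const)
    (analyticOrderAt_eq_top.1 h))
  exact d.H_zero_ne_zero hα (congrFun h1 0)

lemma analyticOrderAt_H_ne_zero {α w : ℂ} (hw : d.H α w = 0) : analyticOrderAt (d.H α) w ≠ 0 :=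
  analyticOrderAt_ne_zero.2 ⟨(d.differentiable_H α).analyticAt w, hw⟩

lemma log_norm_reflect_polarPt {e₁ e₂ : ℝ} (h₁ : e₁ = 1 ∨ e₁ = -1) (h₂ : e₂ = 1 ∨ e₂ = -1)
    (s θ : ℝ) : Real.log ‖reflect e₁ e₂ (polarPt s θ)‖ = s := by
  rw [norm_reflect h₁ h₂, norm_polarPt, Real.log_exp]

/-- The reflection to the first quadrant preserves multiplicities, and inside the quadrant every
value is simple. -/
lemma order_eq_one_of_interior (hd : d.HasFactor) {α z : ℂ} (hα : α ≠ 0) (hz : d.H α z = 0)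
    (hθ : d.curve ‖α‖ (Real.log ‖z‖) ∈ Set.Ioo 0 (Real.pi / 2)) :
    analyticOrderAt (d.H α) z = 1 := by
  obtain ⟨hg, e₁, e₂, h₁, h₂, e, ea⟩ := curve_of_zero hd hα hz
  set β := (‖α‖ : ℂ) * exp (d.phase ‖α‖ (Real.log ‖z‖) * I) with hβ
  have h0 : d.H β (polarPt (Real.log ‖z‖) (d.curve ‖α‖ (Real.log ‖z‖))) = 0 := by
    rw [← H_reflect_eq_zero_iff d h₁ h₂, ← e, ← ea, hz]
  have ho := analyticOrderAt_H_reflect (d := d) h₁ h₂ β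
    (polarPt (Real.log ‖z‖) (d.curve ‖α‖ (Real.log ‖z‖)))
  rw [← e, ← ea] at ho
  obtain ⟨q, hq⟩ := ENat.ne_top_iff_exists.1 (analyticOrderAt_H_ne_top (d := d) hα z)
  have h1 := order_le_one hθ h0 (q := q) (by rw [← ho, hq])
  have h2 := analyticOrderAt_H_ne_zero hz
  rw [← hq] at h2 ⊢
  have : q ≠ 0 := by exact_mod_cast h2
  have : q = 1 := by omega
  simp [this]

/-! ### Generic `α`: one zero for each quarter-turn of the phase -/

lemma phase_ge (hd : d.HasFactor) {c : ℝ} (hc : 0 < c) (s : ℝ) : -(Real.pi / 2) ≤ d.phase c s := by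
  have hpi := Real.pi_pos
  rcases d.exponents with ⟨h, -⟩ | ⟨h, -⟩
  · obtain ⟨s₀, h0⟩ := phase_start_low hd hc h
    rw [← (h0 _ (min_le_left s₀ s)).2]
    exact phase_monotone hc (min_le_right _ _)
  · obtain ⟨s₀, h0⟩ := phase_start_high hd hc h
    have : 0 ≤ d.phase c s := by
      rw [← (h0 _ (min_le_left s₀ s)).2]
      exact phase_monotone hc (min_le_right _ _)
    linarith

lemma exists_phase_eq (hd : d.HasFactor) {c : ℝ} (hc : 0 < c) {s₁ s₂ t : ℝ}
    (h₁ : d.phase c s₁ ≤ t) (h₂ : t ≤ d.phase c s₂) : ∃ s, d.phase c s = t := by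
  have := mem_range_of_exists_le_of_exists_ge (continuous_phase hd hc) ⟨s₁, h₁⟩ ⟨s₂, h₂⟩
  exact this

/-- The number of the quadrant containing the value of the quotient at the reflected zero. -/
noncomputable def genericIndex (d : QuotientData) (α z : ℂ) : ℕ :=
  ⌊d.phase ‖α‖ (Real.log ‖z‖) / (Real.pi / 2) + 1⌋₊

lemma curve_interior_of_ne {c : ℝ} (hc : 0 < c) {s : ℝ} (h1 : Real.cos (d.phase c s) ≠ 0)
    (h2 : Real.sin (d.phase c s) ≠ 0) : d.curve c s ∈ Set.Ioo 0 (Real.pi / 2) := by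
  have hm := d.curve_mem c s
  refine ⟨lt_of_le_of_ne hm.1 fun h => h2 (sin_phase_of_curve_eq_zero h.symm),
    lt_of_le_of_ne hm.2 fun h => h1 (cos_phase_of_curve_eq_pi_div_two hc h)⟩

lemma zero_coordinates (hd : d.HasFactor) {α z : ℂ} (hα : α ≠ 0) (hz : d.H α z = 0) :
    ∃ e₁ e₂ : ℝ, (e₁ = 1 ∨ e₁ = -1) ∧ (e₂ = 1 ∨ e₂ = -1) ∧
      z.re = e₁ * (Real.exp (Real.log ‖z‖) * Real.cos (d.curve ‖α‖ (Real.log ‖z‖))) ∧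
      z.im = e₂ * (Real.exp (Real.log ‖z‖) * Real.sin (d.curve ‖α‖ (Real.log ‖z‖))) ∧
      α.re = e₁ * (‖α‖ * Real.cos (d.phase ‖α‖ (Real.log ‖z‖))) ∧
      α.im = e₂ * (‖α‖ * Real.sin (d.phase ‖α‖ (Real.log ‖z‖))) := by
  obtain ⟨-, e₁, e₂, h₁, h₂, e, ea⟩ := curve_of_zero hd hα hz
  have er := congrArg re e
  have ei := congrArg im e
  have ar := congrArg re ea
  have ai := congrArg im ea
  simp only [reflect, polarPt_re, polarPt_im, re_ofReal_mul, im_ofReal_mul, exp_ofReal_mul_I_re,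
    exp_ofReal_mul_I_im] at er ei ar ai
  exact ⟨e₁, e₂, h₁, h₂, er, ei, ar, ai⟩

/-- `z` and `α` arise by the same reflection from a point of the open first quadrant and from `|α|
e^{i phase}`, so the unknown signs cancel in the products. Since `α` is off the axes, so is the
point of the curve. -/
lemma generic_signs (hd : d.HasFactor) {α z : ℂ} (hr : α.re ≠ 0) (hi : α.im ≠ 0)
    (hz : d.H α z = 0) :
    d.curve ‖α‖ (Real.log ‖z‖) ∈ Set.Ioo 0 (Real.pi / 2) ∧
    0 < z.re * (α.re * Real.cos (d.phase ‖α‖ (Real.log ‖z‖))) ∧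
    0 < z.im * (α.im * Real.sin (d.phase ‖α‖ (Real.log ‖z‖))) := by
  have hα : α ≠ 0 := by rintro rfl; exact hr rfl
  obtain ⟨e₁, e₂, h₁, h₂, zr, zi, ar, ai⟩ := zero_coordinates hd hα hz
  have hc := norm_pos_iff.2 hα
  have hcos : Real.cos (d.phase ‖α‖ (Real.log ‖z‖)) ≠ 0 := by
    intro h; rw [h, mul_zero, mul_zero] at ar; exact hr ar
  have hsin : Real.sin (d.phase ‖α‖ (Real.log ‖z‖)) ≠ 0 := by
    intro h; rw [h, mul_zero, mul_zero] at ai; exact hi ai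
  have hθ := curve_interior_of_ne hc hcos hsin
  have c1 : 0 < Real.cos (d.curve ‖α‖ (Real.log ‖z‖)) :=
    Real.cos_pos_of_mem_Ioo ⟨by linarith [hθ.1, Real.pi_pos], hθ.2⟩
  have c2 : 0 < Real.sin (d.curve ‖α‖ (Real.log ‖z‖)) :=
    Real.sin_pos_of_mem_Ioo ⟨hθ.1, by linarith [hθ.2, Real.pi_pos]⟩
  have q1 : e₁ * e₁ = 1 := by rcases h₁ with h | h <;> rw [h] <;> norm_num
  have q2 : e₂ * e₂ = 1 := by rcases h₂ with h | h <;> rw [h] <;> norm_num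
  have x := Real.exp_pos (Real.log ‖z‖)
  refine ⟨hθ, ?_, ?_⟩
  · have : z.re * (α.re * Real.cos (d.phase ‖α‖ (Real.log ‖z‖)))
        = (e₁ * e₁) * (Real.exp (Real.log ‖z‖) * Real.cos (d.curve ‖α‖ (Real.log ‖z‖))
          * (‖α‖ * (Real.cos (d.phase ‖α‖ (Real.log ‖z‖))) ^ 2)) := by
      rw [zr, ar]; ring
    rw [this, q1]; positivity
  · have : z.im * (α.im * Real.sin (d.phase ‖α‖ (Real.log ‖z‖)))
        = (e₂ * e₂) * (Real.exp (Real.log ‖z‖) * Real.sin (d.curve ‖α‖ (Real.log ‖z‖))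
          * (‖α‖ * (Real.sin (d.phase ‖α‖ (Real.log ‖z‖))) ^ 2)) := by
      rw [zi, ai]; ring
    rw [this, q2]; positivity

lemma cos_sin_ne_zero_of_generic (hd : d.HasFactor) {α z : ℂ} (hr : α.re ≠ 0) (hi : α.im ≠ 0)
    (hz : d.H α z = 0) : Real.cos (d.phase ‖α‖ (Real.log ‖z‖)) ≠ 0 ∧
      Real.sin (d.phase ‖α‖ (Real.log ‖z‖)) ≠ 0 := by
  obtain ⟨-, h1, h2⟩ := generic_signs hd hr hi hz
  exact ⟨right_ne_zero_of_mul (right_ne_zero_of_mul h1.ne'),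
    right_ne_zero_of_mul (right_ne_zero_of_mul h2.ne')⟩

lemma cos_mul_sin_int_mul_pi_div_two (k : ℤ) :
    Real.cos (k * (Real.pi / 2)) * Real.sin (k * (Real.pi / 2)) = 0 := by
  have : Real.sin (2 * (k * (Real.pi / 2))) = 0 := by
    rw [show 2 * ((k : ℝ) * (Real.pi / 2)) = k * Real.pi by ring, Real.sin_int_mul_pi]
  rw [Real.sin_two_mul] at this
  linarith

/-- As the phase is at least `-π/2`, the summand `1` in the index makes the argument of the floor
nonnegative and no truncation occurs. The left end is excluded because `α` is off the axes. -/
lemma phase_mem_of_generic (hd : d.HasFactor) {α z : ℂ} (hr : α.re ≠ 0) (hi : α.im ≠ 0)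
    (hz : d.H α z = 0) : d.phase ‖α‖ (Real.log ‖z‖) ∈
      Set.Ioo (((d.genericIndex α z : ℝ) - 1) * (Real.pi / 2))
        ((d.genericIndex α z : ℝ) * (Real.pi / 2)) := by
  have hα : α ≠ 0 := by rintro rfl; exact hr rfl
  have hp : 0 < Real.pi / 2 := by positivity
  have hge := phase_ge hd (norm_pos_iff.2 hα) (Real.log ‖z‖)
  obtain ⟨hc, hs⟩ := cos_sin_ne_zero_of_generic hd hr hi hz
  have h0 : 0 ≤ d.phase ‖α‖ (Real.log ‖z‖) / (Real.pi / 2) + 1 := by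
    have : -1 ≤ d.phase ‖α‖ (Real.log ‖z‖) / (Real.pi / 2) := by
      rw [le_div_iff₀ hp]; linarith
    linarith
  have h1 := Nat.floor_le h0
  have h2 := Nat.lt_floor_add_one (d.phase ‖α‖ (Real.log ‖z‖) / (Real.pi / 2) + 1)
  change ((d.genericIndex α z : ℕ) : ℝ) ≤ _ at h1
  change _ < ((d.genericIndex α z : ℕ) : ℝ) + 1 at h2
  have h3 : ((d.genericIndex α z : ℝ) - 1) * (Real.pi / 2) ≤ d.phase ‖α‖ (Real.log ‖z‖) := by
    rw [← le_div_iff₀ hp]; linarith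
  refine ⟨lt_of_le_of_ne h3 fun h => ?_, ?_⟩
  · have := cos_mul_sin_int_mul_pi_div_two ((d.genericIndex α z : ℤ) - 1)
    push_cast at this
    rw [h] at this
    exact (mul_ne_zero hc hs) this
  · rw [← div_lt_iff₀ hp]; linarith

lemma genericIndex_mono {α z z' : ℂ} (hα : α ≠ 0) (hz : z ≠ 0) (h : ‖z‖ ≤ ‖z'‖) :
    d.genericIndex α z ≤ d.genericIndex α z' := by
  have h1 := Real.log_le_log (norm_pos_iff.2 hz) h
  have h2 := phase_monotone (d := d) (norm_pos_iff.2 hα) h1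
  have hp : 0 < Real.pi / 2 := by positivity
  exact Nat.floor_mono (by gcongr)

lemma eq_of_cos_sq_eq {k : ℤ} {s t : ℝ} (hs : s ∈ Set.Ioo ((k - 1) * (Real.pi / 2)) (k * (Real.pi / 2)))
    (ht : t ∈ Set.Ioo ((k - 1) * (Real.pi / 2)) (k * (Real.pi / 2)))
    (h : Real.cos s ^ 2 = Real.cos t ^ 2) : s = t := by
  have hpi := Real.pi_pos
  have h2 : Real.cos (2 * s) = Real.cos (2 * t) := by rw [Real.cos_two_mul, Real.cos_two_mul, h]
  obtain ⟨j, hj | hj⟩ := Real.cos_eq_cos_iff.1 h2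
  · have h3 : t - s = j * Real.pi := by linarith
    have h4 : (j : ℝ) < 1 := by
      by_contra! hh
      nlinarith [hs.1, ht.2]
    have h5 : (-1 : ℝ) < j := by
      by_contra! hh
      nlinarith [hs.2, ht.1]
    have h4' : j < 1 := by exact_mod_cast h4
    have h5' : -1 < j := by exact_mod_cast h5
    have : j = 0 := by omega
    rw [this] at h3
    push_cast at h3
    linarith
  · have h3 : t + s = j * Real.pi := by linarith
    have h4 : (j : ℝ) < k := by
      by_contra! hh
      nlinarith [hs.2, ht.2]
    have h5 : (k - 1 : ℝ) < j := by
      by_contra! hh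
      nlinarith [hs.1, ht.1]
    have h4' : j < k := by exact_mod_cast h4
    have h5' : k - 1 < j := by exact_mod_cast h5
    omega

lemma norm_mul_cos_sq (hd : d.HasFactor) {α z : ℂ} (hα : α ≠ 0) (hz : d.H α z = 0) :
    Real.cos (d.phase ‖α‖ (Real.log ‖z‖)) ^ 2 = (α.re / ‖α‖) ^ 2 := by
  obtain ⟨e₁, -, h₁, -, -, -, ar, -⟩ := zero_coordinates hd hα hz
  have hc := (norm_pos_iff.2 hα).ne'
  have q1 : e₁ ^ 2 = 1 := by rcases h₁ with h | h <;> rw [h] <;> norm_num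
  rw [ar, mul_div_assoc, mul_div_cancel_left₀ _ hc, mul_pow, q1, one_mul]

/-- The value of `cos²` is prescribed by `α` and injective on a quarter-turn, so the phases agree.
The curve is interior, hence the phase is strictly increasing there and the radii agree. The
reflections are then determined by the signs of the two parts of `α`. -/
lemma eq_of_genericIndex_eq (hd : d.HasFactor) {α z z' : ℂ} (hr : α.re ≠ 0) (hi : α.im ≠ 0)
    (hz : d.H α z = 0) (hz' : d.H α z' = 0) (h : d.genericIndex α z = d.genericIndex α z') :
    z = z' := by
  have hα : α ≠ 0 := by rintro rfl; exact hr rfl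
  have m1 := phase_mem_of_generic hd hr hi hz
  have m2 := phase_mem_of_generic hd hr hi hz'
  rw [h] at m1
  have hph : d.phase ‖α‖ (Real.log ‖z‖) = d.phase ‖α‖ (Real.log ‖z'‖) :=
    eq_of_cos_sq_eq (k := d.genericIndex α z') (by exact_mod_cast m1) (by exact_mod_cast m2)
      (by rw [norm_mul_cos_sq hd hα hz, norm_mul_cos_sq hd hα hz'])
  have hs : Real.log ‖z‖ = Real.log ‖z'‖ := by
    by_contra hne
    exact (curve_eq_of_phase_eq hd (norm_pos_iff.2 hα) hne hph).2 (generic_signs hd hr hi hz).1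
  obtain ⟨e₁, e₂, h₁, h₂, zr, zi, ar, ai⟩ := zero_coordinates hd hα hz
  obtain ⟨e₁', e₂', h₁', h₂', zr', zi', ar', ai'⟩ := zero_coordinates hd hα hz'
  rw [hs] at zr zi ar ai
  have n1 : ‖α‖ * Real.cos (d.phase ‖α‖ (Real.log ‖z'‖)) ≠ 0 := by
    intro h0; rw [h0, mul_zero] at ar; exact hr ar
  have n2 : ‖α‖ * Real.sin (d.phase ‖α‖ (Real.log ‖z'‖)) ≠ 0 := by
    intro h0; rw [h0, mul_zero] at ai; exact hi ai
  have q1 : e₁ = e₁' := mul_right_cancel₀ n1 (ar.symm.trans ar')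
  have q2 : e₂ = e₂' := mul_right_cancel₀ n2 (ai.symm.trans ai')
  exact Complex.ext (by rw [zr, zr', q1]) (by rw [zi, zi', q2])

lemma exists_mem_Ioo_cos_sq (k : ℕ) {r : ℝ} (h0 : r ≠ 0) (h1 : r ^ 2 < 1) :
    ∃ t ∈ Set.Ioo (((k : ℝ) - 1) * (Real.pi / 2)) (k * (Real.pi / 2)), Real.cos t ^ 2 = r ^ 2 := by
  have hpi := Real.pi_pos
  have habs : |r| < 1 := by rwa [← sq_lt_one_iff_abs_lt_one]
  have hb0 : 0 < Real.arccos |r| := Real.arccos_pos.2 habs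
  have hb1 : Real.arccos |r| < Real.pi / 2 := Real.arccos_lt_pi_div_two.2 (abs_pos.2 h0)
  have hcos : Real.cos (Real.arccos |r|) ^ 2 = r ^ 2 := by
    rw [Real.cos_arccos (by linarith [abs_nonneg r]) habs.le, sq_abs]
  obtain ⟨j, hj | hj⟩ := Nat.even_or_odd' k
  · refine ⟨j * Real.pi - Real.arccos |r|, ?_, ?_⟩
    · rw [hj]; push_cast
      exact ⟨by linarith, by linarith⟩
    · rw [Real.cos_nat_mul_pi_sub, mul_pow, ← pow_mul, mul_comm j 2, pow_mul, neg_one_sq, one_pow,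
        one_mul, hcos]
  · refine ⟨Real.arccos |r| + j * Real.pi, ?_, ?_⟩
    · rw [hj]; push_cast
      exact ⟨by linarith, by linarith⟩
    · rw [Real.cos_add_nat_mul_pi, mul_pow, ← pow_mul, mul_comm j 2, pow_mul, neg_one_sq, one_pow,
        one_mul, hcos]

lemma exists_sign_of_sq_eq {x y : ℝ} (h : x ^ 2 = y ^ 2) :
    ∃ e : ℝ, (e = 1 ∨ e = -1) ∧ x = e * y := by
  rcases sq_eq_sq_iff_eq_or_eq_neg.1 h with h | h
  · exact ⟨1, Or.inl rfl, by rw [h, one_mul]⟩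
  · exact ⟨-1, Or.inr rfl, by rw [h]; ring⟩

/-- The phase rises continuously from `-π/2`, the left end of the quarter of index `0`, so it meets
the admissible value in every quarter before that of `z`. -/
lemma exists_zero_of_generic (hd : d.HasFactor) (hm : d.m = 0) {α z : ℂ} (hr : α.re ≠ 0)
    (hi : α.im ≠ 0) (hz : d.H α z = 0) {k : ℕ} (hk : k < d.genericIndex α z) :
    ∃ w, d.H α w = 0 ∧ d.genericIndex α w = k := by
  have hα : α ≠ 0 := by rintro rfl; exact hr rfl
  have hc := norm_pos_iff.2 hα
  have hpi := Real.pi_pos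
  have hsq : α.re ^ 2 + α.im ^ 2 = ‖α‖ ^ 2 := by
    rw [← normSq_eq_norm_sq, normSq_apply]; ring
  have hlt : (α.re / ‖α‖) ^ 2 < 1 := by
    rw [div_pow, div_lt_one (by positivity)]
    have : 0 < α.im ^ 2 := by positivity
    linarith
  obtain ⟨t, ht, hcos⟩ := exists_mem_Ioo_cos_sq k (div_ne_zero hr hc.ne') hlt
  obtain ⟨s₀, h0⟩ := phase_start_low hd hc hm
  have m1 := phase_mem_of_generic hd hr hi hz
  have hk' : (k : ℝ) ≤ d.genericIndex α z - 1 := by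
    have : (k : ℝ) + 1 ≤ d.genericIndex α z := by exact_mod_cast hk
    linarith
  have ht2 : t ≤ d.phase ‖α‖ (Real.log ‖z‖) := by
    have : (k : ℝ) * (Real.pi / 2) ≤ (d.genericIndex α z - 1) * (Real.pi / 2) := by gcongr
    linarith [ht.2, m1.1]
  have ht1 : d.phase ‖α‖ s₀ ≤ t := by
    rw [(h0 s₀ le_rfl).2]
    have : 0 ≤ (k : ℝ) * (Real.pi / 2) := by positivity
    linarith [ht.1]
  obtain ⟨s, hs⟩ := exists_phase_eq hd hc ht1 ht2
  have e1 : α.re ^ 2 = (‖α‖ * Real.cos t) ^ 2 := by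
    rw [mul_pow, hcos, div_pow]; field_simp
  have e2 : α.im ^ 2 = (‖α‖ * Real.sin t) ^ 2 := by
    rw [mul_pow, Real.sin_sq]; rw [mul_pow] at e1; linarith
  obtain ⟨a₁, h₁, b₁⟩ := exists_sign_of_sq_eq e1
  obtain ⟨a₂, h₂, b₂⟩ := exists_sign_of_sq_eq e2
  have hct : Real.cos (d.phase ‖α‖ s) ≠ 0 := by
    rw [hs]; intro h; rw [h, mul_zero, mul_zero] at b₁; exact hr b₁
  have hst : Real.sin (d.phase ‖α‖ s) ≠ 0 := by
    rw [hs]; intro h; rw [h, mul_zero, mul_zero] at b₂; exact hi b₂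
  have hgap := gap_curve_eq_zero (curve_interior_of_ne hc hct hst)
  have hw := zero_of_curve (d := d) hα h₁ h₂ hgap (by
    rw [hs]
    apply Complex.ext
    · simp only [reflect, re_ofReal_mul, exp_ofReal_mul_I_re]; exact b₁
    · simp only [reflect, im_ofReal_mul, exp_ofReal_mul_I_im]; exact b₂)
  refine ⟨_, hw, ?_⟩
  have m2 := phase_mem_of_generic hd hr hi hw
  rw [log_norm_reflect_polarPt h₁ h₂, hs] at m2
  set g := d.genericIndex α (reflect a₁ a₂ (polarPt s (d.curve ‖α‖ s)))
  have u1 : (g : ℝ) - 1 < k := by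
    by_contra! hh
    have : (k : ℝ) * (Real.pi / 2) ≤ (g - 1) * (Real.pi / 2) := by gcongr
    linarith [ht.2, m2.1]
  have u2 : (k : ℝ) - 1 < g := by
    by_contra! hh
    have : (g : ℝ) * (Real.pi / 2) ≤ (k - 1) * (Real.pi / 2) := by gcongr
    linarith [ht.1, m2.2]
  have u1' : (g : ℝ) < (k + 1 : ℕ) := by push_cast; linarith
  have u2' : (k : ℝ) < (g + 1 : ℕ) := by push_cast; linarith
  have u1'' : g < k + 1 := by exact_mod_cast u1'
  have u2'' : k < g + 1 := by exact_mod_cast u2'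
  omega

end QuotientData

/-! ### Real `α`: the levels `kπ` of the phase -/

namespace QuotientData

variable {d : QuotientData}

/-- The number of half-turns made by the value of the quotient up to the modulus of `z`. -/
noncomputable def realIndex (d : QuotientData) (a : ℝ) (z : ℂ) : ℕ :=
  ⌊d.phase |a| (Real.log ‖z‖) / Real.pi⌋₊

lemma realIndex_mono {a : ℝ} {z z' : ℂ} (ha : a ≠ 0) (hz : z ≠ 0) (h : ‖z‖ ≤ ‖z'‖) :
    d.realIndex a z ≤ d.realIndex a z' := by
  have h1 := Real.log_le_log (norm_pos_iff.2 hz) h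
  have h2 := phase_monotone (d := d) (abs_pos.2 ha) h1
  have hp := Real.pi_pos
  exact Nat.floor_mono (by gcongr)

/-- A real `α` forces the sine of the phase to vanish, so the phase is a multiple of `π`,
nonnegative by `phase_ge`. The cosine is then nonzero and keeps the curve off the imaginary axis. -/
lemma real_zero_facts (hd : d.HasFactor) {a : ℝ} (ha : a ≠ 0) {z : ℂ} (hz : d.H a z = 0) :
    d.phase |a| (Real.log ‖z‖) = d.realIndex a z * Real.pi ∧
    0 < z.re * (a * Real.cos (d.realIndex a z * Real.pi)) ∧
    (z.im = 0 ↔ d.curve |a| (Real.log ‖z‖) = 0) ∧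
    (z.im ≠ 0 → d.curve |a| (Real.log ‖z‖) ∈ Set.Ioo 0 (Real.pi / 2)) := by
  have hα : (a : ℂ) ≠ 0 := ofReal_ne_zero.2 ha
  have hpi := Real.pi_pos
  obtain ⟨e₁, e₂, h₁, h₂, zr, zi, ar, ai⟩ := zero_coordinates hd hα hz
  simp only [norm_real, Real.norm_eq_abs, ofReal_re, ofReal_im] at zr zi ar ai
  have hc := abs_pos.2 ha
  have n2 : e₂ ≠ 0 := by rcases h₂ with h | h <;> rw [h] <;> norm_num
  have hsin : Real.sin (d.phase |a| (Real.log ‖z‖)) = 0 := by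
    have := (mul_eq_zero.1 ai.symm).resolve_left n2
    exact (mul_eq_zero.1 this).resolve_left hc.ne'
  obtain ⟨j, hj⟩ := Real.sin_eq_zero_iff.1 hsin
  have hge := phase_ge hd hc (Real.log ‖z‖)
  rw [← hj] at hge
  have hj0 : 0 ≤ j := by
    have : (-1 : ℝ) < j := by
      by_contra! hh
      nlinarith
    have : (-1 : ℤ) < j := by exact_mod_cast this
    omega
  obtain ⟨n, rfl⟩ := Int.eq_ofNat_of_zero_le hj0
  have hidx : d.realIndex a z = n := by
    rw [realIndex, ← hj, mul_div_cancel_right₀ _ hpi.ne']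
    simp
  have hph : d.phase |a| (Real.log ‖z‖) = n * Real.pi := by rw [← hj]; simp
  have hcos : Real.cos (d.phase |a| (Real.log ‖z‖)) ≠ 0 := by
    intro h; rw [h, mul_zero, mul_zero] at ar; exact ha ar
  have hm := d.curve_mem |a| (Real.log ‖z‖)
  have hlt : d.curve |a| (Real.log ‖z‖) < Real.pi / 2 :=
    lt_of_le_of_ne hm.2 fun h => hcos (cos_phase_of_curve_eq_pi_div_two hc h)
  have c1 : 0 < Real.cos (d.curve |a| (Real.log ‖z‖)) :=
    Real.cos_pos_of_mem_Ioo ⟨by linarith [hm.1], hlt⟩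
  have q1 : e₁ * e₁ = 1 := by rcases h₁ with h | h <;> rw [h] <;> norm_num
  have x := Real.exp_pos (Real.log ‖z‖)
  have hiff : z.im = 0 ↔ d.curve |a| (Real.log ‖z‖) = 0 := by
    constructor
    · intro h
      rw [zi] at h
      have h3 := (mul_eq_zero.1 ((mul_eq_zero.1 h).resolve_left n2)).resolve_left x.ne'
      by_contra h4
      exact (Real.sin_pos_of_mem_Ioo ⟨lt_of_le_of_ne hm.1 (Ne.symm h4), by linarith⟩).ne' h3
    · intro h
      rw [zi, h, Real.sin_zero, mul_zero, mul_zero]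
  refine ⟨by rw [hidx, hph], ?_, hiff, fun h => ⟨lt_of_le_of_ne hm.1 fun h' => h (hiff.2 h'.symm), hlt⟩⟩
  rw [hidx, ← hph]
  have : z.re * (a * Real.cos (d.phase |a| (Real.log ‖z‖)))
      = (e₁ * e₁) * (Real.exp (Real.log ‖z‖) * Real.cos (d.curve |a| (Real.log ‖z‖))
        * (|a| * (Real.cos (d.phase |a| (Real.log ‖z‖))) ^ 2)) := by
    nth_rewrite 1 [ar]
    rw [zr]; ring
  rw [this, q1]; positivity

variable {c : ℝ}

/-- On the real axis the continuous phase takes values in the discrete set `πℤ`. -/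
lemma eventually_phase_eq (hd : d.HasFactor) (hc : 0 < c) {s₀ : ℝ} (h0 : d.curve c s₀ = 0) :
    ∀ᶠ s in nhds s₀, d.curve c s = 0 → d.phase c s = d.phase c s₀ := by
  obtain ⟨k, hk⟩ := phase_of_curve_eq_zero h0
  have hpi := Real.pi_pos
  have ht := (continuous_phase hd hc).tendsto s₀
  filter_upwards [ht.eventually_lt_const (by linarith : d.phase c s₀ < d.phase c s₀ + Real.pi),
    ht.eventually_const_lt (by linarith : d.phase c s₀ - Real.pi < d.phase c s₀)] with s h1 h2 h3
  obtain ⟨j, hj⟩ := phase_of_curve_eq_zero h3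
  rw [hk, hj] at h1 h2
  have u1 : (j : ℝ) < k + 1 := by
    by_contra! hh
    nlinarith
  have u2 : (k : ℝ) - 1 < j := by
    by_contra! hh
    nlinarith
  have u1' : j < k + 1 := by exact_mod_cast u1
  have u2' : k - 1 < j := by exact_mod_cast u2
  have : j = k := by omega
  rw [hk, hj, this]

/-- A positive gap at angle `0` just after `s₀` means that the curve has left the axis. The phase
has then increased strictly, and `s₀` is the right end of its level. -/
lemma le_of_gap_pos_right (hd : d.HasFactor) (hc : 0 < c) {s₀ : ℝ} (h0 : d.curve c s₀ = 0)
    (hg : ∀ᶠ s in nhdsWithin s₀ (Set.Ioi s₀), 0 < d.gap c s 0) {s : ℝ}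
    (hs : d.phase c s = d.phase c s₀) : s ≤ s₀ := by
  by_contra! hlt
  obtain ⟨u, hu, hu1, hu2⟩ := (hg.and (Ioo_mem_nhdsGT hlt)).exists
  have h1 := phase_monotone (d := d) hc hu1.le
  have h2 := phase_monotone (d := d) hc hu2.le
  have h3 := (curve_eq_of_phase_eq hd hc hu1.ne (le_antisymm h1 (h2.trans hs.le))).1
  rw [h0] at h3
  linarith [(curve_eq_zero_iff hd hc).1 h3.symm]

lemma ge_of_gap_pos_left (hd : d.HasFactor) (hc : 0 < c) {s₀ : ℝ} (h0 : d.curve c s₀ = 0)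
    (hg : ∀ᶠ s in nhdsWithin s₀ (Set.Iio s₀), 0 < d.gap c s 0) {s : ℝ}
    (hs : d.phase c s = d.phase c s₀) : s₀ ≤ s := by
  by_contra! hlt
  obtain ⟨u, hu, hu1, hu2⟩ := (hg.and (Ioo_mem_nhdsLT hlt)).exists
  have h1 := phase_monotone (d := d) hc hu1.le
  have h2 := phase_monotone (d := d) hc hu2.le
  have h3 := (curve_eq_of_phase_eq hd hc hu2.ne (le_antisymm h2 (hs.ge.trans h1))).1
  rw [h0] at h3
  linarith [(curve_eq_zero_iff hd hc).1 h3]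

/-- A negative gap keeps the curve on the real axis, so the level continues to the right of `s₀`. -/
lemma exists_gt_of_gap_neg_right (hd : d.HasFactor) (hc : 0 < c) {s₀ : ℝ} (h0 : d.curve c s₀ = 0)
    (hg : ∀ᶠ s in nhdsWithin s₀ (Set.Ioi s₀), d.gap c s 0 < 0) :
    ∃ s, s₀ < s ∧ d.phase c s = d.phase c s₀ := by
  have h1 := hg.and (((eventually_phase_eq hd hc h0).filter_mono nhdsWithin_le_nhds).and
    eventually_mem_nhdsWithin)
  obtain ⟨s, hs, hs1, hs2⟩ := h1.exists
  exact ⟨s, hs2, hs1 ((curve_eq_zero_iff hd hc).2 hs.le)⟩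

lemma exists_lt_of_gap_neg_left (hd : d.HasFactor) (hc : 0 < c) {s₀ : ℝ} (h0 : d.curve c s₀ = 0)
    (hg : ∀ᶠ s in nhdsWithin s₀ (Set.Iio s₀), d.gap c s 0 < 0) :
    ∃ s, s < s₀ ∧ d.phase c s = d.phase c s₀ := by
  have h1 := hg.and (((eventually_phase_eq hd hc h0).filter_mono nhdsWithin_le_nhds).and
    eventually_mem_nhdsWithin)
  obtain ⟨s, hs, hs1, hs2⟩ := h1.exists
  exact ⟨s, hs2, hs1 ((curve_eq_zero_iff hd hc).2 hs.le)⟩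

lemma curve_lt_of_phase_eq (hc : 0 < c) {s : ℝ} {k : ℕ} (h : d.phase c s = k * Real.pi) :
    d.curve c s < Real.pi / 2 := by
  refine lt_of_le_of_ne (d.curve_mem c s).2 fun h' => ?_
  have := cos_phase_of_curve_eq_pi_div_two hc h'
  rw [h] at this
  have h2 : Real.sin (k * Real.pi) = 0 := Real.sin_nat_mul_pi k
  have h3 := Real.sin_sq_add_cos_sq (k * Real.pi)
  rw [this, h2] at h3
  norm_num at h3

/-- At the right end of a level the modulus must equal `c`: if it were smaller on the axis, the
curve would stay on the axis a little longer with unchanged phase. Hence the end of a level produces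
a zero. -/
lemma gap_eq_zero_of_level_max (hd : d.HasFactor) (hc : 0 < c) {s₀ : ℝ} {k : ℕ}
    (h : d.phase c s₀ = k * Real.pi) (hmax : ∀ s, d.phase c s = k * Real.pi → s ≤ s₀) :
    d.gap c s₀ (d.curve c s₀) = 0 := by
  rcases eq_or_lt_of_le (d.curve_mem c s₀).1 with h0 | h0
  · rw [← h0]
    refine le_antisymm ((curve_eq_zero_iff hd hc).1 h0.symm) ?_
    by_contra! hneg
    have hev := ((continuous_gap_left (d := d) c 0).tendsto s₀).eventually_lt_const hneg
    obtain ⟨s, hs, hs'⟩ := exists_gt_of_gap_neg_right hd hc h0.symm (nhdsWithin_le_nhds hev)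
    linarith [hmax s (hs'.trans h)]
  · exact gap_curve_eq_zero ⟨h0, curve_lt_of_phase_eq hc h⟩

lemma gap_eq_zero_of_level_min (hd : d.HasFactor) (hc : 0 < c) {s₀ : ℝ} {k : ℕ}
    (h : d.phase c s₀ = k * Real.pi) (hmin : ∀ s, d.phase c s = k * Real.pi → s₀ ≤ s) :
    d.gap c s₀ (d.curve c s₀) = 0 := by
  rcases eq_or_lt_of_le (d.curve_mem c s₀).1 with h0 | h0
  · rw [← h0]
    refine le_antisymm ((curve_eq_zero_iff hd hc).1 h0.symm) ?_
    by_contra! hneg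
    have hev := ((continuous_gap_left (d := d) c 0).tendsto s₀).eventually_lt_const hneg
    obtain ⟨s, hs, hs'⟩ := exists_lt_of_gap_neg_left hd hc h0.symm (nhdsWithin_le_nhds hev)
    linarith [hmin s (hs'.trans h)]
  · exact gap_curve_eq_zero ⟨h0, curve_lt_of_phase_eq hc h⟩

lemma exists_level_max (hd : d.HasFactor) (hc : 0 < c) {t s₁ s₂ : ℝ} (h₁ : d.phase c s₁ = t)
    (h₂ : t < d.phase c s₂) : ∃ s, d.phase c s = t ∧ ∀ s', d.phase c s' = t → s' ≤ s := by
  have hle : ∀ s, d.phase c s = t → s ≤ s₂ := fun s hs => by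
    by_contra! hlt
    have := phase_monotone (d := d) hc hlt.le
    linarith
  have hcl : IsClosed {s | d.phase c s = t} :=
    isClosed_eq (continuous_phase hd hc) continuous_const
  have hcomp : IsCompact ({s | d.phase c s = t} ∩ Set.Icc s₁ s₂) := isCompact_Icc.inter_left hcl
  obtain ⟨s, hs, hmax⟩ := hcomp.exists_isGreatest ⟨s₁, h₁, le_rfl, hle s₁ h₁⟩
  refine ⟨s, hs.1, fun s' hs' => ?_⟩
  rcases le_total s' s₁ with h | h
  · exact h.trans hs.2.1
  · exact hmax ⟨hs', h, hle s' hs'⟩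

lemma exists_level_min (hd : d.HasFactor) (hc : 0 < c) {t s₁ s₂ : ℝ} (h₁ : d.phase c s₁ = t)
    (h₂ : d.phase c s₂ < t) : ∃ s, d.phase c s = t ∧ ∀ s', d.phase c s' = t → s ≤ s' := by
  have hle : ∀ s, d.phase c s = t → s₂ ≤ s := fun s hs => by
    by_contra! hlt
    have := phase_monotone (d := d) hc hlt.le
    linarith
  have hcl : IsClosed {s | d.phase c s = t} :=
    isClosed_eq (continuous_phase hd hc) continuous_const
  have hcomp : IsCompact ({s | d.phase c s = t} ∩ Set.Icc s₂ s₁) := isCompact_Icc.inter_left hcl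
  obtain ⟨s, hs, hmin⟩ := hcomp.exists_isLeast ⟨s₁, h₁, hle s₁ h₁, le_rfl⟩
  refine ⟨s, hs.1, fun s' hs' => ?_⟩
  rcases le_total s₁ s' with h | h
  · exact hs.2.2.trans h
  · exact hmin ⟨hs', hle s' hs', h⟩

/-- The reflection carrying the `k`-th level set to the zeros of index `k`. -/
lemma exists_level_sign {a : ℝ} (k : ℕ) :
    ∃ σ : ℝ, (σ = 1 ∨ σ = -1) ∧ a = σ * (|a| * Real.cos (k * Real.pi)) := by
  refine exists_sign_of_sq_eq ?_
  have h2 : Real.sin (k * Real.pi) = 0 := Real.sin_nat_mul_pi k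
  have h3 := Real.sin_sq_add_cos_sq (k * Real.pi)
  rw [h2] at h3
  rw [mul_pow, sq_abs]
  have : Real.cos (k * Real.pi) ^ 2 = 1 := by linarith
  rw [this, mul_one]

/-- On a level the sign of the real part is fixed by `a` and `cos (kπ)`, while the sign `e` of the
imaginary part is free. This freedom produces the conjugate pairs. -/
lemma level_zero_iff (hd : d.HasFactor) {a : ℝ} (ha : a ≠ 0) {k : ℕ} {σ : ℝ}
    (hσ : σ = 1 ∨ σ = -1) (hσa : a = σ * (|a| * Real.cos (k * Real.pi))) (w : ℂ) :
    d.H a w = 0 ∧ d.realIndex a w = k ↔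
      ∃ s e : ℝ, (e = 1 ∨ e = -1) ∧ d.phase |a| s = k * Real.pi ∧
        d.gap |a| s (d.curve |a| s) = 0 ∧ w = reflect σ e (polarPt s (d.curve |a| s)) := by
  have hα : (a : ℂ) ≠ 0 := ofReal_ne_zero.2 ha
  have hn : ‖(a : ℂ)‖ = |a| := by rw [norm_real, Real.norm_eq_abs]
  constructor
  · rintro ⟨hw, hk⟩
    obtain ⟨hph, -⟩ := real_zero_facts hd ha hw
    obtain ⟨hg, e₁, e₂, h₁, h₂, e, ea⟩ := curve_of_zero hd hα hw
    rw [hn] at hg e ea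
    rw [hk] at hph
    have ar := congrArg re ea
    simp only [reflect, re_ofReal_mul, exp_ofReal_mul_I_re, ofReal_re] at ar
    rw [hph] at ar
    have n1 : |a| * Real.cos (k * Real.pi) ≠ 0 := by
      intro h0; rw [h0, mul_zero] at ar; exact ha ar
    have : e₁ = σ := mul_right_cancel₀ n1 (ar.symm.trans hσa)
    rw [this] at e
    exact ⟨_, e₂, h₂, hph, hg, e⟩
  · rintro ⟨s, e, he, hph, hg, rfl⟩
    have hw : d.H a (reflect σ e (polarPt s (d.curve |a| s))) = 0 := by
      have := zero_of_curve (d := d) hα hσ he (s := s) (by rw [hn]; exact hg) (by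
        rw [hn, hph]
        apply Complex.ext
        · simp only [reflect, re_ofReal_mul, exp_ofReal_mul_I_re, ofReal_re]; exact hσa
        · simp only [reflect, im_ofReal_mul, exp_ofReal_mul_I_im, ofReal_im, Real.sin_nat_mul_pi,
            mul_zero])
      rwa [hn] at this
    refine ⟨hw, ?_⟩
    rw [realIndex, log_norm_reflect_polarPt hσ he, hph, mul_div_cancel_right₀ _ Real.pi_ne_zero,
      Nat.floor_natCast]

lemma reflect_polarPt_zero (σ e s : ℝ) : reflect σ e (polarPt s 0) = ((σ * Real.exp s : ℝ) : ℂ) := by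
  apply Complex.ext <;> simp [reflect, polarPt_re, polarPt_im, -ofReal_mul, -ofReal_exp]

/-- The real zeros of index `k`, by their multiplicity and their place in the level set. -/
lemma level_order (hd : d.HasFactor) {a : ℝ} (ha : a ≠ 0) {k : ℕ} {σ : ℝ}
    (hσ : σ = 1 ∨ σ = -1) {s : ℝ} (hph : d.phase |a| s = k * Real.pi)
    (h0 : d.curve |a| s = 0) (hw : d.H a ((σ * Real.exp s : ℝ) : ℂ) = 0) :
    (analyticOrderAt (d.H a) ((σ * Real.exp s : ℝ) : ℂ) = 2 ∧
      ∀ s', d.phase |a| s' = k * Real.pi → s' = s) ∨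
    (analyticOrderAt (d.H a) ((σ * Real.exp s : ℝ) : ℂ) = 1 ∧
      (∀ s', d.phase |a| s' = k * Real.pi → s' ≤ s) ∧ ∃ s' < s, d.phase |a| s' = k * Real.pi) ∨
    (analyticOrderAt (d.H a) ((σ * Real.exp s : ℝ) : ℂ) = 1 ∧
      (∀ s', d.phase |a| s' = k * Real.pi → s ≤ s') ∧ ∃ s' > s, d.phase |a| s' = k * Real.pi) := by
  have hα : (a : ℂ) ≠ 0 := ofReal_ne_zero.2 ha
  have hc := abs_pos.2 ha
  have hβ0 : σ * a ≠ 0 := mul_ne_zero (by rcases hσ with h | h <;> rw [h] <;> norm_num) ha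
  have habs : |σ * a| = |a| := by rcases hσ with h | h <;> rw [h] <;> simp
  have hβ : reflect σ 1 ((σ * a : ℝ) : ℂ) = a := by
    have q : σ * σ = 1 := by rcases hσ with h | h <;> rw [h] <;> norm_num
    apply Complex.ext
    · simp only [reflect, ofReal_re, ← mul_assoc, q, one_mul]
    · simp only [reflect, ofReal_im, mul_zero]
  have hz : d.H ((σ * a : ℝ) : ℂ) (polarPt s 0) = 0 := by
    rw [← H_reflect_eq_zero_iff d hσ (Or.inl rfl), hβ, reflect_polarPt_zero, hw]
  have ho := analyticOrderAt_H_reflect (d := d) hσ (Or.inl rfl) ((σ * a : ℝ) : ℂ) (polarPt s 0)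
  rw [hβ, reflect_polarPt_zero] at ho
  obtain ⟨q, hq⟩ := ENat.ne_top_iff_exists.1
    (analyticOrderAt_H_ne_top (d := d) hα ((σ * Real.exp s : ℝ) : ℂ))
  have := order_edge hβ0 hz (q := q) (by rw [← ho, hq])
  rw [habs] at this
  rw [← hq]
  simp only [← hph]
  rcases this with ⟨rfl, hr, hl⟩ | ⟨rfl, hr, hl⟩ | ⟨rfl, hr, hl⟩
  · exact Or.inl ⟨rfl, fun s' hs' => le_antisymm (le_of_gap_pos_right hd hc h0 hr hs')
      (ge_of_gap_pos_left hd hc h0 hl hs')⟩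
  · exact Or.inr (Or.inl ⟨rfl, fun s' hs' => le_of_gap_pos_right hd hc h0 hr hs',
      exists_lt_of_gap_neg_left hd hc h0 hl⟩)
  · exact Or.inr (Or.inr ⟨rfl, fun s' hs' => ge_of_gap_pos_left hd hc h0 hl hs',
      exists_gt_of_gap_neg_right hd hc h0 hr⟩)

/-- The number of zeros of index `k` if there are zeros of a larger index. -/
def levelSize (d : QuotientData) (k : ℕ) : ℕ := if d.m = 1 ∧ k = 0 then 1 else 2

lemma exists_level_lower (hd : d.HasFactor) (hc : 0 < c) {k : ℕ} (h : ¬ (d.m = 1 ∧ k = 0)) :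
    ∃ s, d.phase c s < k * Real.pi := by
  have hpi := Real.pi_pos
  rcases d.exponents with ⟨hm, -⟩ | ⟨hm, -⟩
  · obtain ⟨s₀, h0⟩ := phase_start_low hd hc hm
    refine ⟨s₀, ?_⟩
    rw [(h0 s₀ le_rfl).2]
    have : 0 ≤ (k : ℝ) * Real.pi := by positivity
    linarith
  · obtain ⟨s₀, h0⟩ := phase_start_high hd hc hm
    refine ⟨s₀, ?_⟩
    rw [(h0 s₀ le_rfl).2]
    have hk : 0 < k := by omega
    positivity

lemma exists_level_start (hd : d.HasFactor) (hc : 0 < c) {k : ℕ} (h : d.m = 1 ∧ k = 0) (s : ℝ) :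
    ∃ s' < s, d.phase c s' = k * Real.pi ∧ d.curve c s' = 0 := by
  obtain ⟨s₀, h0⟩ := phase_start_high hd hc h.1
  have := h0 (min s₀ s - 1) (by linarith [min_le_left s₀ s])
  exact ⟨min s₀ s - 1, by linarith [min_le_right s₀ s], by simp [this.2, h.2], this.1⟩

/-- A level is a point inside the quadrant, giving two conjugate simple zeros, or it lies on the
real axis. There a zero is double if the level is a single point, and otherwise simple and an end of
the level. Conversely both ends are zeros when they exist. A right end exists once the phase exceeds
`kπ`; a left end exists in a nonempty level except for `m = 1`, `k = 0`, where the level extends to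
`-∞`. -/
lemma level_sum (hd : d.HasFactor) {a : ℝ} (ha : a ≠ 0) (k : ℕ) :
    ∃ t : Finset ℂ, (∀ w, w ∈ t ↔ d.H a w = 0 ∧ d.realIndex a w = k) ∧
      ∑ w ∈ t, analyticOrderAt (d.H a) w ≤ (d.levelSize k : ℕ∞) ∧
      ((∃ w, d.H a w = 0 ∧ k < d.realIndex a w) →
        ∑ w ∈ t, analyticOrderAt (d.H a) w = (d.levelSize k : ℕ∞)) := by
  classical
  have hα : (a : ℂ) ≠ 0 := ofReal_ne_zero.2 ha
  have hn : ‖(a : ℂ)‖ = |a| := by rw [norm_real, Real.norm_eq_abs]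
  have hc := abs_pos.2 ha
  obtain ⟨σ, hσ, hσa⟩ := exists_level_sign (a := a) k
  have hiff := level_zero_iff hd ha hσ hσa
  have hσ0 : σ ≠ 0 := by rcases hσ with h | h <;> rw [h] <;> norm_num
  by_cases hA : ∃ s, d.phase |a| s = k * Real.pi ∧ d.gap |a| s (d.curve |a| s) = 0 ∧
      d.curve |a| s ≠ 0
  · obtain ⟨s, hph, hg, hne⟩ := hA
    have hint : d.curve |a| s ∈ Set.Ioo 0 (Real.pi / 2) :=
      ⟨lt_of_le_of_ne (d.curve_mem _ _).1 (Ne.symm hne), curve_lt_of_phase_eq hc hph⟩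
    have huniq : ∀ s', d.phase |a| s' = k * Real.pi → s' = s := fun s' hs' => by
      by_contra hne'
      exact (curve_eq_of_phase_eq hd hc (Ne.symm hne') (hph.trans hs'.symm)).2 hint
    -- A level that consists of one point cannot extend to `-∞`.
    have hsize : d.levelSize k = 2 := by
      refine if_neg fun h => ?_
      obtain ⟨s', hs', hp', -⟩ := exists_level_start hd hc h s
      exact hs'.ne (huniq s' hp')
    have hord : ∀ e : ℝ, (e = 1 ∨ e = -1) →
        analyticOrderAt (d.H a) (reflect σ e (polarPt s (d.curve |a| s))) = 1 := fun e he => by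
      have hw := ((hiff _).2 ⟨s, e, he, hph, hg, rfl⟩).1
      refine order_eq_one_of_interior hd hα hw ?_
      rw [hn, log_norm_reflect_polarPt hσ he]
      exact hint
    have hdist : reflect σ 1 (polarPt s (d.curve |a| s))
        ≠ reflect σ (-1) (polarPt s (d.curve |a| s)) := by
      intro h
      have := congrArg im h
      simp only [reflect, polarPt_im] at this
      have h1 : 0 < Real.sin (d.curve |a| s) :=
        Real.sin_pos_of_mem_Ioo ⟨hint.1, by linarith [hint.2, Real.pi_pos]⟩
      have := mul_pos (Real.exp_pos s) h1
      linarith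
    have hsum : ∑ w ∈ ({reflect σ 1 (polarPt s (d.curve |a| s)),
        reflect σ (-1) (polarPt s (d.curve |a| s))} : Finset ℂ), analyticOrderAt (d.H a) w
        = (d.levelSize k : ℕ∞) := by
      rw [Finset.sum_pair hdist, hord 1 (Or.inl rfl), hord (-1) (Or.inr rfl), hsize]
      norm_num
    refine ⟨{reflect σ 1 (polarPt s (d.curve |a| s)), reflect σ (-1) (polarPt s (d.curve |a| s))},
      fun w => ?_, hsum.le, fun _ => hsum⟩
    rw [hiff, Finset.mem_insert, Finset.mem_singleton]
    constructor
    · rintro (rfl | rfl)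
      · exact ⟨s, 1, Or.inl rfl, hph, hg, rfl⟩
      · exact ⟨s, -1, Or.inr rfl, hph, hg, rfl⟩
    · rintro ⟨s', e, he, hph', -, rfl⟩
      rw [huniq s' hph']
      rcases he with rfl | rfl
      · exact Or.inl rfl
      · exact Or.inr rfl
  push Not at hA
  -- All the zeros of index `k` are real.
  set X : Set ℝ := {s | d.phase |a| s = k * Real.pi ∧ d.gap |a| s (d.curve |a| s) = 0} with hX
  have hX0 : ∀ s ∈ X, d.curve |a| s = 0 := fun s hs => hA s hs.1 hs.2
  have hiff' : ∀ w, (d.H a w = 0 ∧ d.realIndex a w = k) ↔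
      ∃ s ∈ X, ((σ * Real.exp s : ℝ) : ℂ) = w := fun w => by
    rw [hiff]
    constructor
    · rintro ⟨s, e, he, hph, hg, rfl⟩
      exact ⟨s, ⟨hph, hg⟩, by rw [hX0 s ⟨hph, hg⟩, reflect_polarPt_zero]⟩
    · rintro ⟨s, hs, rfl⟩
      exact ⟨s, 1, Or.inl rfl, hs.1, hs.2, by rw [hX0 s hs, reflect_polarPt_zero]⟩
  have hlev := fun s (hs : s ∈ X) =>
    level_order hd ha hσ hs.1 (hX0 s hs) ((hiff' _).2 ⟨s, hs, rfl⟩).1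
  have hinj : Function.Injective fun s : ℝ => ((σ * Real.exp s : ℝ) : ℂ) := fun s s' h =>
    Real.exp_injective (mul_left_cancel₀ hσ0 (ofReal_injective h))
  have hmaxX : (∃ w, d.H a w = 0 ∧ k < d.realIndex a w) →
      ∃ s ∈ X, ∀ s', d.phase |a| s' = k * Real.pi → s' ≤ s := by
    rintro ⟨w, hw, hkw⟩
    have hpw := (real_zero_facts hd ha hw).1
    have hlt : (k : ℝ) * Real.pi < d.phase |a| (Real.log ‖w‖) := by
      rw [hpw]
      have : (k : ℝ) < d.realIndex a w := by exact_mod_cast hkw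
      exact mul_lt_mul_of_pos_right this Real.pi_pos
    obtain ⟨s₁, hs₁⟩ : ∃ s, d.phase |a| s = k * Real.pi := by
      by_cases h : d.m = 1 ∧ k = 0
      · obtain ⟨s', -, hp', -⟩ := exists_level_start hd hc h 0
        exact ⟨s', hp'⟩
      · obtain ⟨s', hs'⟩ := exists_level_lower hd hc h
        exact exists_phase_eq hd hc hs'.le hlt.le
    obtain ⟨s, hs, hmax⟩ := exists_level_max hd hc hs₁ hlt
    exact ⟨s, ⟨hs, gap_eq_zero_of_level_max hd hc hs hmax⟩, hmax⟩
  have hminX : ∀ s₁ ∈ X, ¬ (d.m = 1 ∧ k = 0) →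
      ∃ s ∈ X, ∀ s', d.phase |a| s' = k * Real.pi → s ≤ s' := by
    intro s₁ hs₁ h
    obtain ⟨s', hs'⟩ := exists_level_lower hd hc h
    obtain ⟨s, hs, hmin⟩ := exists_level_min hd hc hs₁.1 hs'
    exact ⟨s, ⟨hs, gap_eq_zero_of_level_min hd hc hs hmin⟩, hmin⟩
  by_cases hB : ∃ s ∈ X, analyticOrderAt (d.H a) ((σ * Real.exp s : ℝ) : ℂ) = 2
  · obtain ⟨s, hs, ho⟩ := hB
    have huniq : ∀ s', d.phase |a| s' = k * Real.pi → s' = s := by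
      rcases hlev s hs with h | h | h
      · exact h.2
      · rw [h.1] at ho; norm_num at ho
      · rw [h.1] at ho; norm_num at ho
    have hsize : d.levelSize k = 2 := by
      refine if_neg fun h => ?_
      obtain ⟨s', hs', hp', -⟩ := exists_level_start hd hc h s
      exact hs'.ne (huniq s' hp')
    have hsum : ∑ w ∈ ({((σ * Real.exp s : ℝ) : ℂ)} : Finset ℂ), analyticOrderAt (d.H a) w
        = (d.levelSize k : ℕ∞) := by
      rw [Finset.sum_singleton, ho, hsize]; rfl
    refine ⟨{((σ * Real.exp s : ℝ) : ℂ)}, fun w => ?_, hsum.le, fun _ => hsum⟩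
    rw [hiff', Finset.mem_singleton]
    constructor
    · rintro rfl; exact ⟨s, hs, rfl⟩
    · rintro ⟨s', hs', rfl⟩; rw [huniq s' hs'.1]
  push Not at hB
  have hone : ∀ s ∈ X, analyticOrderAt (d.H a) ((σ * Real.exp s : ℝ) : ℂ) = 1 ∧
      (((∀ s', d.phase |a| s' = k * Real.pi → s' ≤ s) ∧ ∃ s' < s, d.phase |a| s' = k * Real.pi) ∨
      ((∀ s', d.phase |a| s' = k * Real.pi → s ≤ s') ∧ ∃ s' > s, d.phase |a| s' = k * Real.pi)) :=
    fun s hs => by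
      rcases hlev s hs with h | h | h
      · exact absurd h.1 (hB s hs)
      · exact ⟨h.1, Or.inl h.2⟩
      · exact ⟨h.1, Or.inr h.2⟩
  have hsumX : ∀ T : Finset ℝ, (∀ s ∈ T, s ∈ X) →
      ∑ w ∈ T.image (fun s : ℝ => ((σ * Real.exp s : ℝ) : ℂ)), analyticOrderAt (d.H a) w
        = (T.card : ℕ∞) := fun T hT => by
    rw [Finset.sum_image hinj.injOn, Finset.sum_congr rfl fun s hs => (hone s (hT s hs)).1]
    simp
  suffices ∃ T : Finset ℝ, (∀ s, s ∈ T ↔ s ∈ X) ∧ T.card ≤ d.levelSize k ∧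
      ((∃ w, d.H a w = 0 ∧ k < d.realIndex a w) → T.card = d.levelSize k) by
    obtain ⟨T, hT, h1, h2⟩ := this
    refine ⟨T.image fun s : ℝ => ((σ * Real.exp s : ℝ) : ℂ), fun w => ?_, ?_, fun h => ?_⟩
    · rw [hiff', Finset.mem_image]; simp only [hT]
    · rw [hsumX T fun s hs => (hT s).1 hs]; exact_mod_cast h1
    · rw [hsumX T fun s hs => (hT s).1 hs]; exact_mod_cast h2 h
  have huniqmax : ∀ s ∈ X, ∀ s' ∈ X, (∀ u, d.phase |a| u = k * Real.pi → u ≤ s) →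
      (∀ u, d.phase |a| u = k * Real.pi → u ≤ s') → s = s' := fun s hs s' hs' h h' =>
    le_antisymm (h' s hs.1) (h s' hs'.1)
  have huniqmin : ∀ s ∈ X, ∀ s' ∈ X, (∀ u, d.phase |a| u = k * Real.pi → s ≤ u) →
      (∀ u, d.phase |a| u = k * Real.pi → s' ≤ u) → s = s' := fun s hs s' hs' h h' =>
    le_antisymm (h s' hs'.1) (h' s hs.1)
  by_cases h10 : d.m = 1 ∧ k = 0
  · have hsize : d.levelSize k = 1 := if_pos h10
    -- This level has no left end, so every zero in it is its right end.
    have hmax : ∀ s ∈ X, ∀ u, d.phase |a| u = k * Real.pi → u ≤ s := fun s hs => by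
      rcases (hone s hs).2 with h | h
      · exact h.1
      · obtain ⟨s', hs', hp', -⟩ := exists_level_start hd hc h10 s
        linarith [h.1 s' hp']
    by_cases hne : ∃ s, s ∈ X
    · obtain ⟨s, hs⟩ := hne
      refine ⟨{s}, fun u => ?_, by simp [hsize], fun _ => by simp [hsize]⟩
      rw [Finset.mem_singleton]
      constructor
      · rintro rfl; exact hs
      · intro hu; exact huniqmax u hu s hs (hmax u hu) (hmax s hs)
    · refine ⟨∅, fun u => ⟨fun h => by simp at h, fun h => absurd ⟨u, h⟩ hne⟩, by simp, fun h => ?_⟩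
      obtain ⟨s, hs, -⟩ := hmaxX h
      exact absurd ⟨s, hs⟩ hne
  · have hsize : d.levelSize k = 2 := if_neg h10
    by_cases hne : ∃ s, s ∈ X
    · obtain ⟨s₀, hs₀⟩ := hne
      obtain ⟨s₁, hs₁, hmin⟩ := hminX s₀ hs₀ h10
      by_cases hmx : ∃ s ∈ X, ∀ s', d.phase |a| s' = k * Real.pi → s' ≤ s
      · obtain ⟨s₂, hs₂, hmax⟩ := hmx
        -- If both ends coincided, the level would be one point, whereas a simple zero has another
        -- point of the level beside it.
        have h12 : s₁ ≠ s₂ := by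
          rintro rfl
          rcases (hone s₁ hs₁).2 with h | h
          · obtain ⟨s', h1, h2⟩ := h.2
            linarith [hmin s' h2]
          · obtain ⟨s', h1, h2⟩ := h.2
            linarith [hmax s' h2]
        refine ⟨{s₁, s₂}, fun u => ?_, by rw [Finset.card_pair h12, hsize],
          fun _ => by rw [Finset.card_pair h12, hsize]⟩
        rw [Finset.mem_insert, Finset.mem_singleton]
        constructor
        · rintro (rfl | rfl)
          · exact hs₁
          · exact hs₂
        · intro hu
          rcases (hone u hu).2 with h | h
          · exact Or.inr (huniqmax u hu s₂ hs₂ h.1 hmax)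
          · exact Or.inl (huniqmin u hu s₁ hs₁ h.1 hmin)
      · refine ⟨{s₁}, fun u => ?_, by simp [hsize], fun h => absurd (hmaxX h) hmx⟩
        rw [Finset.mem_singleton]
        constructor
        · rintro rfl; exact hs₁
        · intro hu
          rcases (hone u hu).2 with h | h
          · exact absurd ⟨u, hu, h.1⟩ hmx
          · exact huniqmin u hu s₁ hs₁ h.1 hmin
    · refine ⟨∅, fun u => ⟨fun h => by simp at h, fun h => absurd ⟨u, h⟩ hne⟩, by simp, fun h => ?_⟩
      obtain ⟨s, hs, -⟩ := hmaxX h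
      exact absurd ⟨s, hs⟩ hne

end QuotientData

/-! ### Listing zeros by modulus and locating them by counting -/

/-- The positions of a list of length `ω`, counted from `1`. -/
def listPositions (ω : ℕ∞) : Set ℕ := {n | 1 ≤ n ∧ (n : ℕ∞) ≤ ω}

lemma listPositions_of_le {ω : ℕ∞} {m n : ℕ} (hn : n ∈ listPositions ω) (h1 : 1 ≤ m) (h : m ≤ n) :
    m ∈ listPositions ω := ⟨h1, (by exact_mod_cast h : (m : ℕ∞) ≤ n).trans hn.2⟩

/-- The rank is the number of predecessors. The predecessor of largest key has rank one less, so the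
ranks have no holes. -/
lemma exists_rank {Z K : Type} [LinearOrder K] (key : Z → K) (hkey : Function.Injective key)
    (hfin : ∀ p, {q | key q < key p}.Finite) :
    ∃ rank : Z → ℕ, (∀ p q, rank p < rank q ↔ key p < key q) ∧
      ∀ p n, n ≤ rank p → ∃ q, rank q = n := by
  set rank : Z → ℕ := fun p => {q | key q < key p}.ncard with hrank
  have hlt : ∀ p q, key p < key q → rank p < rank q := fun p q h =>
    Set.ncard_lt_ncard ⟨fun r (hr : key r < key p) => hr.trans h,
      fun hs => lt_irrefl (key p) (hs (show p ∈ {r | key r < key q} from h))⟩ (hfin q)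
  have hle : ∀ p q, rank p < rank q → key p < key q := fun p q h => by
    by_contra! hge
    rcases eq_or_lt_of_le hge with e | hge
    · rw [hkey e] at h; exact lt_irrefl _ h
    · exact lt_asymm h (hlt q p hge)
  refine ⟨rank, fun p q => ⟨hle p q, hlt p q⟩, ?_⟩
  have hpred : ∀ n p, rank p = n + 1 → ∃ q, rank q = n := fun n p hp => by
    have hne : {q | key q < key p}.Nonempty := by
      by_contra hemp
      rw [Set.not_nonempty_iff_eq_empty] at hemp
      simp [hrank, hemp] at hp
    obtain ⟨q, hq, hmax⟩ := Set.exists_max_image _ key (hfin p) hne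
    refine ⟨q, ?_⟩
    have e : {r | key r < key p} = insert q {r | key r < key q} := by
      ext r
      simp only [Set.mem_ofPred_eq, Set.mem_insert_iff]
      constructor
      · intro hr
        rcases eq_or_lt_of_le (hmax r hr) with h | h
        · exact Or.inl (hkey h)
        · exact Or.inr h
      · rintro (rfl | h)
        · exact hq
        · exact lt_trans h hq
    have hp' : {r | key r < key p}.ncard = n + 1 := hp
    rw [e, Set.ncard_insert_of_notMem (by simp) (hfin q)] at hp'
    exact Nat.succ_injective hp'
  intro p n hn
  induction hk : rank p - n generalizing p with
  | zero => exact ⟨p, by omega⟩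
  | succ k ih =>
    obtain ⟨q, hq⟩ := hpred (rank p - 1) p (by omega)
    exact ih q (by omega) (by omega)

lemma finite_zeros_of_norm_le {H : ℂ → ℂ} (hH : Differentiable ℂ H)
    (htop : ∀ w, analyticOrderAt H w ≠ ⊤) (R : ℝ) : {w | H w = 0 ∧ ‖w‖ ≤ R}.Finite := by
  by_contra hinf
  obtain ⟨w, -, hw⟩ := Set.Infinite.exists_accPt_of_subset_isCompact hinf
    (isCompact_closedBall (0 : ℂ) R) (fun w hw => by simpa using hw.2)
  rw [accPt_iff_frequently_nhdsNE] at hw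
  have h1 : ∃ᶠ z in nhdsWithin w {w}ᶜ, H z = 0 := hw.mono fun z hz => hz.1
  exact htop w (analyticOrderAt_eq_top.2
    ((hH.analyticAt w).frequently_zero_iff_eventually_zero.1 h1))

/-- The zeros of an entire function can be listed in the order of their absolute values. -/
lemma exists_isZeroEnumeration {H : ℂ → ℂ} (hH : Differentiable ℂ H)
    (htop : ∀ w, analyticOrderAt H w ≠ ⊤) : ∃ ω z, IsZeroEnumeration H ω z := by
  classical
  -- A zero is represented by as many pairs as its multiplicity. The lexicographic key orders by
  -- modulus first; the other entries only break ties.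
  set Z := {p : ℂ × ℕ // (p.2 : ℕ∞) < analyticOrderAt H p.1} with hZ
  set key : Z → ℝ ×ₗ ℝ ×ₗ ℝ ×ₗ ℕ := fun p =>
    toLex (‖p.1.1‖, toLex (p.1.1.re, toLex (p.1.1.im, p.1.2))) with hkey
  have hinj : Function.Injective key := by
    rintro ⟨⟨w, j⟩, hp⟩ ⟨⟨w', j'⟩, hp'⟩ h
    simp only [hkey, EmbeddingLike.apply_eq_iff_eq, Prod.mk.injEq] at h
    obtain ⟨-, h1, h2, h3⟩ := h
    exact Subtype.ext (Prod.ext (Complex.ext h1 h2) h3)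
  have hnorm : ∀ p q : Z, key p ≤ key q → ‖p.1.1‖ ≤ ‖q.1.1‖ := fun p q h => by
    rcases (Prod.Lex.le_iff).1 h with h | h
    · exact h.le
    · exact h.1.le
  have hzero : ∀ p : Z, H p.1.1 = 0 := fun p =>
    apply_eq_zero_of_analyticOrderAt_ne_zero (ne_of_gt (lt_of_le_of_lt zero_le p.2))
  have hfin : ∀ p : Z, {q | key q < key p}.Finite := fun p => by
    have h1 : (⋃ w ∈ {w | H w = 0 ∧ ‖w‖ ≤ ‖p.1.1‖},
        ({w} ×ˢ {j : ℕ | (j : ℕ∞) < analyticOrderAt H w} : Set (ℂ × ℕ))).Finite := by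
      refine Set.Finite.biUnion (finite_zeros_of_norm_le hH htop _) fun w _ => ?_
      refine (Set.finite_singleton w).prod ?_
      obtain ⟨q, hq⟩ := ENat.ne_top_iff_exists.1 (htop w)
      rw [← hq]
      refine (Set.finite_lt_nat q).subset fun j hj => ?_
      exact_mod_cast (show (j : ℕ∞) < q from hj)
    refine Set.Finite.of_finite_image (f := Subtype.val) (h1.subset ?_)
      Subtype.val_injective.injOn
    rintro _ ⟨q, hq, rfl⟩
    exact Set.mem_biUnion (x := q.1.1) ⟨hzero q, hnorm q p (le_of_lt hq)⟩ ⟨rfl, q.2⟩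
  obtain ⟨rank, hrank, hdown⟩ := exists_rank key hinj hfin
  have hrinj : Function.Injective rank := fun p q h => by
    refine hinj (le_antisymm ?_ ?_) <;> by_contra! hlt
    · exact absurd ((hrank q p).2 hlt) (by omega)
    · exact absurd ((hrank p q).2 hlt) (by omega)
  -- This is `0` if there are no zeros and `⊤` if there are infinitely many. As ranks have no holes,
  -- the positions up to `ω` are exactly the numbers `rank p + 1`.
  set ω : ℕ∞ := ⨆ p : Z, ((rank p + 1 : ℕ) : ℕ∞) with hω
  have hmem : ∀ n : ℕ, 1 ≤ n → ((n : ℕ∞) ≤ ω ↔ ∃ p, rank p + 1 = n) := fun n hn => by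
    constructor
    · intro h
      by_contra! hne
      have h2 : ω ≤ ((n - 1 : ℕ) : ℕ∞) := by
        refine iSup_le fun p => ?_
        by_contra! hlt
        have : n - 1 < rank p + 1 := by exact_mod_cast hlt
        obtain ⟨q, hq⟩ := hdown p (n - 1) (by omega)
        exact hne q (by omega)
      have : (n : ℕ∞) ≤ ((n - 1 : ℕ) : ℕ∞) := h.trans h2
      have : n ≤ n - 1 := by exact_mod_cast this
      omega
    · rintro ⟨p, rfl⟩
      exact le_iSup (fun p : Z => ((rank p + 1 : ℕ) : ℕ∞)) p
  set z : ℕ → ℂ := fun n => if h : ∃ p, rank p + 1 = n then h.choose.1.1 else 0 with hz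
  have hzp : ∀ p : Z, z (rank p + 1) = p.1.1 := fun p => by
    have h : ∃ q, rank q + 1 = rank p + 1 := ⟨p, rfl⟩
    have : h.choose = p := hrinj (Nat.succ_injective h.choose_spec)
    simp only [hz]
    rw [dif_pos h, this]
  refine ⟨ω, z, fun n hn h => ?_, fun w => ?_⟩
  · obtain ⟨q, hq⟩ := (hmem (n + 1) (by omega)).1 h
    obtain ⟨p, hp⟩ := (hmem n hn).1 (le_trans (by exact_mod_cast Nat.le_succ n) h)
    rw [← hq, ← hp, hzp, hzp]
    refine hnorm p q (le_of_lt ((hrank p q).1 (by omega)))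
  · have e : {n : ℕ | 1 ≤ n ∧ (n : ℕ∞) ≤ ω ∧ z n = w}
        = (fun p => rank p + 1) '' {p : Z | p.1.1 = w} := by
      ext n
      simp only [Set.mem_ofPred_eq, Set.mem_image]
      constructor
      · rintro ⟨h1, h2, h3⟩
        obtain ⟨p, rfl⟩ := (hmem n h1).1 h2
        exact ⟨p, by rw [← h3, hzp], rfl⟩
      · rintro ⟨p, hp, rfl⟩
        exact ⟨by omega, (hmem _ (by omega)).2 ⟨p, rfl⟩, by rw [hzp, hp]⟩
    have hi : Function.Injective fun p : Z => rank p + 1 := fun p q h =>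
      hrinj (Nat.succ_injective h)
    rw [e, hi.encard_image]
    obtain ⟨q, hq⟩ := ENat.ne_top_iff_exists.1 (htop w)
    have e2 : {p : Z | p.1.1 = w} = Set.range fun j : Fin q =>
        (⟨(w, j), by rw [← hq]; exact_mod_cast j.2⟩ : Z) := by
      ext ⟨⟨w', j⟩, hp⟩
      simp only [Set.mem_ofPred_eq, Set.mem_range]
      constructor
      · rintro rfl
        rw [← hq] at hp
        exact ⟨⟨j, by exact_mod_cast hp⟩, rfl⟩
      · rintro ⟨j', h⟩
        have := congrArg (fun r : Z => r.1.1) h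
        exact this.symm
    have hi2 : Function.Injective fun j : Fin q =>
        (⟨(w, j), by rw [← hq]; exact_mod_cast j.2⟩ : Z) := fun j j' h => by
      have := congrArg (fun r : Z => r.1.2) h
      exact Fin.ext this
    rw [e2, ← Set.image_univ, hi2.encard_image, Set.encard_univ, ENat.card_eq_coe_fintype_card,
      Fintype.card_fin, hq]

namespace IsZeroEnumeration

variable {H : ℂ → ℂ} {ω : ℕ∞} {z : ℕ → ℂ}

lemma norm_le (h : IsZeroEnumeration H ω z) {m n : ℕ} (h1 : 1 ≤ m) (hmn : m ≤ n)
    (hn : n ∈ listPositions ω) : ‖z m‖ ≤ ‖z n‖ := by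
  induction n, hmn using Nat.le_induction with
  | base => exact le_rfl
  | succ k hk ih =>
    exact (ih (listPositions_of_le hn (h1.trans hk) (Nat.le_succ k))).trans
      (h.1 k (h1.trans hk) hn.2)

lemma eq_zero (h : IsZeroEnumeration H ω z) {n : ℕ} (hn : n ∈ listPositions ω) : H (z n) = 0 := by
  refine apply_eq_zero_of_analyticOrderAt_ne_zero ?_
  rw [← h.2 (z n), Set.encard_ne_zero]
  exact ⟨n, hn.1, hn.2, rfl⟩

lemma two_le_order (h : IsZeroEnumeration H ω z) {m n : ℕ} (hm : m ∈ listPositions ω)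
    (hn : n ∈ listPositions ω) (hne : m ≠ n) (e : z m = z n) : 2 ≤ analyticOrderAt H (z n) := by
  rw [← h.2 (z n), ← Set.encard_pair hne]
  refine Set.encard_le_encard ?_
  rintro k (rfl | rfl)
  · exact ⟨hm.1, hm.2, e⟩
  · exact ⟨hn.1, hn.2, rfl⟩

lemma encard_mem (h : IsZeroEnumeration H ω z) (t : Finset ℂ) :
    {n | n ∈ listPositions ω ∧ z n ∈ t}.encard = ∑ w ∈ t, analyticOrderAt H w := by
  classical
  induction t using Finset.induction_on with
  | empty => simp
  | insert w t hw ih =>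
    rw [Finset.sum_insert hw, ← ih, ← h.2 w]
    rw [← Set.encard_union_eq]
    · congr 1
      ext n
      simp only [Set.mem_ofPred_eq, Finset.mem_insert, Set.mem_union, listPositions]
      tauto
    · rw [Set.disjoint_left]
      rintro n ⟨-, -, rfl⟩ ⟨-, h2⟩
      exact hw h2

/-- If the zeros fall into clusters of known sizes, ordered by their moduli, then the position of a
zero in the list determines its cluster. -/
lemma position_bounds (h : IsZeroEnumeration H ω z) (k : ℂ → ℕ) (S : ℕ → ℕ)
    (hmono : ∀ w w', H w = 0 → H w' = 0 → ‖w‖ ≤ ‖w'‖ → k w ≤ k w')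
    (hS : ∀ j, ∃ t : Finset ℂ, (∀ w, w ∈ t ↔ H w = 0 ∧ k w = j) ∧
      ∑ w ∈ t, analyticOrderAt H w ≤ (S j : ℕ∞) ∧
      ((∃ w, H w = 0 ∧ j < k w) → ∑ w ∈ t, analyticOrderAt H w = (S j : ℕ∞)))
    {n : ℕ} (hn : n ∈ listPositions ω) :
    ∑ j ∈ Finset.range (k (z n)), S j < n ∧ n ≤ ∑ j ∈ Finset.range (k (z n) + 1), S j := by
  choose t ht hle heq using hS
  have hcount : ∀ K, {m | m ∈ listPositions ω ∧ k (z m) < K}.encard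
      = ∑ j ∈ Finset.range K, ∑ w ∈ t j, analyticOrderAt H w := by
    intro K
    induction K with
    | zero => simp
    | succ K ih =>
      rw [Finset.sum_range_succ, ← ih, ← h.encard_mem (t K), ← Set.encard_union_eq]
      · congr 1
        ext m
        simp only [Set.mem_ofPred_eq, Set.mem_union, ht]
        constructor
        · rintro ⟨h1, h2⟩
          rcases Nat.lt_succ_iff_lt_or_eq.1 h2 with h3 | h3
          · exact Or.inl ⟨h1, h3⟩
          · exact Or.inr ⟨h1, h.eq_zero h1, h3⟩
        · rintro (⟨h1, h2⟩ | ⟨h1, -, h2⟩)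
          · exact ⟨h1, by omega⟩
          · exact ⟨h1, by omega⟩
      · rw [Set.disjoint_left]
        rintro m ⟨-, h1⟩ ⟨-, h2⟩
        have := ((ht K _).1 h2).2
        omega
  have hk : ∀ {m m' : ℕ}, 1 ≤ m → m ≤ m' → m' ∈ listPositions ω → k (z m) ≤ k (z m') :=
    fun h1 h2 h3 => hmono _ _ (h.eq_zero (listPositions_of_le h3 h1 h2)) (h.eq_zero h3)
      (h.norm_le h1 h2 h3)
  constructor
  · have h1 : {m | m ∈ listPositions ω ∧ k (z m) < k (z n)} ⊆ (Finset.Ico 1 n : Finset ℕ) := by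
      rintro m ⟨h2, h3⟩
      simp only [Finset.coe_Ico, Set.mem_Ico]
      refine ⟨h2.1, ?_⟩
      by_contra! h4
      exact absurd (hk hn.1 h4 h2) (by omega)
    have h2 := Set.encard_le_encard h1
    rw [hcount, Set.encard_coe_eq_coe_finsetCard, Nat.card_Ico] at h2
    have h3 : ∑ j ∈ Finset.range (k (z n)), ∑ w ∈ t j, analyticOrderAt H w
        = ((∑ j ∈ Finset.range (k (z n)), S j : ℕ) : ℕ∞) := by
      rw [Nat.cast_sum]
      exact Finset.sum_congr rfl fun j hj => heq j ⟨z n, h.eq_zero hn, Finset.mem_range.1 hj⟩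
    rw [h3] at h2
    have h4 : ∑ j ∈ Finset.range (k (z n)), S j ≤ n - 1 := by exact_mod_cast h2
    have := hn.1
    omega
  · have h1 : ((Finset.Icc 1 n : Finset ℕ) : Set ℕ)
        ⊆ {m | m ∈ listPositions ω ∧ k (z m) < k (z n) + 1} := by
      intro m hm
      simp only [Finset.coe_Icc, Set.mem_Icc] at hm
      exact ⟨listPositions_of_le hn hm.1 hm.2, Nat.lt_succ_of_le (hk hm.1 hm.2 hn)⟩
    have h2 := Set.encard_le_encard h1
    rw [hcount, Set.encard_coe_eq_coe_finsetCard, Nat.card_Icc] at h2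
    have h3 : ∑ j ∈ Finset.range (k (z n) + 1), ∑ w ∈ t j, analyticOrderAt H w
        ≤ ((∑ j ∈ Finset.range (k (z n) + 1), S j : ℕ) : ℕ∞) := by
      rw [Nat.cast_sum]
      exact Finset.sum_le_sum fun j _ => hle j
    have h4 : n + 1 - 1 ≤ ∑ j ∈ Finset.range (k (z n) + 1), S j := by exact_mod_cast h2.trans h3
    omega

end IsZeroEnumeration

/-! ### Quadrants and quarter-turns -/

lemma mem_quadrant_iff (l : ℤ) (z : ℂ) :
    z ∈ quadrant l ↔ 0 < (z * I ^ (-l)).re ∧ 0 < (z * I ^ (-l)).im := by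
  set w := z * I ^ (-l) with hw
  have hz : z ≠ 0 ↔ w ≠ 0 := by
    rw [hw, Ne, Ne, mul_eq_zero, or_iff_left (zpow_ne_zero _ I_ne_zero)]
  change z ≠ 0 ∧ 0 < w.arg ∧ w.arg < Real.pi / 2 ↔ _
  rw [hz]
  constructor
  · rintro ⟨h0, h1, h2⟩
    have him : 0 < w.im := by
      refine lt_of_le_of_ne (arg_nonneg_iff.1 h1.le) fun h => ?_
      rcases lt_or_ge w.re 0 with hr | hr
      · rw [arg_eq_pi_iff.2 ⟨hr, h.symm⟩] at h2
        linarith [Real.pi_pos]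
      · rw [arg_eq_zero_iff.2 ⟨hr, h.symm⟩] at h1
        exact lt_irrefl _ h1
    rcases arg_lt_pi_div_two_iff.1 h2 with h | h | h
    · exact ⟨h, him⟩
    · linarith
    · exact absurd h h0
  · rintro ⟨h1, h2⟩
    refine ⟨fun h => by simp [h] at h1, lt_of_le_of_ne (arg_nonneg_iff.2 h2.le) fun h => ?_,
      arg_lt_pi_div_two_iff.2 (Or.inl h1)⟩
    have := (arg_eq_zero_iff.1 h.symm).2
    linarith

lemma I_zpow_neg_cases (l : ℤ) : I ^ (-l) = 1 ∨ I ^ (-l) = I ∨ I ^ (-l) = -1 ∨ I ^ (-l) = -I := by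
  have h4 : I ^ (4 : ℤ) = 1 := by
    rw [show (4 : ℤ) = ((4 : ℕ) : ℤ) by norm_num, zpow_natCast, I_pow_four]
  have e : I ^ (-l) = I ^ ((-l) % 4) := by
    conv_lhs => rw [← Int.emod_add_mul_ediv (-l) 4]
    rw [zpow_add₀ I_ne_zero, zpow_mul, h4, one_zpow, mul_one]
  have h1 := Int.emod_nonneg (-l) (by norm_num : (4 : ℤ) ≠ 0)
  have h2 := Int.emod_lt_of_pos (-l) (by norm_num : (0 : ℤ) < 4)
  rw [e]
  have : (-l) % 4 = 0 ∨ (-l) % 4 = 1 ∨ (-l) % 4 = 2 ∨ (-l) % 4 = 3 := by omega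
  rcases this with h | h | h | h <;> rw [h]
  · exact Or.inl (zpow_zero _)
  · exact Or.inr (Or.inl (zpow_one _))
  · refine Or.inr (Or.inr (Or.inl ?_))
    rw [show (2 : ℤ) = ((2 : ℕ) : ℤ) by norm_num, zpow_natCast, I_sq]
  · refine Or.inr (Or.inr (Or.inr ?_))
    rw [show (3 : ℤ) = ((3 : ℕ) : ℤ) by norm_num, zpow_natCast, I_pow_three]

/-- The sign conditions say that `z'` lies in the same open quadrant as `i z`; those of
`quadrant_pred` say the same with `-i z`. -/
lemma quadrant_succ {z z' : ℂ} (h1 : z'.re * z.im < 0) (h2 : 0 < z'.im * z.re) {l : ℤ}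
    (h : z ∈ quadrant l) : z' ∈ quadrant (l + 1) := by
  rw [mem_quadrant_iff] at h ⊢
  have e : I ^ (-(l + 1)) = I ^ (-l) * (-I) := by
    rw [neg_add, zpow_add₀ I_ne_zero, zpow_neg_one, inv_I]
  rw [e]
  rcases I_zpow_neg_cases l with hl | hl | hl | hl <;> rw [hl] at h ⊢ <;> simp at h ⊢ <;>
    obtain ⟨a, b⟩ := h <;> constructor <;> by_contra! hh <;> nlinarith

lemma quadrant_pred {z z' : ℂ} (h1 : 0 < z'.re * z.im) (h2 : z'.im * z.re < 0) {l : ℤ}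
    (h : z ∈ quadrant l) : z' ∈ quadrant (l + -1) := by
  rw [mem_quadrant_iff] at h ⊢
  have e : I ^ (-(l + -1)) = I ^ (-l) * I := by
    rw [neg_add, zpow_add₀ I_ne_zero, neg_neg, zpow_one]
  rw [e]
  rcases I_zpow_neg_cases l with hl | hl | hl | hl <;> rw [hl] at h ⊢ <;> simp at h ⊢ <;>
    obtain ⟨a, b⟩ := h <;> constructor <;> by_contra! hh <;> nlinarith

lemma exists_quarter_signs (k : ℕ) : ∃ e₁ e₂ : ℝ,
    ∀ s ∈ Set.Ioo (((k : ℝ) - 1) * (Real.pi / 2)) (k * (Real.pi / 2)),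
      0 < e₁ * Real.cos s ∧ 0 < e₂ * Real.sin s := by
  have q : ∀ j : ℕ, ((-1 : ℝ) ^ j) * (-1) ^ j = 1 := fun j => by
    rw [← mul_pow]; norm_num
  obtain ⟨j, hj | hj⟩ := Nat.even_or_odd' k
  · refine ⟨(-1) ^ j, -(-1) ^ j, fun s hs => ?_⟩
    rw [hj] at hs
    push_cast at hs
    obtain ⟨u, rfl⟩ : ∃ u, s = j * Real.pi - u := ⟨j * Real.pi - s, by ring⟩
    have u1 : 0 < u := by linarith [hs.2]
    have u2 : u < Real.pi / 2 := by linarith [hs.1]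
    rw [Real.cos_nat_mul_pi_sub, Real.sin_nat_mul_pi_sub, ← mul_assoc, q, one_mul]
    refine ⟨Real.cos_pos_of_mem_Ioo ⟨by linarith, u2⟩, ?_⟩
    have := Real.sin_pos_of_mem_Ioo ⟨u1, by linarith⟩
    have e : -(-1) ^ j * -((-1) ^ j * Real.sin u) = ((-1 : ℝ) ^ j * (-1) ^ j) * Real.sin u := by ring
    rwa [e, q, one_mul]
  · refine ⟨(-1) ^ j, (-1) ^ j, fun s hs => ?_⟩
    rw [hj] at hs
    push_cast at hs
    obtain ⟨u, rfl⟩ : ∃ u, s = u + j * Real.pi := ⟨s - j * Real.pi, by ring⟩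
    have u1 : 0 < u := by linarith [hs.1]
    have u2 : u < Real.pi / 2 := by linarith [hs.2]
    rw [Real.cos_add_nat_mul_pi, Real.sin_add_nat_mul_pi, ← mul_assoc, ← mul_assoc, q, one_mul,
      one_mul]
    exact ⟨Real.cos_pos_of_mem_Ioo ⟨by linarith, u2⟩, Real.sin_pos_of_mem_Ioo ⟨u1, by linarith⟩⟩

lemma consecutive_quarter_signs {k : ℕ} {s t : ℝ}
    (hs : s ∈ Set.Ioo (((k : ℝ) - 1) * (Real.pi / 2)) (k * (Real.pi / 2)))
    (ht : t ∈ Set.Ioo ((((k + 1 : ℕ) : ℝ) - 1) * (Real.pi / 2)) ((k + 1 : ℕ) * (Real.pi / 2))) :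
    Real.cos t * Real.sin s < 0 ∧ 0 < Real.sin t * Real.cos s := by
  obtain ⟨e₁, e₂, h⟩ := exists_quarter_signs k
  push_cast at ht
  obtain ⟨a, b⟩ := h s hs
  -- `t - π/2` lies in the same quarter as `s`, and the shift exchanges sine and cosine up to sign.
  obtain ⟨a', b'⟩ := h (t - Real.pi / 2) ⟨by linarith [ht.1], by linarith [ht.2]⟩
  rw [Real.cos_sub_pi_div_two] at a'
  rw [Real.sin_sub_pi_div_two] at b'
  constructor
  · by_contra! hh
    have h1 := mul_pos b b'
    nlinarith [mul_nonneg hh (mul_self_nonneg e₂)]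
  · by_contra! hh
    have h1 := mul_pos a a'
    nlinarith [mul_nonpos_of_nonpos_of_nonneg hh (mul_self_nonneg e₁)]

/-! ### The distribution of the listed zeros for generic and for real `α` -/

namespace QuotientData

variable {d : QuotientData}

lemma ne_zero_of_H {α w : ℂ} (hα : α ≠ 0) (hw : d.H α w = 0) : w ≠ 0 := by
  rintro rfl; exact d.H_zero_ne_zero hα hw

lemma sq_im (w : ℂ) : (w ^ 2).im = 2 * (w.re * w.im) := by
  rw [sq, mul_im]; ring

/-- Every index below one that occurs belongs to exactly one simple zero, so all clusters have size
`1`. Indices start from `0` and positions from `1`. -/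
lemma generic_index_of_list (hd : d.HasFactor) (hm : d.m = 0) {α : ℂ} (hr : α.re ≠ 0)
    (hi : α.im ≠ 0) {ω : ℕ∞} {z : ℕ → ℂ} (h : IsZeroEnumeration (d.H α) ω z) {n : ℕ}
    (hn : n ∈ listPositions ω) : d.genericIndex α (z n) + 1 = n := by
  have hα : α ≠ 0 := by rintro rfl; exact hr rfl
  have key := h.position_bounds (d.genericIndex α) (fun _ => 1)
    (fun w w' hw _ hle => genericIndex_mono hα (ne_zero_of_H hα hw) hle) (fun j => ?_) hn
  · simp only [Finset.sum_const, Finset.card_range, smul_eq_mul, mul_one] at key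
    omega
  · by_cases hex : ∃ w, d.H α w = 0 ∧ d.genericIndex α w = j
    · obtain ⟨w, hw, hwj⟩ := hex
      have ho : analyticOrderAt (d.H α) w = 1 :=
        order_eq_one_of_interior hd hα hw (generic_signs hd hr hi hw).1
      refine ⟨{w}, fun w' => ?_, by simp [ho], fun _ => by simp [ho]⟩
      rw [Finset.mem_singleton]
      constructor
      · rintro rfl; exact ⟨hw, hwj⟩
      · rintro ⟨h1, h2⟩; exact eq_of_genericIndex_eq hd hr hi h1 hw (h2.trans hwj.symm)
    · refine ⟨∅, fun w' => ⟨fun h => by simp at h, fun h => absurd ⟨w', h⟩ hex⟩, by simp, ?_⟩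
      rintro ⟨w, hw, hjw⟩
      exact absurd (exists_zero_of_generic hd hm hr hi hw hjw) hex

lemma distributedGeneric (hd : d.HasFactor) (hm : d.m = 0) {α : ℂ} (hα2 : (α ^ 2).im ≠ 0)
    {ω : ℕ∞} {z : ℕ → ℂ} (h : IsZeroEnumeration (d.H α) ω z) :
    DistributedGeneric (d.H α) α ω z := by
  rw [sq_im] at hα2
  have hr : α.re ≠ 0 := left_ne_zero_of_mul (right_ne_zero_of_mul hα2)
  have hi : α.im ≠ 0 := right_ne_zero_of_mul (right_ne_zero_of_mul hα2)
  have hα : α ≠ 0 := by rintro rfl; exact hr rfl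
  refine ⟨fun w hw => ?_, fun n hn hn' => ?_, fun h1 => ?_⟩
  · obtain ⟨hθ, h1, h2⟩ := generic_signs hd hr hi hw
    refine ⟨ne_zero_of_H hα hw, order_eq_one_of_interior hd hα hw hθ, ?_⟩
    rw [sq_im]
    exact mul_ne_zero two_ne_zero (mul_ne_zero (left_ne_zero_of_mul h1.ne')
      (left_ne_zero_of_mul h2.ne'))
  · have p' : n + 1 ∈ listPositions ω := ⟨by omega, hn'⟩
    have p : n ∈ listPositions ω := listPositions_of_le p' hn (Nat.le_succ n)
    have k1 := generic_index_of_list hd hm hr hi h p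
    have k2 := generic_index_of_list hd hm hr hi h p'
    have hz := h.eq_zero p
    have hz' := h.eq_zero p'
    have m1 := phase_mem_of_generic hd hr hi hz
    have m2 := phase_mem_of_generic hd hr hi hz'
    rw [show d.genericIndex α (z (n + 1)) = d.genericIndex α (z n) + 1 by omega] at m2
    obtain ⟨q1, q2⟩ := consecutive_quarter_signs m1 m2
    obtain ⟨-, s1, s2⟩ := generic_signs hd hr hi hz
    obtain ⟨-, s1', s2'⟩ := generic_signs hd hr hi hz'
    have t1 : (z (n + 1)).re * (z n).im * (α.re * α.im) < 0 := by
      by_contra! hh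
      have := mul_pos s1' s2
      have := mul_nonpos_of_nonneg_of_nonpos hh q1.le
      linarith
    have t2 : 0 < (z (n + 1)).im * (z n).re * (α.re * α.im) := by
      by_contra! hh
      have := mul_pos s2' s1
      have := mul_nonpos_of_nonpos_of_nonneg hh q2.le
      linarith
    refine ⟨?_, fun l hl => ?_⟩
    · by_contra! hle
      have := genericIndex_mono (d := d) hα (ne_zero_of_H hα hz') hle
      omega
    · rw [sq_im]
      rcases lt_or_gt_of_ne (right_ne_zero_of_mul hα2) with hneg | hpos
      · rw [sign_neg (by linarith)]
        refine quadrant_pred ?_ ?_ hl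
        · exact pos_of_mul_neg_left t1 hneg.le
        · by_contra! hh
          linarith [mul_nonpos_of_nonneg_of_nonpos hh hneg.le]
      · rw [sign_pos (by linarith)]
        refine quadrant_succ ?_ ?_ hl
        · by_contra! hh
          linarith [mul_nonneg hh hpos.le]
        · exact pos_of_mul_pos_left t2 hpos.le
  · have p : 1 ∈ listPositions ω := ⟨le_rfl, by exact_mod_cast h1⟩
    have k1 := generic_index_of_list hd hm hr hi h p
    have hz := h.eq_zero p
    have m1 := phase_mem_of_generic hd hr hi hz
    rw [show d.genericIndex α (z 1) = 0 by omega] at m1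
    simp only [Nat.cast_zero, zero_sub, zero_mul, neg_mul, one_mul] at m1
    obtain ⟨-, s1, s2⟩ := generic_signs hd hr hi hz
    -- The first zero has index `0`, so its phase lies in `(-π/2, 0)`.
    have c1 := Real.cos_pos_of_mem_Ioo ⟨m1.1, by linarith [m1.2, Real.pi_pos]⟩
    have c2 := Real.sin_neg_of_neg_of_neg_pi_lt m1.2 (by linarith [m1.1, Real.pi_pos])
    have t1 : 0 < (z 1).re * α.re := by
      by_contra! hh
      linarith [mul_nonpos_of_nonpos_of_nonneg hh c1.le]
    have t2 : (z 1).im * α.im < 0 := by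
      by_contra! hh
      linarith [mul_nonpos_of_nonneg_of_nonpos hh c2.le]
    refine ⟨by linarith, ?_⟩
    rw [sq_im]
    have := mul_neg_of_pos_of_neg t1 t2
    linarith

lemma real_order (hd : d.HasFactor) {a : ℝ} (ha : a ≠ 0) {w : ℂ} (hw : d.H a w = 0) :
    w.re ≠ 0 ∧
    (w.im = 0 → analyticOrderAt (d.H a) w = 1 ∨ analyticOrderAt (d.H a) w = 2) ∧
    (w.im ≠ 0 → analyticOrderAt (d.H a) w = 1) := by
  have hα : (a : ℂ) ≠ 0 := ofReal_ne_zero.2 ha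
  have hn : ‖(a : ℂ)‖ = |a| := by rw [norm_real, Real.norm_eq_abs]
  obtain ⟨-, h1, h2, h3⟩ := real_zero_facts hd ha hw
  refine ⟨left_ne_zero_of_mul h1.ne', fun him => ?_, fun him => ?_⟩
  · obtain ⟨σ, hσ, hσa⟩ := exists_level_sign (a := a) (d.realIndex a w)
    obtain ⟨s, e, he, hph, hg, hws⟩ := (level_zero_iff hd ha hσ hσa w).1 ⟨hw, rfl⟩
    have h0 : d.curve |a| s = 0 := by
      have := h2.1 him
      rwa [hws, log_norm_reflect_polarPt hσ he] at this
    rw [h0, reflect_polarPt_zero] at hws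
    rw [hws] at hw ⊢
    rcases level_order hd ha hσ hph h0 hw with h | h | h
    · exact Or.inr h.1
    · exact Or.inl h.1
    · exact Or.inl h.1
  · refine order_eq_one_of_interior hd hα hw ?_
    rw [hn]
    exact h3 him

lemma real_index_bounds (hd : d.HasFactor) {a : ℝ} (ha : a ≠ 0) {ω : ℕ∞} {z : ℕ → ℂ}
    (h : IsZeroEnumeration (d.H a) ω z) {n : ℕ} (hn : n ∈ listPositions ω) :
    ∑ j ∈ Finset.range (d.realIndex a (z n)), d.levelSize j < n ∧
      n ≤ ∑ j ∈ Finset.range (d.realIndex a (z n) + 1), d.levelSize j :=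
  h.position_bounds (d.realIndex a) d.levelSize
    (fun _ _ hw _ hle => realIndex_mono ha (ne_zero_of_H (ofReal_ne_zero.2 ha) hw) hle)
    (fun j => level_sum hd ha j) hn

lemma sum_levelSize_low (hm : d.m = 0) (K : ℕ) :
    ∑ j ∈ Finset.range K, d.levelSize j = 2 * K := by
  simp [levelSize, hm, mul_comm]

lemma sum_levelSize_high (hm : d.m = 1) (K : ℕ) :
    ∑ j ∈ Finset.range (K + 1), d.levelSize j = 2 * K + 1 := by
  rw [Finset.sum_range_succ']
  simp [levelSize, hm, mul_comm]

/-- At equal moduli both zeros reflect to the same point of the curve and differ at most in the sign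
of the imaginary part. At different moduli the level is not a single point and hence lies on the
real axis. -/
lemma real_pair (hd : d.HasFactor) {a : ℝ} (ha : a ≠ 0) {ω : ℕ∞} {z : ℕ → ℂ}
    (h : IsZeroEnumeration (d.H a) ω z) {m n : ℕ} (hm : 1 ≤ m) (hmn : m < n)
    (hn : n ∈ listPositions ω) (hk : d.realIndex a (z m) = d.realIndex a (z n)) :
    ‖z m‖ ≤ ‖z n‖ ∧ (‖z m‖ = ‖z n‖ → z m = (starRingEnd ℂ) (z n)) ∧
    (‖z m‖ < ‖z n‖ → (z m).im = 0 ∧ (z n).im = 0 ∧ 0 < (z m).re * (z n).re) := by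
  have hc := abs_pos.2 ha
  have hα : (a : ℂ) ≠ 0 := ofReal_ne_zero.2 ha
  have p := listPositions_of_le hn hm hmn.le
  have hz := h.eq_zero p
  have hz' := h.eq_zero hn
  obtain ⟨f1, f2, f3, f4⟩ := real_zero_facts hd ha hz
  obtain ⟨g1, g2, g3, g4⟩ := real_zero_facts hd ha hz'
  rw [hk] at f1 f2
  refine ⟨h.norm_le hm hmn.le hn, fun he => ?_, fun hlt => ?_⟩
  · obtain ⟨σ, hσ, hσa⟩ := exists_level_sign (a := a) (d.realIndex a (z n))
    obtain ⟨s, e, he₁, -, -, hws⟩ := (level_zero_iff hd ha hσ hσa (z m)).1 ⟨hz, hk⟩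
    obtain ⟨s', e', he₁', -, -, hws'⟩ := (level_zero_iff hd ha hσ hσa (z n)).1 ⟨hz', rfl⟩
    have hs : s = s' := by
      have h1 := congrArg (fun w => Real.log ‖w‖) hws
      have h2 := congrArg (fun w => Real.log ‖w‖) hws'
      simp only [log_norm_reflect_polarPt hσ he₁, log_norm_reflect_polarPt hσ he₁'] at h1 h2
      rw [← h1, ← h2, he]
    -- With equal signs one zero occupies two positions, so it is multiple and therefore real.
    by_cases hee : e = e'
    · have heq : z m = z n := by rw [hws, hws', hs, hee]
      have h2 := h.two_le_order p hn hmn.ne heq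
      have him : (z n).im = 0 := by
        by_contra him
        rw [(real_order hd ha hz').2.2 him] at h2
        norm_num at h2
      rw [heq, conj_eq_iff_im.2 him]
    · have hneg : e = -e' := by
        rcases he₁ with rfl | rfl <;> rcases he₁' with rfl | rfl
        · exact absurd rfl hee
        · norm_num
        · rfl
        · exact absurd rfl hee
      rw [hws, hws', hs, hneg]
      apply Complex.ext <;> simp [reflect]
  · have hlog : Real.log ‖z m‖ ≠ Real.log ‖z n‖ :=
      (Real.log_lt_log (norm_pos_iff.2 (ne_zero_of_H hα hz)) hlt).ne
    have := curve_eq_of_phase_eq hd hc hlog (f1.trans g1.symm)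
    have i1 : (z m).im = 0 := by
      by_contra hne; exact this.2 (f4 hne)
    have i2 : (z n).im = 0 := by
      by_contra hne; exact this.2 (this.1 ▸ g4 hne)
    refine ⟨i1, i2, ?_⟩
    have h5 := mul_pos f2 g2
    by_contra! hh
    nlinarith [mul_nonpos_of_nonpos_of_nonneg hh
      (mul_self_nonneg (a * Real.cos (d.realIndex a (z n) * Real.pi)))]

/-- Passing to the next level changes the sign of `cos (kπ)`, and the real part of the zero follows
that sign. -/
lemma real_cross (hd : d.HasFactor) {a : ℝ} (ha : a ≠ 0) {ω : ℕ∞} {z : ℕ → ℂ}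
    (h : IsZeroEnumeration (d.H a) ω z) {m n : ℕ} (hm : m ∈ listPositions ω)
    (hn : n ∈ listPositions ω) (hk : d.realIndex a (z n) = d.realIndex a (z m) + 1) :
    ‖z m‖ < ‖z n‖ ∧ (z m).re * (z n).re < 0 := by
  have hz := h.eq_zero hm
  have hz' := h.eq_zero hn
  obtain ⟨-, f2, -⟩ := real_zero_facts hd ha hz
  obtain ⟨-, g2, -⟩ := real_zero_facts hd ha hz'
  constructor
  · by_contra! hle
    have := realIndex_mono (d := d) ha (ne_zero_of_H (ofReal_ne_zero.2 ha) hz') hle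
    omega
  · rw [hk] at g2
    push_cast at g2
    rw [add_mul, one_mul, Real.cos_add_pi] at g2
    have h5 := mul_pos f2 g2
    by_contra! hh
    nlinarith [mul_nonneg hh
      (mul_self_nonneg (a * Real.cos (d.realIndex a (z m) * Real.pi)))]

lemma distributedReal (hd : d.HasFactor) (hm : d.m = 0) {a : ℝ} (ha : a ≠ 0)
    {ω : ℕ∞} {z : ℕ → ℂ} (h : IsZeroEnumeration (d.H a) ω z) :
    DistributedReal (d.H a) a ω z := by
  have hidx : ∀ {n}, n ∈ listPositions ω →
      2 * d.realIndex a (z n) < n ∧ n ≤ 2 * (d.realIndex a (z n) + 1) := fun hn => by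
    have := real_index_bounds hd ha h hn
    rwa [sum_levelSize_low hm, sum_levelSize_low hm] at this
  refine ⟨fun w hw => real_order hd ha hw, fun n hn => ?_, fun n hn => ?_, fun h1 => ?_⟩
  · have p2 : 2 * n + 2 ∈ listPositions ω := ⟨by omega, hn⟩
    have p1 := listPositions_of_le p2 (by omega : 1 ≤ 2 * n + 1) (by omega)
    have k1 := hidx p1
    have k2 := hidx p2
    obtain ⟨b1, b2, b3⟩ := real_pair hd ha h (by omega) (by omega) p2
      (by omega : d.realIndex a (z (2 * n + 1)) = d.realIndex a (z (2 * n + 2)))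
    refine ⟨b1, b2, fun hlt => ?_⟩
    obtain ⟨i1, i2, hpos⟩ := b3 hlt
    rcases lt_trichotomy (z (2 * n + 2)).re 0 with hr | hr | hr
    · have : (z (2 * n + 1)).re < 0 := by
        by_contra! hh
        nlinarith
      rw [arg_eq_pi_iff.2 ⟨hr, i2⟩, arg_eq_pi_iff.2 ⟨this, i1⟩]
      exact ⟨rfl, Or.inr rfl⟩
    · rw [hr, mul_zero] at hpos
      exact absurd hpos (lt_irrefl _)
    · have : 0 ≤ (z (2 * n + 1)).re := by
        by_contra! hh
        nlinarith
      rw [arg_eq_zero_iff.2 ⟨hr.le, i2⟩, arg_eq_zero_iff.2 ⟨this, i1⟩]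
      exact ⟨rfl, Or.inl rfl⟩
  · have p3 : 2 * n + 3 ∈ listPositions ω := ⟨by omega, hn⟩
    have p2 := listPositions_of_le p3 (by omega : 1 ≤ 2 * n + 2) (by omega)
    have k2 := hidx p2
    have k3 := hidx p3
    exact real_cross hd ha h p2 p3 (by omega)
  · have p : 1 ∈ listPositions ω := ⟨le_rfl, by exact_mod_cast h1⟩
    have k := hidx p
    obtain ⟨-, f2, -⟩ := real_zero_facts hd ha (h.eq_zero p)
    rw [show d.realIndex a (z 1) = 0 by omega] at f2
    simp only [Nat.cast_zero, zero_mul, Real.cos_zero, mul_one] at f2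
    rw [ofReal_re]
    linarith

/-! ### Imaginary `α`, by rotation to the reciprocal quotient -/

/-- The data of the reciprocal of the quotient, rotated by a right angle. -/
def swap (d : QuotientData) : QuotientData where
  ι := d.κ
  κ := d.ι
  x := d.y
  y := d.x
  x_pos := d.y_pos
  y_pos := d.x_pos
  x_summable := d.y_summable
  y_summable := d.x_summable
  m := d.n
  n := d.m
  exponents := d.exponents.symm.imp And.symm And.symm

/-- The substitution `z = i u` exchanges the factors `1 + x z²` and `1 - x u²`. Thus `F(i u) = b i`
becomes an equation for the reciprocal type of quotient with the real value `-1/b`. -/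
lemma H_rotate (hm : d.m = 0) {b : ℝ} (hb : b ≠ 0) (u : ℂ) :
    d.H (b * I) (I * u) = b * d.swap.H ((-b⁻¹ : ℝ) : ℂ) u := by
  have hn : d.n = 1 := by
    rcases d.exponents with h | h
    · exact h.2
    · omega
  have hbc : (b : ℂ) ≠ 0 := ofReal_ne_zero.2 hb
  simp only [H, P, Q, swap, hm, hn, mul_pow, I_sq, pow_zero, pow_one, one_mul, neg_mul, neg_neg]
  push_cast
  field_simp
  rw [I_sq]; ring

lemma analyticOrderAt_rotate (hm : d.m = 0) {b : ℝ} (hb : b ≠ 0) (u : ℂ) :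
    analyticOrderAt (d.H (b * I)) (I * u) = analyticOrderAt (d.swap.H ((-b⁻¹ : ℝ) : ℂ)) u := by
  rw [← analyticOrderAt_comp_mul_left I_ne_zero u]
  have : (fun z => d.H (b * I) (I * z)) = fun z => (b : ℂ) * d.swap.H ((-b⁻¹ : ℝ) : ℂ) z :=
    funext fun z => H_rotate hm hb z
  rw [this, analyticOrderAt_const_mul (d.swap.differentiable_H _) (ofReal_ne_zero.2 hb)]

/-- The level `0` contains a whole half-line of small radii, so it is not a single interior point; a
nonreal zero would force that. -/
lemma im_eq_zero_of_realIndex_eq_zero (hd : d.HasFactor) (hm : d.m = 1) {a : ℝ} (ha : a ≠ 0)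
    {w : ℂ} (hw : d.H a w = 0) (h0 : d.realIndex a w = 0) : w.im = 0 := by
  obtain ⟨f1, -, -, f4⟩ := real_zero_facts hd ha hw
  by_contra him
  obtain ⟨s, hs, hp, -⟩ := exists_level_start hd (abs_pos.2 ha) ⟨hm, h0⟩ (Real.log ‖w‖)
  exact (curve_eq_of_phase_eq hd (abs_pos.2 ha) hs.ne' (f1.trans hp.symm)).2 (f4 him)

lemma distributedImaginary (hd : d.HasFactor) (hm : d.m = 0) {b : ℝ} (hb : b ≠ 0)
    {ω : ℕ∞} {z : ℕ → ℂ} (h : IsZeroEnumeration (d.H (b * I)) ω z) :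
    DistributedImaginary (d.H (b * I)) (b * I) ω z := by
  have hd' : d.swap.HasFactor := hd.symm
  have hm' : d.swap.m = 1 := by
    rcases d.exponents with h | h
    · exact h.2
    · omega
  set a : ℝ := -b⁻¹ with ha_def
  have ha : a ≠ 0 := neg_ne_zero.2 (inv_ne_zero hb)
  obtain ⟨u, hu⟩ : ∃ u : ℕ → ℂ, ∀ n, z n = I * u n :=
    ⟨fun n => -I * z n, fun n => by rw [← mul_assoc]; simp⟩
  have hnorm : ∀ n, ‖z n‖ = ‖u n‖ := fun n => by rw [hu]; simp
  have hre : ∀ n, (z n).re = -(u n).im := fun n => by rw [hu]; simp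
  have him : ∀ n, (z n).im = (u n).re := fun n => by rw [hu]; simp
  have hU : IsZeroEnumeration (d.swap.H a) ω u := by
    refine ⟨fun n h1 h2 => by rw [← hnorm, ← hnorm]; exact h.1 n h1 h2, fun w => ?_⟩
    rw [← analyticOrderAt_rotate hm hb, ← h.2 (I * w)]
    congr 1
    ext n
    simp only [Set.mem_ofPred_eq, hu, mul_right_inj' I_ne_zero]
  have hidx : ∀ {n}, n ∈ listPositions ω →
      n ≤ 2 * d.swap.realIndex a (u n) + 1 ∧ 2 * d.swap.realIndex a (u n) ≤ n := fun {n} hn => by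
    have := real_index_bounds hd' ha hU hn
    rw [sum_levelSize_high hm'] at this
    refine ⟨this.2, ?_⟩
    -- The level `0` has size `1`, so for `k ≥ 1` the levels below `k` hold `2k - 1` zeros. Position
    -- `1` has index `0`, and positions `2k`, `2k + 1` have index `k`.
    rcases Nat.eq_zero_or_pos (d.swap.realIndex a (u n)) with h0 | h0
    · omega
    · obtain ⟨K, hK⟩ := Nat.exists_eq_succ_of_ne_zero h0.ne'
      rw [hK, sum_levelSize_high hm'] at this
      omega
  refine ⟨fun w hw => ?_, fun n hn => ?_, fun n hn => ?_, fun h1 => ?_⟩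
  · obtain ⟨v, rfl⟩ : ∃ v, w = I * v := ⟨-I * w, by rw [← mul_assoc]; simp⟩
    rw [H_rotate hm hb] at hw
    have hv := (mul_eq_zero.1 hw).resolve_left (ofReal_ne_zero.2 hb)
    obtain ⟨r1, r2, r3⟩ := real_order hd' ha hv
    rw [analyticOrderAt_rotate hm hb]
    refine ⟨by simpa using r1, fun h0 => r2 (by simpa using h0), fun h0 => r3 (by simpa using h0)⟩
  · have p3 : 2 * n + 3 ∈ listPositions ω := ⟨by omega, hn⟩
    have p2 := listPositions_of_le p3 (by omega : 1 ≤ 2 * n + 2) (by omega)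
    have k2 := hidx p2
    have k3 := hidx p3
    obtain ⟨b1, b2, b3⟩ := real_pair hd' ha hU (by omega) (by omega) p3
      (by omega : d.swap.realIndex a (u (2 * n + 2)) = d.swap.realIndex a (u (2 * n + 3)))
    rw [hnorm, hnorm]
    refine ⟨b1, fun he => ?_, fun hlt => ?_⟩
    · rw [hu, hu, b2 he]; simp
    · obtain ⟨i1, i2, hpos⟩ := b3 hlt
      have e1 : (z (2 * n + 2)).re = 0 := by rw [hre, i1, neg_zero]
      have e2 : (z (2 * n + 3)).re = 0 := by rw [hre, i2, neg_zero]
      rw [← him, ← him] at hpos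
      rcases lt_trichotomy (z (2 * n + 3)).im 0 with hr | hr | hr
      · have : (z (2 * n + 2)).im < 0 := by
          by_contra! hh
          nlinarith
        rw [arg_eq_neg_pi_div_two_iff.2 ⟨e1, this⟩, arg_eq_neg_pi_div_two_iff.2 ⟨e2, hr⟩]
        exact ⟨rfl, Or.inl rfl⟩
      · rw [hr, mul_zero] at hpos
        exact absurd hpos (lt_irrefl _)
      · have : 0 < (z (2 * n + 2)).im := by
          by_contra! hh
          nlinarith
        rw [arg_eq_pi_div_two_iff.2 ⟨e1, this⟩, arg_eq_pi_div_two_iff.2 ⟨e2, hr⟩]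
        exact ⟨rfl, Or.inr rfl⟩
  · have p2 : 2 * n + 2 ∈ listPositions ω := ⟨by omega, hn⟩
    have p1 := listPositions_of_le p2 (by omega : 1 ≤ 2 * n + 1) (by omega)
    have k1 := hidx p1
    have k2 := hidx p2
    rw [hnorm, hnorm, him, him]
    exact real_cross hd' ha hU p1 p2 (by omega)
  · have p : 1 ∈ listPositions ω := ⟨le_rfl, by exact_mod_cast h1⟩
    have k := hidx p
    have k0 : d.swap.realIndex a (u 1) = 0 := by omega
    obtain ⟨-, f2, -⟩ := real_zero_facts hd' ha (hU.eq_zero p)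
    rw [k0] at f2
    simp only [Nat.cast_zero, zero_mul, Real.cos_zero, mul_one] at f2
    rw [him, hre, im_eq_zero_of_realIndex_eq_zero hd' hm' ha (hU.eq_zero p) k0, neg_zero]
    refine ⟨?_, rfl⟩
    have e : ((b : ℂ) * I).im = b := by simp
    rw [e]
    have hb2 : 0 < b * b := mul_self_pos.2 hb
    -- From `a = -1/b`: positivity of `a · Re u₁` becomes negativity of `b · Im z₁`.
    have : b * (u 1).re = -((u 1).re * a) * (b * b) := by rw [ha_def]; field_simp
    rw [this]
    nlinarith

end QuotientData

/-! ### Reduction of the twisted series to a quotient -/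

lemma I_pow_odd_twist (n : ℕ) : I ^ ((2 * n + 1) * (2 * n + 1 - 1) / 2) = (-I) ^ n := by
  rw [show (2 * n + 1) * (2 * n + 1 - 1) / 2 = n * (2 * n + 1) by
    rw [Nat.add_sub_cancel, show (2 * n + 1) * (2 * n) = 2 * (n * (2 * n + 1)) by ring]; omega]
  induction n with
  | zero => simp
  | succ k ih =>
    rw [show (k + 1) * (2 * (k + 1) + 1) = k * (2 * k + 1) + (4 * k + 3) by ring, pow_add, ih,
      pow_add, pow_mul, I_pow_four, one_pow, one_mul, I_pow_three, pow_succ]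

lemma I_pow_even_twist (n : ℕ) : I ^ (2 * n * (2 * n - 1) / 2) = I ^ n := by
  rcases n with _ | n
  · simp
  · rw [show 2 * (n + 1) * (2 * (n + 1) - 1) / 2
        = (2 * n + 1) * (2 * n + 1 - 1) / 2 + 2 * n + 1 by
      rw [Nat.add_sub_cancel, show 2 * (n + 1) - 1 = 2 * n + 1 by omega,
        show (2 * n + 1) * (2 * n) = 2 * (n * (2 * n + 1)) by ring,
        show 2 * (n + 1) * (2 * n + 1) = 2 * (n * (2 * n + 1) + 2 * n + 1) by ring]
      omega, pow_succ, pow_add, I_pow_odd_twist, pow_mul, ← mul_pow, I_sq, pow_succ]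
    simp

/-- The twisting factor is `i^n` at the index `2n` and `(-i)^n` at `2n + 1`, so the even and odd
parts are again values of `f` and `g`. At `conj μ · z`, where `(conj μ)² = -i`, the arguments become
`z²` and `-z²`. -/
lemma twistedSeries_eq {c : ℕ → ℂ} {f g : ℂ → ℂ}
    (hf : ∀ z, HasSum (fun n : ℕ => c (2 * n) * z ^ n) (f z))
    (hg : ∀ z, HasSum (fun n : ℕ => c (2 * n + 1) * z ^ n) (g z)) (w : ℂ) :
    twistedSeries c w = f (I * w ^ 2) + w * g (-I * w ^ 2) := by
  refine HasSum.tsum_eq (HasSum.even_add_odd ?_ ?_)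
  · convert hf (I * w ^ 2) using 2 with n
    rw [I_pow_even_twist, mul_pow, pow_mul]; ring
  · refine ((hg (-I * w ^ 2)).mul_left w).congr_fun fun n => ?_
    rw [I_pow_odd_twist, mul_pow, pow_succ, pow_mul]; ring

lemma twistedSeriesBar_eq {c : ℕ → ℂ} {f g : ℂ → ℂ}
    (hf : ∀ z, HasSum (fun n : ℕ => c (2 * n) * z ^ n) (f z))
    (hg : ∀ z, HasSum (fun n : ℕ => c (2 * n + 1) * z ^ n) (g z)) (w : ℂ) :
    twistedSeriesBar c w = f (-I * w ^ 2) + w * g (I * w ^ 2) := by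
  refine HasSum.tsum_eq (HasSum.even_add_odd ?_ ?_)
  · convert hf (-I * w ^ 2) using 2 with n
    rw [I_pow_even_twist, mul_pow, pow_mul, ← inv_pow, inv_I]; ring
  · refine ((hg (I * w ^ 2)).mul_left w).congr_fun fun n => ?_
    rw [I_pow_odd_twist, mul_pow, pow_succ, pow_mul, ← inv_pow, inv_neg, inv_I, neg_neg]; ring

/-- There is no power of `z` since `0` is not a negative zero; the parameters are `x_i = -1 / a_i`
for the zeros `a_i`. -/
lemma eq_genusProd_of_negative_zeros {f : ℂ → ℂ} (hf : IsEntireGenusZero f)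
    (hneg : HasOnlyNegativeZeros f) :
    ∃ (ι : Type) (x : ι → ℝ), (∀ i, 0 < x i) ∧ Summable x ∧ f 0 ≠ 0 ∧
      ∀ z, f z = f 0 * genusProd x z := by
  obtain ⟨C, m, ι, a, hC, ha, hs, hfa⟩ := hf
  have h0 : f 0 ≠ 0 := fun h => by
    obtain ⟨x, hx, e⟩ := hneg 0 h
    exact hx.ne' (by exact_mod_cast e)
  have hm : m = 0 := by
    by_contra hm
    exact h0 (by rw [hfa, zero_pow hm, mul_zero, zero_mul])
  subst hm
  have hzero : ∀ i, ∃ t : ℝ, t < 0 ∧ a i = t := fun i => hneg (a i) <| by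
    rw [hfa, tprod_of_exists_eq_zero ⟨i, by rw [div_self (ha i), sub_self]⟩, mul_zero]
  choose t ht hat using hzero
  have hfx : ∀ z, f z = C * genusProd (fun i => (-t i)⁻¹) z := fun z => by
    rw [hfa, pow_zero, mul_one, genusProd]
    congr 2 with i
    rw [hat]; push_cast; rw [inv_neg]; ring
  refine ⟨ι, fun i => (-t i)⁻¹, fun i => inv_pos.2 (neg_pos.2 (ht i)), ?_, h0, fun z => ?_⟩
  · convert hs using 2 with i
    rw [hat, norm_real, Real.norm_eq_abs, abs_of_neg (ht i)]
  · rw [hfx, hfx 0, genusProd_zero, mul_one]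

lemma zerosDistributed_const_mul {H : ℂ → ℂ} (hH : Differentiable ℂ H) {C α : ℂ} (hC : C ≠ 0)
    (h : ZerosDistributed H α) : ZerosDistributed (fun z => C * H z) α := by
  have ho : ∀ w, analyticOrderAt (fun z => C * H z) w = analyticOrderAt H w :=
    analyticOrderAt_const_mul hH hC
  simpa only [ZerosDistributed, IsZeroEnumeration, DistributedGeneric, DistributedReal,
    DistributedImaginary, ho, mul_eq_zero, hC, false_or] using h

/-! ### The quotient without factors, and the conclusion -/

namespace QuotientData
variable {d : QuotientData}

lemma H_of_not_hasFactor (hd : ¬ d.HasFactor) (hm : d.m = 0) (α z : ℂ) :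
    d.H α z = 1 - α * z := by
  obtain ⟨hι, hκ⟩ := not_or.1 hd
  have := not_nonempty_iff.1 hι
  have := not_nonempty_iff.1 hκ
  have hn : d.n = 1 := by rcases d.exponents with h | h <;> omega
  rw [H, P, Q, hm, hn, genusProd_of_isEmpty, genusProd_of_isEmpty]; ring

lemma analyticOrderAt_of_not_hasFactor (hd : ¬ d.HasFactor) (hm : d.m = 0) {α w : ℂ} (hα : α ≠ 0)
    (hw : d.H α w = 0) : analyticOrderAt (d.H α) w = 1 := by
  refine ((d.differentiable_H α).analyticAt w).analyticOrderAt_eq_one_of_zero_deriv_ne_zero hw ?_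
  have : d.H α = fun z => 1 - α * z := funext (H_of_not_hasFactor hd hm α)
  simp [this, hα]

lemma zero_of_not_hasFactor (hd : ¬ d.HasFactor) (hm : d.m = 0) {α w : ℂ}
    (hw : d.H α w = 0) : w = α⁻¹ := by
  rw [H_of_not_hasFactor hd hm, sub_eq_zero] at hw
  exact eq_inv_of_mul_eq_one_right hw.symm

lemma inv_signs {α : ℂ} (hα : α ≠ 0) :
    (α⁻¹).re = α.re * (normSq α)⁻¹ ∧ (α⁻¹).im = -α.im * (normSq α)⁻¹ ∧ 0 < (normSq α)⁻¹ :=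
  ⟨inv_re α, inv_im α, inv_pos.2 (normSq_pos.2 hα)⟩

/-- Here the strict monotonicity fails, but the function is `1 - α z` with the single simple zero `1
/ α`, so only the assertions on `z 1` have content. -/
lemma distributed_of_not_hasFactor (hd : ¬ d.HasFactor) (hm : d.m = 0) {α : ℂ} (hα : α ≠ 0)
    {ω : ℕ∞} {z : ℕ → ℂ} (h : IsZeroEnumeration (d.H α) ω z) :
    ((α ^ 2).im ≠ 0 → DistributedGeneric (d.H α) α ω z) ∧
    (α.im = 0 → DistributedReal (d.H α) α ω z) ∧
    (α.re = 0 → DistributedImaginary (d.H α) α ω z) := by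
  have hz : ∀ {w}, d.H α w = 0 → w = α⁻¹ := zero_of_not_hasFactor hd hm
  have ho : ∀ {w}, d.H α w = 0 → analyticOrderAt (d.H α) w = 1 :=
    analyticOrderAt_of_not_hasFactor hd hm hα
  have hshort : ∀ n : ℕ, 1 ≤ n → ¬ ((n + 1 : ℕ) : ℕ∞) ≤ ω := by
    intro n hn hle
    have p' : n + 1 ∈ listPositions ω := ⟨by omega, hle⟩
    have p : n ∈ listPositions ω := listPositions_of_le p' hn (Nat.le_succ n)
    have := h.two_le_order p p' (Nat.lt_succ_self n).ne
      ((hz (h.eq_zero p)).trans (hz (h.eq_zero p')).symm)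
    rw [ho (h.eq_zero p')] at this
    exact absurd this (by decide)
  have hfirst : 1 ≤ ω → z 1 = α⁻¹ := fun h1 => hz (h.eq_zero ⟨le_rfl, by exact_mod_cast h1⟩)
  obtain ⟨hre, him, hN⟩ := inv_signs hα
  refine ⟨fun hα2 => ⟨fun w hw => ⟨ne_zero_of_H hα hw, ho hw, ?_⟩,
      fun n hn hle => absurd hle (hshort n hn), fun h1 => ?_⟩,
    fun hi => ⟨fun w hw => ⟨?_, fun _ => Or.inl (ho hw), fun _ => ho hw⟩,
      fun n hle => absurd hle (hshort _ (by omega)),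
      fun n hle => absurd hle (hshort _ (by omega)), fun h1 => ?_⟩,
    fun hr => ⟨fun w hw => ⟨?_, fun _ => Or.inl (ho hw), fun _ => ho hw⟩,
      fun n hle => absurd hle (hshort _ (by omega)),
      fun n hle => absurd hle (hshort _ (by omega)), fun h1 => ?_⟩⟩
  · rw [sq_im] at hα2 ⊢
    rw [hz hw, hre, him]
    have h1 := left_ne_zero_of_mul (right_ne_zero_of_mul hα2)
    have h2 := right_ne_zero_of_mul (right_ne_zero_of_mul hα2)
    exact mul_ne_zero two_ne_zero (mul_ne_zero (mul_ne_zero h1 hN.ne')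
      (mul_ne_zero (neg_ne_zero.2 h2) hN.ne'))
  · rw [sq_im] at hα2 ⊢
    rw [hfirst h1, hre, him]
    have h1 := left_ne_zero_of_mul (right_ne_zero_of_mul hα2)
    have h2 := right_ne_zero_of_mul (right_ne_zero_of_mul hα2)
    constructor
    · linarith [mul_pos (pow_pos (abs_pos.2 h2) 2) hN, sq_abs α.im,
        show α.im * (-α.im * (normSq α)⁻¹) = -(|α.im| ^ 2 * (normSq α)⁻¹) by rw [sq_abs]; ring]
    · rw [show 2 * (α.re * α.im) * (α.re * (normSq α)⁻¹) * (-α.im * (normSq α)⁻¹)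
        = -(2 * (α.re * α.im * (normSq α)⁻¹) ^ 2) by ring]
      have := mul_ne_zero (mul_ne_zero h1 h2) hN.ne'
      exact neg_neg_of_pos (by positivity)
  · have hr : α.re ≠ 0 := fun hr => hα (Complex.ext hr hi)
    rw [hz hw, hre]; exact mul_ne_zero hr hN.ne'
  · have hr : α.re ≠ 0 := fun hr => hα (Complex.ext hr hi)
    rw [hfirst h1, hre, ← mul_assoc]
    exact mul_pos (mul_self_pos.2 hr) hN
  · have hi : α.im ≠ 0 := fun hi => hα (Complex.ext hr hi)
    rw [hz hw, him]; exact mul_ne_zero (neg_ne_zero.2 hi) hN.ne'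
  · have hi : α.im ≠ 0 := fun hi => hα (Complex.ext hr hi)
    rw [hfirst h1, hre, him, hr, zero_mul, ← mul_assoc, mul_neg, neg_mul]
    exact ⟨neg_neg_of_pos (mul_pos (mul_self_pos.2 hi) hN), rfl⟩

lemma zerosDistributed (hm : d.m = 0) {α : ℂ} (hα : α ≠ 0) : ZerosDistributed (d.H α) α := by
  refine ⟨exists_isZeroEnumeration (d.differentiable_H α) (analyticOrderAt_H_ne_top hα),
    fun ω z h => ?_⟩
  by_cases hd : d.HasFactor
  · refine ⟨fun h2 => distributedGeneric hd hm h2 h, fun hi => ?_, fun hr => ?_⟩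
    · obtain ⟨a, rfl⟩ : ∃ a : ℝ, α = a := ⟨α.re, Complex.ext rfl (by simp [hi])⟩
      exact distributedReal hd hm (ofReal_ne_zero.1 hα) h
    · obtain ⟨b, rfl⟩ : ∃ b : ℝ, α = b * I := ⟨α.im, Complex.ext (by simp [hr]) (by simp)⟩
      exact distributedImaginary hd hm (ofReal_ne_zero.1 (left_ne_zero_of_mul hα)) h
  · exact distributed_of_not_hasFactor hd hm hα h

end QuotientData

/-- The zeros of `f (z²) + ν z g (-z²)` for functions `f`, `g` of genus zero with negative zeros. -/
lemma zerosDistributed_of_negative_zeros {f g : ℂ → ℂ} (hf : IsEntireGenusZero f)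
    (hg : IsEntireGenusZero g) (hf_neg : HasOnlyNegativeZeros f) (hg_neg : HasOnlyNegativeZeros g)
    {ν : ℂ} (hν : ν ≠ 0) :
    ZerosDistributed (fun z => f (z ^ 2) + ν * z * g (-z ^ 2)) (-(ν * g 0 / f 0)) := by
  obtain ⟨ι, x, hx, hxs, f0, ef⟩ := eq_genusProd_of_negative_zeros hf hf_neg
  obtain ⟨κ, y, hy, hys, g0, eg⟩ := eq_genusProd_of_negative_zeros hg hg_neg
  -- With `F = z⁻¹ ∏ (1 + x z²) / ∏ (1 - y z²)`, the function is `f 0 · (P - α Q)` for `α = -ν g(0)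
  -- / f(0)`.
  let d : QuotientData := ⟨ι, κ, x, y, hx, hy, hxs, hys, 0, 1, Or.inl ⟨rfl, rfl⟩⟩
  have key := zerosDistributed_const_mul (d.differentiable_H _) f0 (d.zerosDistributed rfl
    (neg_ne_zero.2 (div_ne_zero (mul_ne_zero hν g0) f0)))
  convert key using 2 with z
  rw [ef (z ^ 2), eg (-z ^ 2), QuotientData.H, QuotientData.P, QuotientData.Q]
  simp only [d]
  field_simp
  ring

theorem mainTheorem10 (c : ℕ → ℂ) (f g : ℂ → ℂ)
    (hf : ∀ z, HasSum (fun n : ℕ => c (2 * n) * z ^ n) (f z))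
    (hg : ∀ z, HasSum (fun n : ℕ => c (2 * n + 1) * z ^ n) (g z))
    (hf_genus : IsEntireGenusZero f) (hg_genus : IsEntireGenusZero g)
    (hf_neg : HasOnlyNegativeZeros f) (hg_neg : HasOnlyNegativeZeros g)
    (μ : ℂ) (hμ : μ ^ 2 = I) :
    ZerosDistributed (fun z => twistedSeries c ((starRingEnd ℂ) μ * z))
      (-((starRingEnd ℂ) μ * c 1 / c 0)) ∧
    ZerosDistributed (fun z => twistedSeriesBar c (μ * z)) (-(μ * c 1 / c 0)) := by
  have f0 : f 0 = c 0 := (hf 0).unique (by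
    simpa using hasSum_single (f := fun n : ℕ => c (2 * n) * (0 : ℂ) ^ n) 0
      fun n hn => by simp [hn])
  have g0 : g 0 = c 1 := (hg 0).unique (by
    simpa using hasSum_single (f := fun n : ℕ => c (2 * n + 1) * (0 : ℂ) ^ n) 0
      fun n hn => by simp [hn])
  have hμ0 : μ ≠ 0 := by rintro rfl; exact I_ne_zero (by rw [← hμ]; simp)
  have hμc : (starRingEnd ℂ) μ ^ 2 = -I := by rw [← map_pow, hμ, conj_I]
  rw [← f0, ← g0]
  constructor
  · convert zerosDistributed_of_negative_zeros hf_genus hg_genus hf_neg hg_neg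
      ((map_ne_zero (starRingEnd ℂ)).2 hμ0) using 2 with z
    rw [twistedSeries_eq hf hg, mul_pow, hμc, ← mul_assoc, ← mul_assoc, mul_neg, neg_mul_neg,
      I_mul_I, neg_neg, one_mul, neg_one_mul]
  · convert zerosDistributed_of_negative_zeros hf_genus hg_genus hf_neg hg_neg hμ0 using 2 with z
    rw [twistedSeriesBar_eq hf hg, mul_pow, hμ, ← mul_assoc, ← mul_assoc, neg_mul, I_mul_I,
      neg_neg, one_mul, neg_one_mul]
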